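/- A finite set $X\subset\mathbb{R}^3$ is in general position if no $3$ points of $X$ are collinear, no $4$ are coplanar, no $6$ lie in the union of two orthogonal planes, and no $7$ lie in the union of three mutually orthogonal planes. Let $X$ be a set of $8n$ points. An orthogonal equipartition of $X$ is an (unordered) partition of $X$ into $8$ parts of $n$ points each such that there exist three mutually orthogonal planes $H_1,H_2,H_3$ and a bijection between the $8$ parts and the $8$ closed regions $\overline{H_1^{s_1}}\cap\overline{H_2^{s_2}}\cap\overline{H_3^{s_3}}$, $s_i\in\{+,-\}$, for which each part is contained in its region; here $H_i^{+}$ and $H_i^{-}$ are the open half-spaces bounded by $H_i$. Theorem. On a real random access machine (unit-cost exact real arithmetic $+,-,\times,\div,\sqrt{\phantom{x}}$, comparisons, and indirectly addressed memory) the set of all orthogonal equipartitions of a set of $8n$ points in general position can be found in time $O(n^7)$. That is, there are one program and one constant $C$ such that for every $n\ge 1$ and every set $X\subset\mathbb{R}^3$ of $8n$ points in general position, given in any order by their coordinates, the program halts after at most $Cn^7$ steps and has then listed every orthogonal equipartition of $X$ exactly once, and nothing else. -/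

import Mathlib

/-! ## Geometry -/

/-- Euclidean three-space. -/
abbrev E3 : Type := EuclideanSpace ℝ (Fin 3)

/-- An oriented plane `{x | ⟪normal, x⟫ = offset}` in three-space. -/
structure OrientedPlane where
  normal : E3
  offset : ℝ
  normal_ne_zero : normal ≠ 0

namespace OrientedPlane

/-- The points of the plane. -/
def carrier (H : OrientedPlane) : Set E3 := {x | inner ℝ H.normal x = H.offset}

/-- The two open half-spaces bounded by the plane: `true` is the positive one. -/
def side (H : OrientedPlane) : Bool → Set E3
  | true => {x | H.offset < inner ℝ H.normal x}
  | false => {x | inner ℝ H.normal x < H.offset}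

/-- The planes of the family are mutually orthogonal. -/
def MutuallyOrthogonal {k : ℕ} (H : Fin k → OrientedPlane) : Prop :=
  ∀ i j : Fin k, i ≠ j → inner ℝ (H i).normal (H j).normal = 0

/-- The closed region on the prescribed sides of the three planes. -/
def region (H : Fin 3 → OrientedPlane) (s : Fin 3 → Bool) : Set E3 :=
  ⋂ i, closure ((H i).side (s i))

theorem closure_side_true (H : OrientedPlane) :
    closure (H.side true) = {x | H.offset ≤ inner ℝ H.normal x} := by
  have hc : Continuous fun x : E3 => inner ℝ H.normal x := by fun_prop
  apply Set.Subset.antisymm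
  · refine closure_minimal (fun x hx => ?_) (isClosed_le continuous_const hc)
    have hx' : H.offset < inner ℝ H.normal x := hx
    exact hx'.le
  · intro x hx
    have hn : 0 < inner ℝ H.normal H.normal := real_inner_self_pos.2 H.normal_ne_zero
    have ht : Filter.Tendsto (fun t : ℝ => x + t • H.normal) (nhdsWithin 0 (Set.Ioi 0))
        (nhds x) := by
      have h : Continuous fun t : ℝ => x + t • H.normal := by fun_prop
      have h0 := h.tendsto 0
      simp only [zero_smul, add_zero] at h0
      exact h0.mono_left nhdsWithin_le_nhds
    refine mem_closure_of_tendsto ht ?_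
    filter_upwards [self_mem_nhdsWithin] with t (h0 : 0 < t)
    have hx' : H.offset ≤ inner ℝ H.normal x := hx
    change H.offset < inner ℝ H.normal (x + t • H.normal)
    rw [inner_add_right, real_inner_smul_right]
    linarith [mul_pos h0 hn]

theorem closure_side_false (H : OrientedPlane) :
    closure (H.side false) = {x | inner ℝ H.normal x ≤ H.offset} := by
  have h := closure_side_true ⟨-H.normal, -H.offset, neg_ne_zero.2 H.normal_ne_zero⟩
  simpa [side, inner_neg_left] using h

end OrientedPlane

/-- General position: no 3 points on a line, no 4 on a plane, no 6 on the union of two orthogonal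
planes, and no 7 on the union of three mutually orthogonal planes. -/
def InGeneralPosition (X : Finset E3) : Prop :=
  (∀ s ⊆ X, s.card = 3 → ¬ Collinear ℝ (s : Set E3)) ∧
  (∀ s ⊆ X, s.card = 4 → ¬ Coplanar ℝ (s : Set E3)) ∧
  (∀ s ⊆ X, s.card = 6 → ∀ H : Fin 2 → OrientedPlane, OrientedPlane.MutuallyOrthogonal H →
    ¬ (s : Set E3) ⊆ ⋃ i, (H i).carrier) ∧
  (∀ s ⊆ X, s.card = 7 → ∀ H : Fin 3 → OrientedPlane, OrientedPlane.MutuallyOrthogonal H →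
    ¬ (s : Set E3) ⊆ ⋃ i, (H i).carrier)

/-- The partition `P` of `X` consists of 8 parts of `n` points each, and there are three mutually
orthogonal planes and a bijection from the parts to the 8 closed regions of these planes such that
every part lies in its region. -/
def IsOrthogonalEquipartition (n : ℕ) {X : Finset E3} (P : Finpartition X) : Prop :=
  P.parts.card = 8 ∧ (∀ A ∈ P.parts, A.card = n) ∧
  ∃ H : Fin 3 → OrientedPlane, OrientedPlane.MutuallyOrthogonal H ∧
    ∃ e : {A // A ∈ P.parts} ≃ (Fin 3 → Bool),
      ∀ A : {A // A ∈ P.parts}, (A.val : Set E3) ⊆ OrientedPlane.region H (e A)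

/-! ## The real random access machine

Programs are structured (sequence, branching, loop). A state has registers and an unbounded memory
for natural numbers, registers and an unbounded memory for real numbers, and a write-only output
tape of natural numbers. The memories are addressed through natural number registers; a real number
is never converted into a natural number. Every elementary instruction and every test of a
comparison takes one step. Natural numbers are only copied, compared, and increased or decreased by
one, so that in `t` steps they cannot exceed the input size or the constants of the program by more
than `t`. -/

namespace RealRAM

/-- States of the machine. -/
structure State where
  ireg : ℕ → ℕ
  imem : ℕ → ℕ
  rreg : ℕ → ℝ
  rmem : ℕ → ℝ
  out : List ℕ

/-- Exact binary arithmetic of real numbers. -/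
inductive ArithOp where
  | add | sub | mul | div

/-- The value of an arithmetic operation (a division by zero yields zero). -/
noncomputable def ArithOp.eval : ArithOp → ℝ → ℝ → ℝ
  | add, u, v => u + v
  | sub, u, v => u - v
  | mul, u, v => u * v
  | div, u, v => u / v

/-- Elementary instructions; `a`, `b`, `c` are numbers of registers. -/
inductive Instr where
  /-- write the constant `k` into the integer register `a` -/
  | iconst (a k : ℕ)
  /-- copy the integer register `b` to `a` -/
  | icopy (a b : ℕ)
  /-- increase the integer register `a` by one -/
  | isucc (a : ℕ)
  /-- decrease the integer register `a` by one, unless it is zero -/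
  | ipred (a : ℕ)
  /-- read the integer memory cell, whose address is in `b`, into `a` -/
  | iload (a b : ℕ)
  /-- write the integer register `b` to the integer memory cell whose address is in `a` -/
  | istore (a b : ℕ)
  /-- write the integer constant `k` into the real register `a` -/
  | rconst (a : ℕ) (k : ℤ)
  /-- copy the real register `b` to `a` -/
  | rcopy (a b : ℕ)
  /-- apply an arithmetic operation to the real registers `b` and `c`, with the result in `a` -/
  | rarith (o : ArithOp) (a b c : ℕ)
  /-- write the square root of the real register `b` (zero if it is negative) into `a` -/
  | rsqrt (a b : ℕ)
  /-- read the real memory cell, whose address is in the integer register `b`, into `a` -/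
  | rload (a b : ℕ)
  /-- write the real register `b` to the real memory cell whose address is in the integer
  register `a` -/
  | rstore (a b : ℕ)
  /-- append the integer register `a` to the output -/
  | print (a : ℕ)

/-- The effect of an elementary instruction. -/
noncomputable def Instr.apply : Instr → State → State
  | iconst a k, s => { s with ireg := Function.update s.ireg a k }
  | icopy a b, s => { s with ireg := Function.update s.ireg a (s.ireg b) }
  | isucc a, s => { s with ireg := Function.update s.ireg a (s.ireg a + 1) }
  | ipred a, s => { s with ireg := Function.update s.ireg a (s.ireg a - 1) }
  | iload a b, s => { s with ireg := Function.update s.ireg a (s.imem (s.ireg b)) }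
  | istore a b, s => { s with imem := Function.update s.imem (s.ireg a) (s.ireg b) }
  | rconst a k, s => { s with rreg := Function.update s.rreg a (k : ℝ) }
  | rcopy a b, s => { s with rreg := Function.update s.rreg a (s.rreg b) }
  | rarith o a b c, s => { s with rreg := Function.update s.rreg a (o.eval (s.rreg b) (s.rreg c)) }
  | rsqrt a b, s => { s with rreg := Function.update s.rreg a (Real.sqrt (s.rreg b)) }
  | rload a b, s => { s with rreg := Function.update s.rreg a (s.rmem (s.ireg b)) }
  | rstore a b, s => { s with rmem := Function.update s.rmem (s.ireg a) (s.rreg b) }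
  | print a, s => { s with out := s.out ++ [s.ireg a] }

/-- Tests: comparison of two integer registers or of two real registers. -/
inductive Test where
  | ilt (a b : ℕ)
  | rlt (a b : ℕ)

/-- The test succeeds in the given state. -/
def Test.Holds : Test → State → Prop
  | ilt a b, s => s.ireg a < s.ireg b
  | rlt a b, s => s.rreg a < s.rreg b

/-- Programs. -/
inductive Prog where
  | instr (i : Instr)
  | seq (p q : Prog)
  | ite (c : Test) (p q : Prog)
  | loop (c : Test) (p : Prog)

/-- `p.Runs s t s'`: started in the state `s`, the program `p` halts after exactly `t` steps in the
state `s'`. The program `loop c p` repeats `p` as long as `c` holds. -/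
inductive Prog.Runs : Prog → State → ℕ → State → Prop where
  | instr (i : Instr) (s : State) : Prog.Runs (.instr i) s 1 (i.apply s)
  | seq {p q : Prog} {s s' s'' : State} {t t' : ℕ} :
      Prog.Runs p s t s' → Prog.Runs q s' t' s'' → Prog.Runs (.seq p q) s (t + t') s''
  | ite_true {c : Test} {p q : Prog} {s s' : State} {t : ℕ} :
      c.Holds s → Prog.Runs p s t s' → Prog.Runs (.ite c p q) s (t + 1) s'
  | ite_false {c : Test} {p q : Prog} {s s' : State} {t : ℕ} :
      ¬ c.Holds s → Prog.Runs q s t s' → Prog.Runs (.ite c p q) s (t + 1) s'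
  | loop_done {c : Test} {p : Prog} {s : State} :
      ¬ c.Holds s → Prog.Runs (.loop c p) s 1 s
  | loop_step {c : Test} {p : Prog} {s s' s'' : State} {t t' : ℕ} :
      c.Holds s → Prog.Runs p s t s' → Prog.Runs (.loop c p) s' t' s'' →
      Prog.Runs (.loop c p) s (t + t' + 1) s''

/-- The machine is deterministic: step count and final state are functions of the start. -/
theorem Prog.Runs.unique {p : Prog} {s s₁ : State} {t₁ : ℕ} (h₁ : p.Runs s t₁ s₁) :
    ∀ {s₂ : State} {t₂ : ℕ}, p.Runs s t₂ s₂ → t₁ = t₂ ∧ s₁ = s₂ := by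
  induction h₁ with
  | instr i s => intro s₂ t₂ h; cases h; exact ⟨rfl, rfl⟩
  | seq _ _ ih ih' =>
    intro s₂ t₂ h
    cases h with
    | seq h h' =>
      obtain ⟨rfl, rfl⟩ := ih h
      obtain ⟨rfl, rfl⟩ := ih' h'
      exact ⟨rfl, rfl⟩
  | ite_true hc _ ih =>
    intro s₂ t₂ h
    cases h with
    | ite_true _ h => obtain ⟨rfl, rfl⟩ := ih h; exact ⟨rfl, rfl⟩
    | ite_false hn _ => exact absurd hc hn
  | ite_false hc _ ih =>
    intro s₂ t₂ h
    cases h with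
    | ite_true hn _ => exact absurd hn hc
    | ite_false _ h => obtain ⟨rfl, rfl⟩ := ih h; exact ⟨rfl, rfl⟩
  | loop_done hc =>
    intro s₂ t₂ h
    cases h with
    | loop_done _ => exact ⟨rfl, rfl⟩
    | loop_step hn _ _ => exact absurd hn hc
  | loop_step hc _ _ ih ih' =>
    intro s₂ t₂ h
    cases h with
    | loop_done hn => exact absurd hc hn
    | loop_step _ h h' =>
      obtain ⟨rfl, rfl⟩ := ih h
      obtain ⟨rfl, rfl⟩ := ih' h'
      exact ⟨rfl, rfl⟩

/-- The start on the list `x` of `N` points: the integer register 0 holds `N`, the cell `3 * j + k`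
of the real memory holds the coordinate number `k` of the point number `j`, and everything else is
zero or empty. -/
noncomputable def State.input {N : ℕ} (x : Fin N → E3) : State where
  ireg := fun a => if a = 0 then N else 0
  imem := fun _ => 0
  rreg := fun _ => 0
  rmem := fun a => if h : a / 3 < N then x ⟨a / 3, h⟩ ⟨a % 3, Nat.mod_lt a (by norm_num)⟩ else 0
  out := []

end RealRAM

/-- The 8 blocks of points that carry the labels 0, …, 7. -/
noncomputable def labelBlocks {N : ℕ} (x : Fin N → E3) (w : Fin N → Fin 8) : Finset (Finset E3) :=
  Finset.univ.image fun k : Fin 8 => (Finset.univ.filter fun j : Fin N => w j = k).image x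

/-- The tape `out` lists the partitions `L` one after the other. Each partition is written as a word
of `N` labels from 0, …, 7, one for each point, and two points are in the same part exactly if they
have the same label. -/
def ListsPartitions {N : ℕ} (x : Fin N → E3) (out : List ℕ) {X : Finset E3}
    (L : List (Finpartition X)) : Prop :=
  ∃ W : List (Fin N → Fin 8),
    out = W.flatMap (fun w => List.ofFn fun j => (w j : ℕ)) ∧
    W.map (labelBlocks x) = L.map fun P => P.parts

/-! The sign pattern of an equipartition constrains only the normals: if every point of one class
lies on the positive side of a plane with normal `n` and every point of the other class on the
negative side, then `n ⬝ᵥ (a - b) ≥ 0` for all differences across the plane. Conversely, these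
inequalities allow the plane to be put through an extreme point. Hence the orthogonal frames that
realize a given partition form a set cut out by finitely many linear inequalities on the three
normals.

Orthogonal frames have three degrees of freedom. Starting from a feasible frame, one moves along a
path that keeps the equalities already reached and carries one normal to its negative. Some
inequality must fail on the way, so by the intermediate value theorem another one becomes an
equality at a feasible frame (`exists_feasible_of_path`). After finitely many such moves the frame
is `Rigid`: its directions are determined by few differences, in one of three ways. Two independent
differences lie in one plane and one difference lies in a second plane; or each plane contains one
difference, and a quadratic equation gives the first normal up to a sign of a square root; or one
normal is parallel to a difference and a second plane contains another difference. In each case six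
points suffice for the three normals together with points through which the planes pass
(`exists_isDetermined`).

The program therefore runs through all sextuples of points and builds four candidate frames from
each. As no four points are coplanar, at most three points lie on each candidate plane; nine further
loops over bits distribute them in all ways (`exists_sideBit`). There are `O(N^6)` candidates, and
each is treated in time `O(N)`: label the points by octants, rename the labels by order of first
appearance so that a partition has only one word, check that each label occurs `N / 8` times, and
insert the word into a trie, printing it only if it is new. The total is `O(N^7)` with `N = 8 * n`.

Soundness needs little: the normals `v`, `v × w`, `v × (v × w)` are mutually orthogonal, and nonzero
once `v × w ≠ 0`, so every balanced candidate is an orthogonal equipartition, even when the six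
points are in a useless configuration. Completeness is `IsOrthogonalEquipartition.exists_listedFor`.
The machine part computes with a total semantics `Cmd.sem` of counted loops, tied to the
step-counting relation by `Cmd.runs` and `Cmd.cost_le`. -/

namespace RealRAM

/-! ## Programs with counted loops -/

/-- Commands: programs whose only loops are counted loops. The command `loop b r p` runs `p` with
the values `0, 1, …` of the integer register `r`, up to the value of the register `b`. -/
inductive Cmd where
  | instr (i : Instr)
  | seq (p q : Cmd)
  | ite (c : Test) (p q : Cmd)
  | loop (b r : ℕ) (p : Cmd)

infixr:60 " ;; " => Cmd.seq

namespace Instr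

/-- The instruction writes the integer register `x`. -/
def setsI : Instr → ℕ → Bool
  | iconst a _, x => a == x
  | icopy a _, x => a == x
  | isucc a, x => a == x
  | ipred a, x => a == x
  | iload a _, x => a == x
  | _, _ => false

/-- The instruction writes the real register `x`. -/
def setsR : Instr → ℕ → Bool
  | rconst a _, x => a == x
  | rcopy a _, x => a == x
  | rarith _ a _ _, x => a == x
  | rsqrt a _, x => a == x
  | rload a _, x => a == x
  | _, _ => false

/-- The instruction writes the integer memory. -/
def storesI : Instr → Bool
  | istore _ _ => true
  | _ => false

/-- The instruction writes the real memory. -/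
def storesR : Instr → Bool
  | rstore _ _ => true
  | _ => false

/-- The instruction writes the output. -/
def prints : Instr → Bool
  | print _ => true
  | _ => false

end Instr

namespace Cmd

/-- The translation of commands into programs of the machine. -/
def toProg : Cmd → Prog
  | instr i => .instr i
  | seq p q => .seq p.toProg q.toProg
  | ite c p q => .ite c p.toProg q.toProg
  | loop b r p =>
      .seq (.instr (.iconst r 0)) (.loop (.ilt r b) (.seq p.toProg (.instr (.isucc r))))

open Classical in
/-- The effect of a command on the state. -/
noncomputable def sem : Cmd → State → State
  | instr i, s => i.apply s
  | seq p q, s => q.sem (p.sem s)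
  | ite c p q, s => if c.Holds s then p.sem s else q.sem s
  | loop b r p, s =>
      (fun s' => (Instr.isucc r).apply (p.sem s'))^[s.ireg b] ((Instr.iconst r 0).apply s)

/-- Some instruction in the command has the property `f`. -/
def any (f : Instr → Bool) : Cmd → Bool
  | instr i => f i
  | seq p q => p.any f || q.any f
  | ite _ p q => p.any f || q.any f
  | loop _ r p => f (.iconst r 0) || f (.isucc r) || p.any f

/-- The observable `g` is left abstract so that a single induction on commands yields all the
clauses of `Frame`. -/
theorem sem_eq_of_any {α : Type*} (g : State → α) (f : Instr → Bool)
    (hf : ∀ i s, f i = false → g (i.apply s) = g s) :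
    ∀ (c : Cmd) (s : State), c.any f = false → g (c.sem s) = g s
  | instr i, s, h => hf i s h
  | seq p q, s, h => by
    simp only [any, Bool.or_eq_false_iff] at h
    rw [sem, sem_eq_of_any g f hf q _ h.2, sem_eq_of_any g f hf p _ h.1]
  | ite c p q, s, h => by
    simp only [any, Bool.or_eq_false_iff] at h
    rw [sem]
    split_ifs
    · exact sem_eq_of_any g f hf p _ h.1
    · exact sem_eq_of_any g f hf q _ h.2
  | loop b r p, s, h => by
    simp only [any, Bool.or_eq_false_iff] at h
    rw [sem]
    generalize s.ireg b = n
    induction n with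
    | zero => exact hf _ _ h.1.1
    | succ n ih =>
      rw [Function.iterate_succ_apply', hf _ _ h.1.2, sem_eq_of_any g f hf p _ h.2, ih]

/-- What the command leaves unchanged on the way from `s` to `s'`. -/
structure Frame (c : Cmd) (s s' : State) : Prop where
  ireg : ∀ a, c.any (·.setsI a) = false → s'.ireg a = s.ireg a
  rreg : ∀ a, c.any (·.setsR a) = false → s'.rreg a = s.rreg a
  imem : c.any (·.storesI) = false → s'.imem = s.imem
  rmem : c.any (·.storesR) = false → s'.rmem = s.rmem
  out : c.any (·.prints) = false → s'.out = s.out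

theorem _root_.RealRAM.Instr.ireg_apply (a : ℕ) (i : Instr) (s : State) (h : i.setsI a = false) :
    (i.apply s).ireg a = s.ireg a := by
  cases i <;> first
    | rfl
    | exact Function.update_of_ne (Ne.symm (beq_eq_false_iff_ne.1 h)) _ _

theorem _root_.RealRAM.Instr.rreg_apply (a : ℕ) (i : Instr) (s : State) (h : i.setsR a = false) :
    (i.apply s).rreg a = s.rreg a := by
  cases i <;> first
    | rfl
    | exact Function.update_of_ne (Ne.symm (beq_eq_false_iff_ne.1 h)) _ _

theorem _root_.RealRAM.Instr.imem_apply (i : Instr) (s : State) (h : i.storesI = false) :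
    (i.apply s).imem = s.imem := by
  cases i <;> simp_all [Instr.storesI, Instr.apply]

theorem _root_.RealRAM.Instr.rmem_apply (i : Instr) (s : State) (h : i.storesR = false) :
    (i.apply s).rmem = s.rmem := by
  cases i <;> simp_all [Instr.storesR, Instr.apply]

theorem _root_.RealRAM.Instr.out_apply (i : Instr) (s : State) (h : i.prints = false) :
    (i.apply s).out = s.out := by
  cases i <;> simp_all [Instr.prints, Instr.apply]

theorem frame (c : Cmd) (s : State) : Frame c s (c.sem s) where
  ireg a := sem_eq_of_any (·.ireg a) _ (Instr.ireg_apply a) c s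
  rreg a := sem_eq_of_any (·.rreg a) _ (Instr.rreg_apply a) c s
  imem := sem_eq_of_any (·.imem) _ Instr.imem_apply c s
  rmem := sem_eq_of_any (·.rmem) _ Instr.rmem_apply c s
  out := sem_eq_of_any (·.out) _ Instr.out_apply c s

/-- The frame property is also needed in the middle of a loop, where the invariant is
re-established. -/
theorem frame_iterate (b r : ℕ) (p : Cmd) (s : State) (n : ℕ) :
    Frame (loop b r p) s
      ((fun s' => (Instr.isucc r).apply (p.sem s'))^[n] ((Instr.iconst r 0).apply s)) := by
  have key : ∀ {α : Type} (g : State → α) (f : Instr → Bool)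
      (_ : ∀ i s, f i = false → g (i.apply s) = g s), (loop b r p).any f = false →
      g ((fun s' => (Instr.isucc r).apply (p.sem s'))^[n] ((Instr.iconst r 0).apply s)) = g s := by
    intro α g f hf h
    simp only [any, Bool.or_eq_false_iff] at h
    induction n with
    | zero => exact hf _ _ h.1.1
    | succ n ih =>
      rw [Function.iterate_succ_apply', hf _ _ h.1.2, sem_eq_of_any g f hf p _ h.2, ih]
  exact ⟨fun a => key (·.ireg a) _ (Instr.ireg_apply a), fun a => key (·.rreg a) _
    (Instr.rreg_apply a), key (·.imem) _ Instr.imem_apply, key (·.rmem) _ Instr.rmem_apply,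
    key (·.out) _ Instr.out_apply⟩

/-- The counter of a loop whose body does not write it. -/
theorem ireg_iterate {r : ℕ} {p : Cmd} (hr : p.any (·.setsI r) = false) (s : State) (n : ℕ) :
    ((fun s' => (Instr.isucc r).apply (p.sem s'))^[n] ((Instr.iconst r 0).apply s)).ireg r = n := by
  induction n with
  | zero => simp [Instr.apply]
  | succ n ih =>
    rw [Function.iterate_succ_apply']
    change Function.update _ _ _ _ = _
    rw [Function.update_self, (p.frame _).ireg r hr, ih]

/-- Reasoning about loops with an invariant. -/
theorem loop_induct {b r : ℕ} {p : Cmd} {s : State} (hr : p.any (·.setsI r) = false)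
    (I : ℕ → State → Prop) (h0 : I 0 ((Instr.iconst r 0).apply s))
    (hs : ∀ k s', k < s.ireg b → s'.ireg r = k → Frame (loop b r p) s s' → I k s' →
      I (k + 1) ((Instr.isucc r).apply (p.sem s'))) :
    I (s.ireg b) ((loop b r p).sem s) := by
  rw [sem]
  suffices h : ∀ n ≤ s.ireg b,
      I n ((fun s' => (Instr.isucc r).apply (p.sem s'))^[n] ((Instr.iconst r 0).apply s)) from
    h _ le_rfl
  intro n hn
  induction n with
  | zero => exact h0
  | succ n ih =>
    rw [Function.iterate_succ_apply']
    exact hs n _ hn (ireg_iterate hr s n) (frame_iterate b r p s n) (ih (Nat.le_of_succ_le hn))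

/-- Loops are bounded by the registers `0, 1, 2`, which are not written, and no loop counter is
written in the body of the loop. -/
def WF : Cmd → Bool
  | instr i => !i.setsI 0 && !i.setsI 1 && !i.setsI 2
  | seq p q => p.WF && q.WF
  | ite _ p q => p.WF && q.WF
  | loop b r p => decide (b < 3) && decide (3 ≤ r) && !p.any (·.setsI r) && p.WF

/-- An upper bound for the number of steps if the register `0` is at most `N` and the registers
`1, 2` are at most `8`. -/
def cost (N : ℕ) : Cmd → ℕ
  | instr _ => 1
  | seq p q => p.cost N + q.cost N
  | ite _ p q => p.cost N + q.cost N + 1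
  | loop b _ p => (if b = 0 then N else 8) * (p.cost N + 2) + 2

theorem any_setsI_of_WF : ∀ {c : Cmd}, c.WF = true → ∀ b < 3, c.any (·.setsI b) = false
  | instr i, h, b, hb => by
    simp only [WF, Bool.and_eq_true, Bool.not_eq_true'] at h
    interval_cases b <;> simp [any, h]
  | seq p q, h, b, hb => by
    simp only [WF, Bool.and_eq_true] at h
    simp [any, any_setsI_of_WF h.1 b hb, any_setsI_of_WF h.2 b hb]
  | ite _ p q, h, b, hb => by
    simp only [WF, Bool.and_eq_true] at h
    simp [any, any_setsI_of_WF h.1 b hb, any_setsI_of_WF h.2 b hb]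
  | loop b' r p, h, b, hb => by
    simp only [WF, Bool.and_eq_true, decide_eq_true_eq] at h
    have h' := any_setsI_of_WF h.2 b hb
    have : r ≠ b := by omega
    simp only [any, h', Bool.or_false]
    simp [Instr.setsI, this]

/-- The total semantics is what the machine computes, within the cost bound. Since the bounding
registers are never written, each loop runs exactly as often as its bound says on entry. -/
theorem runs {N : ℕ} : ∀ (c : Cmd) (s : State), c.WF = true → s.ireg 0 ≤ N → s.ireg 1 ≤ 8 →
    s.ireg 2 ≤ 8 → ∃ t ≤ c.cost N, c.toProg.Runs s t (c.sem s)
  | instr i, s, _, _, _, _ => ⟨1, le_rfl, .instr i s⟩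
  | seq p q, s, h, h0, h1, h2 => by
    simp only [WF, Bool.and_eq_true] at h
    obtain ⟨t, ht, hp⟩ := runs p s h.1 h0 h1 h2
    have e := fun b hb => (p.frame s).ireg b (any_setsI_of_WF h.1 b hb)
    obtain ⟨t', ht', hq⟩ := runs q (p.sem s) h.2 ((e 0 (by omega)).trans_le h0)
      ((e 1 (by omega)).trans_le h1) ((e 2 (by omega)).trans_le h2)
    exact ⟨t + t', Nat.add_le_add ht ht', .seq hp hq⟩
  | ite c p q, s, h, h0, h1, h2 => by
    simp only [WF, Bool.and_eq_true] at h
    rw [sem]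
    split_ifs with hc
    · obtain ⟨t, ht, hp⟩ := runs p s h.1 h0 h1 h2
      exact ⟨t + 1, by simp only [cost]; omega, .ite_true hc hp⟩
    · obtain ⟨t, ht, hp⟩ := runs q s h.2 h0 h1 h2
      exact ⟨t + 1, by simp only [cost]; omega, .ite_false hc hp⟩
  | loop b r p, s, h, h0, h1, h2 => by
    have hw := any_setsI_of_WF h
    simp only [WF, Bool.and_eq_true, decide_eq_true_eq, Bool.not_eq_true'] at h
    obtain ⟨⟨⟨hb, hr⟩, hpr⟩, hp⟩ := h
    have hbn : s.ireg b ≤ if b = 0 then N else 8 := by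
      interval_cases b <;> simpa
    set st := fun n =>
      (fun s' => (Instr.isucc r).apply (p.sem s'))^[n] ((Instr.iconst r 0).apply s) with hst
    -- `Runs` unfolds a loop from the front, while the iterates are counted from the start; the
    -- induction is therefore on the number `m` of remaining rounds.
    have key : ∀ m n, n + m = s.ireg b → ∃ t ≤ m * (p.cost N + 2) + 1,
        (Prog.loop (.ilt r b) (.seq p.toProg (.instr (.isucc r)))).Runs (st n) t
          (st (s.ireg b)) := by
      intro m
      induction m with
      | zero =>
        rintro n hn
        have hn' : n = s.ireg b := hn
        refine ⟨1, by omega, ?_⟩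
        rw [hn']
        refine .loop_done ?_
        have e1 : (st (s.ireg b)).ireg r = s.ireg b := ireg_iterate hpr s _
        have e2 : (st (s.ireg b)).ireg b = s.ireg b := (frame_iterate b r p s _).ireg b (hw b hb)
        simp [Test.Holds, e1, e2]
      | succ m ih =>
        rintro n hn
        obtain ⟨t, ht, h'⟩ := ih (n + 1) (by omega)
        have e := fun b' hb' => (frame_iterate b r p s n).ireg b' (hw b' hb')
        obtain ⟨t', ht', hp'⟩ := runs p (st n) hp ((e 0 (by omega)).trans_le h0)
          ((e 1 (by omega)).trans_le h1) ((e 2 (by omega)).trans_le h2)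
        have e1 : (st n).ireg r = n := ireg_iterate hpr s _
        have hc : (Test.ilt r b).Holds (st n) := by
          have e2 : (st n).ireg b = s.ireg b := e b hb
          change (st n).ireg r < (st n).ireg b
          omega
        refine ⟨t' + 1 + t + 1, ?_, .loop_step hc (.seq hp' (.instr _ _)) ?_⟩
        · rw [Nat.succ_mul]; omega
        · have : st (n + 1) = (Instr.isucc r).apply (p.sem (st n)) :=
            Function.iterate_succ_apply' _ _ _
          rwa [← this]
    obtain ⟨t, ht, h'⟩ := key (s.ireg b) 0 (by omega)
    refine ⟨1 + t, ?_, .seq (.instr _ _) h'⟩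
    have := Nat.mul_le_mul_right (p.cost N + 2) hbn
    simp only [cost]
    omega

/-- The nesting depth of the loops over the register `0`. -/
def depth : Cmd → ℕ
  | instr _ => 0
  | seq p q => max p.depth q.depth
  | ite _ p q => max p.depth q.depth
  | loop b _ p => if b = 0 then p.depth + 1 else p.depth

/-- The constant in the bound of the number of steps by a power of `N`. -/
def coef : Cmd → ℕ
  | instr _ => 1
  | seq p q => p.coef + q.coef
  | ite _ p q => p.coef + q.coef + 1
  | loop _ _ p => 8 * (p.coef + 2) + 2

/-- Only nested loops over register `0` raise the exponent; the others contribute a factor of at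
most 8 to the constant. -/
theorem cost_le {N : ℕ} (hN : 1 ≤ N) : ∀ c : Cmd, c.cost N ≤ c.coef * N ^ c.depth
  | instr _ => by simp [cost, coef, depth]
  | seq p q => by
    have hp := (cost_le hN p).trans
      (Nat.mul_le_mul_left _ (Nat.pow_le_pow_right hN (le_max_left p.depth q.depth)))
    have hq := (cost_le hN q).trans
      (Nat.mul_le_mul_left _ (Nat.pow_le_pow_right hN (le_max_right p.depth q.depth)))
    simp only [cost, coef, depth, add_mul]
    omega
  | ite _ p q => by
    have hp := (cost_le hN p).trans
      (Nat.mul_le_mul_left _ (Nat.pow_le_pow_right hN (le_max_left p.depth q.depth)))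
    have hq := (cost_le hN q).trans
      (Nat.mul_le_mul_left _ (Nat.pow_le_pow_right hN (le_max_right p.depth q.depth)))
    have h1 : 1 ≤ N ^ max p.depth q.depth := Nat.one_le_pow _ _ hN
    simp only [cost, coef, depth, add_mul]
    omega
  | loop b r p => by
    have hp := cost_le hN p
    have h1 : 1 ≤ N ^ p.depth := Nat.one_le_pow _ _ hN
    by_cases hb : b = 0
    -- With `c` and `d` for the coefficient and depth of the body, `N * (c * N ^ d + 2) + 2 ≤ (c +
    -- 4) * N ^ (d + 1)`, well below the chosen coefficient.
    · simp only [cost, coef, depth, hb, if_true, pow_succ]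
      nlinarith [Nat.mul_le_mul_left N hp, Nat.mul_le_mul_left N h1, Nat.mul_le_mul h1 hN,
        Nat.zero_le (p.coef * (N ^ p.depth * N))]
    · simp only [cost, coef, depth, hb, if_false]
      nlinarith

end Cmd
end RealRAM

namespace RealRAM

/-! ## Arithmetic expressions -/

/-- Expressions over the real registers. -/
inductive RExp where
  | reg (a : ℕ)
  | const (k : ℤ)
  | op (o : ArithOp) (e f : RExp)
  | sqrt (e : RExp)

namespace RExp

instance : Add RExp := ⟨op .add⟩
instance : Sub RExp := ⟨op .sub⟩
instance : Mul RExp := ⟨op .mul⟩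

/-- The value of an expression. -/
noncomputable def eval (ρ : ℕ → ℝ) : RExp → ℝ
  | reg a => ρ a
  | const k => k
  | op o e f => o.eval (e.eval ρ) (f.eval ρ)
  | sqrt e => Real.sqrt (e.eval ρ)

@[simp] theorem eval_reg (ρ : ℕ → ℝ) (a : ℕ) : (reg a).eval ρ = ρ a := rfl
@[simp] theorem eval_const (ρ : ℕ → ℝ) (k : ℤ) : (const k).eval ρ = k := rfl
@[simp] theorem eval_add (ρ : ℕ → ℝ) (e f : RExp) : (e + f).eval ρ = e.eval ρ + f.eval ρ := rfl
@[simp] theorem eval_sub (ρ : ℕ → ℝ) (e f : RExp) : (e - f).eval ρ = e.eval ρ - f.eval ρ := rfl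
@[simp] theorem eval_mul (ρ : ℕ → ℝ) (e f : RExp) : (e * f).eval ρ = e.eval ρ * f.eval ρ := rfl
@[simp] theorem eval_sqrt (ρ : ℕ → ℝ) (e : RExp) : (sqrt e).eval ρ = √(e.eval ρ) := rfl

/-- The expression uses only registers below `d`. -/
def Below (d : ℕ) : RExp → Bool
  | reg a => decide (a < d)
  | const _ => true
  | op _ e f => e.Below d && f.Below d
  | sqrt e => e.Below d

theorem Below.mono {d d' : ℕ} (h : d ≤ d') : ∀ {e : RExp}, e.Below d = true → e.Below d' = true
  | reg a, he => by simp only [Below, decide_eq_true_eq] at he ⊢; omega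
  | const _, _ => rfl
  | op _ e f, he => by
    simp only [Below, Bool.and_eq_true] at he ⊢
    exact ⟨Below.mono h he.1, Below.mono h he.2⟩
  | sqrt e, he => Below.mono (e := e) h he

theorem eval_congr {d : ℕ} {ρ ρ' : ℕ → ℝ} (h : ∀ a < d, ρ a = ρ' a) :
    ∀ {e : RExp}, e.Below d = true → e.eval ρ = e.eval ρ'
  | reg a, he => h a (by simpa [Below] using he)
  | const _, _ => rfl
  | op _ e f, he => by
    simp only [Below, Bool.and_eq_true] at he
    rw [eval, eval, eval_congr h he.1, eval_congr h he.2]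
  | sqrt e, he => by rw [eval, eval, eval_congr (e := e) h he]

/-- The command that writes the value of the expression into the register `d`; registers beyond `d`
are used for intermediate results. -/
def code : RExp → ℕ → Cmd
  | reg a, d => .instr (.rcopy d a)
  | const k, d => .instr (.rconst d k)
  | op o e f, d => e.code d ;; f.code (d + 1) ;; .instr (.rarith o d d (d + 1))
  | sqrt e, d => e.code d ;; .instr (.rsqrt d d)

/-- Registers are used as a stack: the inputs stay below `d`, so evaluating the first operand into
`d` does not disturb the second one. -/
theorem sem_code : ∀ (e : RExp) (d : ℕ) (s : State), e.Below d = true →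
    ∃ f : ℕ → ℝ, (e.code d).sem s = { s with rreg := f } ∧ f d = e.eval s.rreg ∧
      ∀ a < d, f a = s.rreg a
  | reg a, d, s, _ => ⟨_, rfl, Function.update_self .., fun b hb =>
      Function.update_of_ne hb.ne _ _⟩
  | const k, d, s, _ => ⟨_, rfl, Function.update_self .., fun b hb =>
      Function.update_of_ne hb.ne _ _⟩
  | op o e f, d, s, h => by
    simp only [Below, Bool.and_eq_true] at h
    obtain ⟨g, h1, h2, h3⟩ := sem_code e d s h.1
    obtain ⟨g', h1', h2', h3'⟩ := sem_code f (d + 1) { s with rreg := g }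
      (Below.mono (Nat.le_succ d) h.2)
    refine ⟨_, by rw [code, Cmd.sem, h1, Cmd.sem, h1']; rfl, ?_, fun b hb => ?_⟩
    · rw [Function.update_self]
      change o.eval (g' d) (g' (d + 1)) = _
      rw [h2', h3' d (Nat.lt_succ_self d)]
      change o.eval (g d) (f.eval g) = _
      rw [h2, eval, eval_congr h3 h.2]
    · rw [Function.update_of_ne hb.ne]
      exact (h3' b (hb.trans (Nat.lt_succ_self d))).trans (h3 b hb)
  | sqrt e, d, s, h => by
    obtain ⟨g, h1, h2, h3⟩ := sem_code e d s h
    refine ⟨_, by rw [code, Cmd.sem, h1]; rfl, ?_, fun b hb => ?_⟩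
    · rw [Function.update_self]
      change Real.sqrt (g d) = _
      rw [h2, eval]
    · rw [Function.update_of_ne hb.ne]
      exact h3 b hb

end RExp

/-- Triples of expressions. -/
abbrev VExp : Type := Fin 3 → RExp

namespace VExp

/-- The value of a triple of expressions. -/
noncomputable def eval (ρ : ℕ → ℝ) (e : VExp) : Fin 3 → ℝ := fun k => (e k).eval ρ

/-- The triple of registers from `a` on. -/
def regs (a : ℕ) : VExp := fun k => .reg (a + k)

/-- The scalar product. -/
def dot (e f : VExp) : RExp := e 0 * f 0 + e 1 * f 1 + e 2 * f 2

/-- The cross product. -/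
def cross (e f : VExp) : VExp :=
  ![e 1 * f 2 - e 2 * f 1, e 2 * f 0 - e 0 * f 2, e 0 * f 1 - e 1 * f 0]

/-- The linear combination of two triples. -/
def lin (c : RExp) (e : VExp) (c' : RExp) (e' : VExp) : VExp := fun k => c * e k + c' * e' k

theorem eval_sub (ρ : ℕ → ℝ) (e f : VExp) : VExp.eval ρ (e - f) = e.eval ρ - f.eval ρ := rfl

theorem eval_regs (ρ : ℕ → ℝ) (a : ℕ) : (regs a).eval ρ = fun k : Fin 3 => ρ (a + k) := rfl

theorem eval_dot (ρ : ℕ → ℝ) (e f : VExp) : (dot e f).eval ρ = e.eval ρ ⬝ᵥ f.eval ρ := by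
  simp [dot, dotProduct, Fin.sum_univ_three, VExp.eval]

theorem eval_cross (ρ : ℕ → ℝ) (e f : VExp) :
    (cross e f).eval ρ = crossProduct (e.eval ρ) (f.eval ρ) := by
  rw [cross_apply]
  funext k
  fin_cases k <;> simp [cross, VExp.eval]

theorem eval_lin (ρ : ℕ → ℝ) (c : RExp) (e : VExp) (c' : RExp) (e' : VExp) :
    (lin c e c' e').eval ρ = c.eval ρ • e.eval ρ + c'.eval ρ • e'.eval ρ := rfl

/-- The command that writes the three values into the registers from `d` on. -/
def code (e : VExp) (d : ℕ) : Cmd :=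
  (e 0).code d ;; (e 1).code (d + 1) ;; (e 2).code (d + 2)

theorem sem_code (e : VExp) (d : ℕ) (s : State) (h : ∀ k, (e k).Below d = true) :
    ∃ f : ℕ → ℝ, (e.code d).sem s = { s with rreg := f } ∧
      (fun k : Fin 3 => f (d + k)) = e.eval s.rreg ∧ ∀ a < d, f a = s.rreg a := by
  obtain ⟨f0, h0, e0, l0⟩ := (e 0).sem_code d s (h 0)
  obtain ⟨f1, h1, e1, l1⟩ := (e 1).sem_code (d + 1) { s with rreg := f0 }
    (RExp.Below.mono (Nat.le_succ d) (h 1))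
  obtain ⟨f2, h2, e2, l2⟩ := (e 2).sem_code (d + 2) { s with rreg := f1 }
    (RExp.Below.mono (Nat.le_add_right d 2) (h 2))
  have l1' : ∀ a < d, f1 a = s.rreg a := fun a ha =>
    (l1 a (ha.trans (Nat.lt_succ_self d))).trans (l0 a ha)
  refine ⟨f2, by rw [code, Cmd.sem, h0, Cmd.sem, h1, h2], ?_, fun a ha =>
    (l2 a (by omega)).trans (l1' a ha)⟩
  funext k
  fin_cases k
  · change f2 d = _
    rw [l2 d (by omega)]
    change f1 d = _
    rw [l1 d (by omega)]
    exact e0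
  · change f2 (d + 1) = _
    rw [l2 (d + 1) (by omega)]
    exact e1.trans (RExp.eval_congr l0 (h 1))
  · exact e2.trans (RExp.eval_congr l1' (h 2))

end VExp

end RealRAM

/-! ## Tries in the integer memory -/

/-- From the address `root` on, the memory holds a trie over the alphabet `{0, …, 7}`, whose nodes
are the words in `P`. The node `p` occupies the 8 cells from `ν p` on, and the cell `ν p + c` holds
the address of the child `p ++ [c]`, or zero if there is none. The cells from `F` on are free. -/
structure IsTrie (mem : ℕ → ℕ) (root F : ℕ) (P : List ℕ → Prop) (ν : List ℕ → ℕ) : Prop where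
  root_pos : 0 < root
  nil : P []
  addr_nil : ν [] = root
  of_append : ∀ p c, P (p ++ [c]) → P p
  child : ∀ p c, P p → c < 8 → P (p ++ [c]) → mem (ν p + c) = ν (p ++ [c])
  no_child : ∀ p c, P p → c < 8 → ¬ P (p ++ [c]) → mem (ν p + c) = 0
  sep : ∀ p q c d, P p → P q → c < 8 → d < 8 → ν p + c = ν q + d → p = q ∧ c = d
  root_le : ∀ p, P p → root ≤ ν p
  le_free : ∀ p, P p → ν p + 8 ≤ F
  free : ∀ a, F ≤ a → mem a = 0

namespace IsTrie

variable {mem : ℕ → ℕ} {root F : ℕ} {P : List ℕ → Prop} {ν : List ℕ → ℕ}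

theorem empty (mem : ℕ → ℕ) {root : ℕ} (h0 : 0 < root) (h : ∀ a, root ≤ a → mem a = 0) :
    IsTrie mem root (root + 8) (· = []) (fun _ => root) where
  root_pos := h0
  nil := rfl
  addr_nil := rfl
  of_append p c h := by simp at h
  child p c _ _ h := by simp at h
  no_child p c _ _ _ := h _ (by omega)
  sep p q c d hp hq _ _ h := ⟨hp.trans hq.symm, by omega⟩
  root_le _ _ := le_rfl
  le_free _ _ := le_rfl
  free a ha := h a (by omega)

/-- The tables of sides and labels lie below the root, so rewriting them for each candidate leaves
the trie intact. -/
theorem congr {mem' : ℕ → ℕ} (h : IsTrie mem root F P ν) (h' : ∀ a, root ≤ a → mem' a = mem a) :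
    IsTrie mem' root F P ν where
  __ := h
  child p c hp hc hpc := by
    rw [h' _ ((h.root_le p hp).trans (Nat.le_add_right _ _)), h.child p c hp hc hpc]
  no_child p c hp hc hpc := by
    rw [h' _ ((h.root_le p hp).trans (Nat.le_add_right _ _)), h.no_child p c hp hc hpc]
  free a ha := by
    have := h.root_le [] h.nil
    have := h.le_free [] h.nil
    rw [h' a (by omega), h.free a ha]

theorem congr_pred {P' : List ℕ → Prop} (h : IsTrie mem root F P ν) (h' : ∀ p, P' p ↔ P p) :
    IsTrie mem root F P' ν := by
  rwa [show P' = P from funext fun p => propext (h' p)]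

/-- A new child is attached at the free address. -/
theorem insert (h : IsTrie mem root F P ν) {p : List ℕ} {c : ℕ} (hp : P p) (hc : c < 8)
    (hpc : ¬ P (p ++ [c])) :
    IsTrie (Function.update mem (ν p + c) F) root (F + 8) (fun q => P q ∨ q = p ++ [c])
      (Function.update ν (p ++ [c]) F) := by
  have hν : ∀ q, P q → Function.update ν (p ++ [c]) F q = ν q := fun q hq =>
    Function.update_of_ne (by rintro rfl; exact hpc hq) _ _
  have hself : Function.update ν (p ++ [c]) F (p ++ [c]) = F := Function.update_self ..
  have hF : 0 < F := by have := h.le_free p hp; omega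
  have hrF : root ≤ F := by have := h.le_free p hp; have := h.root_le p hp; omega
  -- The new node is a leaf: a descendant already present would force the node itself to be present,
  -- by closure under prefixes.
  have hnoext : ∀ d, ¬ (P (p ++ [c] ++ [d]) ∨ p ++ [c] ++ [d] = p ++ [c]) := by
    rintro d (hd | hd)
    · exact hpc (h.of_append _ _ hd)
    · simp at hd
  have hcell : ∀ d, F + d ≠ ν p + c := fun d => by have := h.le_free p hp; omega
  refine ⟨h.root_pos, .inl h.nil, by rw [hν _ h.nil, h.addr_nil], ?_, ?_, ?_, ?_, ?_, ?_, ?_⟩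
  · rintro q d (hq | hq)
    · exact .inl (h.of_append q d hq)
    · obtain ⟨rfl, -⟩ := List.append_inj' hq rfl
      exact .inl hp
  · rintro q d (hq | rfl) hd hqd
    · rw [hν q hq]
      rcases hqd with hqd | hqd
      · rw [hν _ hqd, Function.update_of_ne, h.child q d hq hd hqd]
        intro e
        obtain ⟨rfl, rfl⟩ := h.sep q p d c hq hp hd hc e
        exact hpc hqd
      · obtain ⟨rfl, e⟩ := List.append_inj' hqd rfl
        obtain rfl : d = c := by simpa using e
        rw [Function.update_self, hself]
    · exact absurd hqd (hnoext d)
  · rintro q d (hq | rfl) hd hqd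
    · simp only [not_or] at hqd
      rw [hν q hq, Function.update_of_ne, h.no_child q d hq hd hqd.1]
      intro e
      obtain ⟨rfl, rfl⟩ := h.sep q p d c hq hp hd hc e
      exact hqd.2 rfl
    · rw [hself, Function.update_of_ne (hcell d)]
      exact h.free _ (Nat.le_add_right _ _)
  · rintro q q' d d' (hq | rfl) (hq' | rfl) hd hd' e
    · rw [hν q hq, hν q' hq'] at e
      exact h.sep q q' d d' hq hq' hd hd' e
    · rw [hν q hq, hself] at e
      have := h.le_free q hq
      omega
    · rw [hν q' hq', hself] at e
      have := h.le_free q' hq'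
      omega
    · rw [hself] at e
      exact ⟨rfl, by omega⟩
  · rintro q (hq | rfl)
    · rw [hν q hq]; exact h.root_le q hq
    · rwa [hself]
  · rintro q (hq | rfl)
    · rw [hν q hq]; exact (h.le_free q hq).trans (Nat.le_add_right _ _)
    · rw [hself]
  · intro a ha
    rw [Function.update_of_ne, h.free a (by omega)]
    have := h.le_free p hp
    omega

end IsTrie

/-! ## Canonical labels -/

/-- The sequence takes a new value at `i`. -/
def IsLeader (r : ℕ → ℕ) (i : ℕ) : Prop := ∀ i' < i, r i' ≠ r i

/-- The first position with the same value. -/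
def firstPos (r : ℕ → ℕ) (k : ℕ) : ℕ := Nat.find (⟨k, rfl⟩ : ∃ i, r i = r k)

open Classical in
/-- The number of values that appear before the value at `k` appears. -/
noncomputable def canonLabel (r : ℕ → ℕ) (k : ℕ) : ℕ := Nat.count (IsLeader r) (firstPos r k)

section canonLabel

variable {r r' : ℕ → ℕ}

theorem firstPos_spec (r : ℕ → ℕ) (k : ℕ) : r (firstPos r k) = r k :=
  Nat.find_spec (⟨k, rfl⟩ : ∃ i, r i = r k)

theorem firstPos_le {k i : ℕ} (h : r i = r k) : firstPos r k ≤ i :=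
  Nat.find_min' (⟨k, rfl⟩ : ∃ i, r i = r k) h

theorem isLeader_firstPos (r : ℕ → ℕ) (k : ℕ) : IsLeader r (firstPos r k) := fun _ hi' e =>
  absurd (firstPos_le (e.trans (firstPos_spec r k))) (not_le.2 hi')

theorem firstPos_congr {k k' : ℕ} (h : r k = r k') : firstPos r k = firstPos r k' :=
  le_antisymm (firstPos_le ((firstPos_spec r k').trans h.symm))
    (firstPos_le ((firstPos_spec r k).trans h))

theorem IsLeader.firstPos_eq {k : ℕ} (h : IsLeader r k) : firstPos r k = k :=
  le_antisymm (firstPos_le rfl) (not_lt.1 fun hlt => h _ hlt (firstPos_spec r k))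

open Classical in
theorem IsLeader.canonLabel_eq {k : ℕ} (h : IsLeader r k) :
    canonLabel r k = Nat.count (IsLeader r) k := by rw [canonLabel, h.firstPos_eq]

theorem canonLabel_congr {k k' : ℕ} (h : r k = r k') : canonLabel r k = canonLabel r k' := by
  rw [canonLabel, canonLabel, firstPos_congr h]

open Classical in
-- Equal counts of leaders at two leaders mean equal positions, so the renaming of values is
-- injective.
theorem canonLabel_inj {k k' : ℕ} : canonLabel r k = canonLabel r k' ↔ r k = r k' := by
  refine ⟨fun h => ?_, canonLabel_congr⟩
  have := Nat.count_injective (isLeader_firstPos r k) (isLeader_firstPos r k') h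
  rw [← firstPos_spec r k, ← firstPos_spec r k', this]

open Classical in
-- Leaders carry distinct values, so there are at most `n` of them.
theorem canonLabel_lt {n : ℕ} (h : ∀ k, r k < n) (k : ℕ) : canonLabel r k < n := by
  have hlt : canonLabel r k < Nat.count (IsLeader r) (firstPos r k + 1) :=
    Nat.count_strict_mono (isLeader_firstPos r k) (Nat.lt_succ_self _)
  refine hlt.trans_le ?_
  rw [Nat.count_eq_card_filter_range]
  calc _ ≤ (Finset.range n).card := by
        refine Finset.card_le_card_of_injOn r (fun i _ => by simpa using h i) ?_
        intro i hi j hj hij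
        simp only [Finset.mem_coe, Finset.mem_filter] at hi hj
        by_contra hne
        rcases lt_or_gt_of_ne hne with hlt | hlt
        · exact hj.2 i hlt hij
        · exact hi.2 j hlt hij.symm
    _ = n := Finset.card_range n

/-- The canonical word is a complete invariant of the partition into level sets, and the label at
`k` depends only on positions up to `k`. This removes both the order of the planes and their
orientation from the output. -/
theorem canonLabel_eq_of_iff {N k : ℕ} (hk : k < N)
    (h : ∀ i < N, ∀ j < N, r i = r j ↔ r' i = r' j) : canonLabel r k = canonLabel r' k := by
  classical
  have hle : firstPos r k ≤ k := firstPos_le rfl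
  have hle' : firstPos r' k ≤ k := firstPos_le rfl
  have hf : firstPos r k = firstPos r' k := le_antisymm
    (firstPos_le ((h _ (by omega) _ hk).2 (firstPos_spec r' k)))
    (firstPos_le ((h _ (by omega) _ hk).1 (firstPos_spec r k)))
  rw [canonLabel, canonLabel, ← hf, Nat.count_eq_card_filter_range, Nat.count_eq_card_filter_range]
  congr 1
  refine Finset.filter_congr fun i hi => ?_
  have hi' := Finset.mem_range.1 hi
  exact forall₂_congr fun _ _ => not_congr (h _ (by omega) _ (by omega))

end canonLabel

namespace RealRAM

/-! ## The program -/

namespace Cmd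

/-- No effect. -/
def skip : Cmd := .instr (.rcopy 99 99)

@[simp] theorem sem_skip (s : State) : skip.sem s = s := by
  simp [skip, sem, Instr.apply]

/-- A list of instructions. -/
def block : List Instr → Cmd
  | [] => skip
  | [i] => .instr i
  | i :: l => .instr i ;; block l

theorem sem_block : ∀ (l : List Instr) (s : State),
    (block l).sem s = l.foldl (fun s i => i.apply s) s
  | [], s => by simp [block]
  | [i], s => rfl
  | i :: j :: l, s => by
    rw [block, sem, sem_block (j :: l)]
    · rfl
    · simp

theorem sem_seq (p q : Cmd) (s : State) : (p ;; q).sem s = q.sem (p.sem s) := rfl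

theorem sem_ite_ilt (a b : ℕ) (p q : Cmd) (s : State) :
    (Cmd.ite (.ilt a b) p q).sem s = if s.ireg a < s.ireg b then p.sem s else q.sem s := by
  rw [sem]
  by_cases h : s.ireg a < s.ireg b
  · rw [if_pos h, if_pos (show (Test.ilt a b).Holds s from h)]
  · rw [if_neg h, if_neg (show ¬ (Test.ilt a b).Holds s from h)]

/-- Read the point whose number is in the register `j` into the real registers from `d` on. -/
def loadPoint (j d : ℕ) : Cmd :=
  block [.iconst 30 0] ;;
  .loop 0 31 (.ite (.ilt 31 j) (block [.isucc 30, .isucc 30, .isucc 30]) skip) ;;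
  block [.rload d 30, .isucc 30, .rload (d + 1) 30, .isucc 30, .rload (d + 2) 30]

/-- Read the six points whose numbers are in the registers `10, …, 15`. -/
def loadPoints : Cmd :=
  loadPoint 10 0 ;; loadPoint 11 3 ;; loadPoint 12 6 ;; loadPoint 13 9 ;; loadPoint 14 12 ;;
  loadPoint 15 15

/-- Compute three mutually orthogonal normals `v`, `v × w`, `v × (v × w)` and the offsets of the
planes through the points with the numbers `o 0`, `o 1`, `o 2` among the six. -/
def planes (v w : VExp) (o : Fin 3 → ℕ) : Cmd :=
  v.code 18 ;; ((VExp.regs 18).cross w).code 21 ;; ((VExp.regs 18).cross (.regs 21)).code 24 ;;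
  ((VExp.regs 18).dot (.regs (3 * o 0))).code 27 ;;
  ((VExp.regs 21).dot (.regs (3 * o 1))).code 28 ;;
  ((VExp.regs 24).dot (.regs (3 * o 2))).code 29 ;;
  ((VExp.regs 21).dot (.regs 21)).code 30 ;; block [.rconst 31 0]

/-- Write the sides of all points with respect to the plane number `i` into the integer memory.
The points on the plane get the bits in the registers from `16 + 3 * i` on. -/
def sides (i : ℕ) : Cmd :=
  block [.icopy 32 (16 + 3 * i), .icopy 33 (17 + 3 * i), .icopy 34 (18 + 3 * i), .iconst 35 0,
    .iconst 38 i] ;;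
  .loop 0 36 (
    block [.rload 40 35, .isucc 35, .rload 41 35, .isucc 35, .rload 42 35, .isucc 35] ;;
    ((VExp.regs (18 + 3 * i)).dot (.regs 40) - .reg (27 + i)).code 43 ;;
    .ite (.rlt 31 43) (block [.iconst 37 1])
      (.ite (.rlt 43 31) (block [.iconst 37 0])
        (block [.icopy 37 32, .icopy 32 33, .icopy 33 34, .iconst 34 0])) ;;
    block [.istore 38 37, .isucc 38, .isucc 38, .isucc 38])

/-- Replace the sides of the point in the register `45` by its canonical label. -/
def relabelStep : Cmd :=
  block [.iload 46 43, .isucc 43, .iload 47 43, .isucc 43, .iload 48 43, .isucc 43,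
    .icopy 49 3] ;;
  .ite (.ilt 7 46) (block [.isucc 49, .isucc 49, .isucc 49, .isucc 49]) skip ;;
  .ite (.ilt 7 47) (block [.isucc 49, .isucc 49]) skip ;;
  .ite (.ilt 7 48) (block [.isucc 49]) skip ;;
  block [.iload 50 49] ;;
  .ite (.ilt 7 50) skip (block [.isucc 42, .icopy 50 42, .istore 49 42]) ;;
  block [.ipred 50, .istore 44 50, .isucc 44, .isucc 44, .isucc 44]

/-- Replace the sides by canonical labels. -/
def relabel : Cmd :=
  block [.icopy 40 3] ;;
  .loop 2 41 (block [.istore 40 7, .isucc 40]) ;;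
  block [.iconst 42 0, .iconst 43 0, .iconst 44 0] ;;
  .loop 0 45 relabelStep

/-- Add 8 to the register `53` if the point in the register `55` has the label in the register
`52`. -/
def tallyStep : Cmd :=
  block [.iload 56 54, .isucc 54, .isucc 54, .isucc 54] ;;
  .ite (.ilt 56 52) skip (.ite (.ilt 52 56) skip
    (block [.isucc 53, .isucc 53, .isucc 53, .isucc 53, .isucc 53, .isucc 53, .isucc 53,
      .isucc 53]))

/-- Set the register `51` to one if the label in the register `52` does not occur for one point
in 8. -/
def balanceStep : Cmd :=
  block [.iconst 53 0, .iconst 54 0] ;;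
  .loop 0 55 tallyStep ;;
  .ite (.ilt 53 0) (block [.iconst 51 1]) (.ite (.ilt 0 53) (block [.iconst 51 1]) skip)

/-- Set the register `51` to one if the labels do not occur equally often. -/
def balance : Cmd :=
  block [.iconst 51 0] ;; .loop 2 52 balanceStep

/-- Add the label of the point in the register `63` to the word that leads to the node of the trie
in the register `60`. -/
def recordStep : Cmd :=
  block [.iload 64 62, .isucc 62, .isucc 62, .isucc 62, .icopy 65 60] ;;
  .loop 2 66 (.ite (.ilt 66 64) (block [.isucc 65]) skip) ;;
  block [.iload 60 65] ;;
  .ite (.ilt 7 60) skip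
    (block [.iconst 61 1, .icopy 60 5, .istore 65 5, .isucc 5, .isucc 5, .isucc 5, .isucc 5,
      .isucc 5, .isucc 5, .isucc 5, .isucc 5])

/-- Insert the word of labels into the trie; the register `61` is set to one if it is new. -/
def record : Cmd :=
  block [.icopy 60 4, .iconst 61 0, .iconst 62 0] ;; .loop 0 63 recordStep

/-- Print the word of labels. -/
def printLabels : Cmd :=
  block [.iconst 67 0] ;;
  .loop 0 68 (block [.iload 69 67, .print 69, .isucc 67, .isucc 67, .isucc 67])

/-- Examine the partitions of three planes. -/
def candidate (v w : VExp) (o : Fin 3 → ℕ) : Cmd :=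
  planes v w o ;;
  .ite (.rlt 31 30)
    (sides 0 ;; sides 1 ;; sides 2 ;; relabel ;; balance ;;
      .ite (.ilt 7 51) skip (record ;; .ite (.ilt 7 61) printLabels skip)) skip

/-- The difference of the points number `a` and `b` among the six. -/
def diff (a b : ℕ) : VExp := .regs (3 * a) - .regs (3 * b)

/-- A numerator in the solution of the quadratic equation for the normal of the first of three
planes that contain pairs of points, where `k` is the sign of the root of the discriminant. -/
def rootCoef (k : ℤ) (d e f : VExp) : RExp :=
  .const k * RExp.sqrt ((d.cross e).dot f * (d.cross e).dot f
      - .const 4 * (e.dot f) * (d.dot e * d.dot f))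
    - (d.cross e).dot f

/-- A normal of the first of three planes that contain pairs of points with differences `d`, `e`,
`f`. -/
def rootVec (k : ℤ) (d e f : VExp) : VExp :=
  VExp.lin (rootCoef k d e f) (d.cross e) (.const 2 * e.dot f) (d.cross (d.cross e))

/-- All candidates that are determined by six points. -/
def candidates : Cmd :=
  loadPoints ;;
  candidate ((diff 0 1).cross (diff 0 2)) (diff 3 4) ![0, 3, 5] ;;
  candidate (rootVec 1 (diff 0 1) (diff 2 3) (diff 4 5)) (diff 2 3) ![0, 2, 4] ;;
  candidate (rootVec (-1) (diff 0 1) (diff 2 3) (diff 4 5)) (diff 2 3) ![0, 2, 4] ;;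
  candidate (diff 0 1) (diff 4 5) ![2, 4, 3]

/-- The nested loops. -/
def search : Cmd :=
  .loop 0 10 <| .loop 0 11 <| .loop 0 12 <| .loop 0 13 <| .loop 0 14 <| .loop 0 15 <|
  .loop 1 16 <| .loop 1 17 <| .loop 1 18 <| .loop 1 19 <| .loop 1 20 <| .loop 1 21 <|
  .loop 1 22 <| .loop 1 23 <| .loop 1 24 candidates

/-- Set the addresses of the tables. -/
def setup : Cmd :=
  block [.iconst 3 0] ;;
  .loop 0 31 (block [.isucc 3, .isucc 3, .isucc 3]) ;;
  block [.icopy 4 3, .isucc 4, .isucc 4, .isucc 4, .isucc 4, .isucc 4, .isucc 4, .isucc 4, .isucc 4,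
    .icopy 5 4, .isucc 5, .isucc 5, .isucc 5, .isucc 5, .isucc 5, .isucc 5, .isucc 5, .isucc 5]

/-- The commands after the initialization of the loop bounds. -/
def main : Cmd := setup ;; search

theorem wf_main : main.WF = true := by decide +kernel

/-- Six loops over the points of a sextuple, and at most one linear pass inside them at a time. -/
theorem depth_main : main.depth = 7 := by decide +kernel

end Cmd

end RealRAM

namespace RealRAM

open Cmd

namespace VExp

/-- All entries use only registers below `d`. -/
def Below (d : ℕ) (e : VExp) : Prop := ∀ k, (e k).Below d = true

variable {d : ℕ} {e f : VExp}

theorem Below.mono {d' : ℕ} (h : d ≤ d') (he : e.Below d) : e.Below d' := fun k =>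
  RExp.Below.mono h (he k)

theorem below_regs {a : ℕ} (h : a + 3 ≤ d) : (regs a).Below d := fun k =>
  decide_eq_true (by have := k.isLt; omega)

theorem below_op (o : ArithOp) {e f : RExp} (he : e.Below d = true) (hf : f.Below d = true) :
    (RExp.op o e f).Below d = true := by simp [RExp.Below, he, hf]

theorem Below.sub (he : e.Below d) (hf : f.Below d) : Below d (e - f) := fun k =>
  below_op .sub (he k) (hf k)

theorem Below.dot (he : e.Below d) (hf : f.Below d) : (VExp.dot e f).Below d = true :=
  below_op .add (below_op .add (below_op .mul (he 0) (hf 0)) (below_op .mul (he 1) (hf 1)))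
    (below_op .mul (he 2) (hf 2))

theorem Below.cross (he : e.Below d) (hf : f.Below d) : Below d (VExp.cross e f) := by
  have h : ∀ i j, (e i * f j - e j * f i).Below d = true := fun i j =>
    below_op .sub (below_op .mul (he i) (hf j)) (below_op .mul (he j) (hf i))
  intro k
  fin_cases k
  exacts [h 1 2, h 2 0, h 0 1]

theorem Below.lin {c c' : RExp} (hc : c.Below d = true) (he : e.Below d) (hc' : c'.Below d = true)
    (hf : f.Below d) : Below d (VExp.lin c e c' f) := fun k =>
  below_op .add (below_op .mul hc (he k)) (below_op .mul hc' (hf k))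

theorem eval_congr {ρ ρ' : ℕ → ℝ} (h : ∀ a < d, ρ a = ρ' a) (he : e.Below d) :
    e.eval ρ = e.eval ρ' := funext fun k => RExp.eval_congr h (he k)

end VExp

/-! ## The effect of the parts of the program -/

/-- Natural numbers cannot be multiplied by the machine, so the address `3 * j` is reached by a
linear pass that adds three in each of the first `j` rounds. -/
theorem sem_loadPoint {j d : ℕ} (hj : j < 30) (s : State) (hjN : s.ireg j ≤ s.ireg 0) :
    (∀ k : Fin 3, ((loadPoint j d).sem s).rreg (d + k) = s.rmem (3 * s.ireg j + k)) ∧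
    ∀ a, a < d ∨ d + 3 ≤ a → ((loadPoint j d).sem s).rreg a = s.rreg a := by
  rw [loadPoint, sem, sem]
  set s1 := (block [Instr.iconst 30 0]).sem s with hs1
  set p : Cmd := .ite (.ilt 31 j) (block [.isucc 30, .isucc 30, .isucc 30]) skip with hp
  have hpj : ∀ a < 30, (Cmd.loop 0 31 p).any (·.setsI a) = false := by
    intro a ha
    simp [hp, any, block, skip, Instr.setsI]
    omega
  have e1 : s1.ireg 0 = s.ireg 0 := by simp [hs1, sem_block, Instr.apply]
  have e2 : s1.ireg j = s.ireg j := by simp [hs1, sem_block, Instr.apply, hj.ne]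
  have e3 : s1.rmem = s.rmem := by simp [hs1, sem_block, Instr.apply]
  have e4 : s1.rreg = s.rreg := by simp [hs1, sem_block, Instr.apply]
  have hI := loop_induct (b := 0) (r := 31) (p := p) (s := s1) rfl
    (fun k s' => s'.ireg 30 = 3 * min k (s.ireg j)) (by simp [hs1, sem_block, Instr.apply]) (by
      intro k s' hk hr hF hI
      have hj' : s'.ireg j = s.ireg j := (hF.ireg j (hpj j hj)).trans e2
      by_cases hlt : k < s.ireg j
      · have hc : (Test.ilt 31 j).Holds s' := by simp only [Test.Holds]; omega
        simp [hp, sem, hc, sem_block, Instr.apply, hI]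
        omega
      · have hc : ¬ (Test.ilt 31 j).Holds s' := by simp only [Test.Holds]; omega
        simp [hp, sem, hc, Instr.apply, hI]
        omega)
  simp only [e1, min_eq_right hjN] at hI
  have hF := (Cmd.loop 0 31 p).frame s1
  set s2 := (Cmd.loop 0 31 p).sem s1
  have e5 : s2.rmem = s.rmem := (hF.rmem rfl).trans e3
  have e6 : s2.rreg = s.rreg := by
    refine Eq.trans ?_ e4
    exact loop_induct (b := 0) (r := 31) (p := p) (s := s1) rfl (fun _ s' => s'.rreg = s1.rreg) rfl
      (fun k s' _ _ _ hI => by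
        simp only [hp, sem]
        split_ifs <;> simp [sem_block, Instr.apply, hI])
  clear_value s2
  constructor
  · intro k
    fin_cases k <;> simp [sem_block, Instr.apply, e5, hI]
  · intro a ha
    have h0 : a ≠ d := by omega
    have h1 : a ≠ d + 1 := by omega
    have h2 : a ≠ d + 2 := by omega
    simp [sem_block, Instr.apply, e6, h0, h1, h2]

/-- The point number `j` of the table `m`. -/
def pt (m : ℕ → ℝ) (j : ℕ) : Fin 3 → ℝ := fun k => m (3 * j + k)

theorem sem_loadPoints (s : State) (h : ∀ i < 6, s.ireg (10 + i) ≤ s.ireg 0) :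
    ∀ i < 6, (fun k : Fin 3 => (loadPoints.sem s).rreg (3 * i + k)) = pt s.rmem (s.ireg (10 + i)) := by
  rw [loadPoints]
  simp only [sem]
  set s1 := (loadPoint 10 0).sem s with hs1
  set s2 := (loadPoint 11 3).sem s1 with hs2
  set s3 := (loadPoint 12 6).sem s2 with hs3
  set s4 := (loadPoint 13 9).sem s3 with hs4
  set s5 := (loadPoint 14 12).sem s4 with hs5
  have a1 : ∀ a < 30, s1.ireg a = s.ireg a := fun a ha =>
    (frame _ s).ireg a (by interval_cases a <;> rfl)
  have a2 : ∀ a < 30, s2.ireg a = s.ireg a := fun a ha =>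
    ((frame _ s1).ireg a (by interval_cases a <;> rfl)).trans (a1 a ha)
  have a3 : ∀ a < 30, s3.ireg a = s.ireg a := fun a ha =>
    ((frame _ s2).ireg a (by interval_cases a <;> rfl)).trans (a2 a ha)
  have a4 : ∀ a < 30, s4.ireg a = s.ireg a := fun a ha =>
    ((frame _ s3).ireg a (by interval_cases a <;> rfl)).trans (a3 a ha)
  have a5 : ∀ a < 30, s5.ireg a = s.ireg a := fun a ha =>
    ((frame _ s4).ireg a (by interval_cases a <;> rfl)).trans (a4 a ha)
  have m1 : s1.rmem = s.rmem := (frame _ s).rmem rfl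
  have m2 : s2.rmem = s.rmem := ((frame _ s1).rmem rfl).trans m1
  have m3 : s3.rmem = s.rmem := ((frame _ s2).rmem rfl).trans m2
  have m4 : s4.rmem = s.rmem := ((frame _ s3).rmem rfl).trans m3
  have m5 : s5.rmem = s.rmem := ((frame _ s4).rmem rfl).trans m4
  obtain ⟨b1, c1⟩ := sem_loadPoint (j := 10) (d := 0) (by omega) s (h 0 (by omega))
  obtain ⟨b2, c2⟩ := sem_loadPoint (j := 11) (d := 3) (by omega) s1
    (by rw [a1 11 (by omega), a1 0 (by omega)]; exact h 1 (by omega))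
  obtain ⟨b3, c3⟩ := sem_loadPoint (j := 12) (d := 6) (by omega) s2
    (by rw [a2 12 (by omega), a2 0 (by omega)]; exact h 2 (by omega))
  obtain ⟨b4, c4⟩ := sem_loadPoint (j := 13) (d := 9) (by omega) s3
    (by rw [a3 13 (by omega), a3 0 (by omega)]; exact h 3 (by omega))
  obtain ⟨b5, c5⟩ := sem_loadPoint (j := 14) (d := 12) (by omega) s4
    (by rw [a4 14 (by omega), a4 0 (by omega)]; exact h 4 (by omega))
  obtain ⟨b6, c6⟩ := sem_loadPoint (j := 15) (d := 15) (by omega) s5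
    (by rw [a5 15 (by omega), a5 0 (by omega)]; exact h 5 (by omega))
  rw [m1, a1 _ (by omega)] at b2
  rw [m2, a2 _ (by omega)] at b3
  rw [m3, a3 _ (by omega)] at b4
  rw [m4, a4 _ (by omega)] at b5
  rw [m5, a5 _ (by omega)] at b6
  intro i hi
  funext k
  have hk := k.isLt
  interval_cases i
  · rw [c6 _ (by omega), c5 _ (by omega), c4 _ (by omega), c3 _ (by omega), c2 _ (by omega)]
    exact b1 k
  · rw [c6 _ (by omega), c5 _ (by omega), c4 _ (by omega), c3 _ (by omega)]
    exact b2 k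
  · rw [c6 _ (by omega), c5 _ (by omega), c4 _ (by omega)]
    exact b3 k
  · rw [c6 _ (by omega), c5 _ (by omega)]
    exact b4 k
  · rw [c6 _ (by omega)]
    exact b5 k
  · exact b6 k

/-- The three normals belonging to `v` and `w`. -/
def normals (v w : Fin 3 → ℝ) : Fin 3 → Fin 3 → ℝ :=
  ![v, crossProduct v w, crossProduct v (crossProduct v w)]

/-- Each value is written above all its inputs, so the final register file still contains the
points, normals and offsets. Register `30` receives the squared length of `v × w`, and register `31`
the zero needed for comparisons. -/
theorem sem_planes {v w : VExp} {o : Fin 3 → ℕ} (hv : v.Below 18)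
    (hw : w.Below 18) (ho : ∀ i, o i < 6) (s : State) :
    ∃ f : ℕ → ℝ, (planes v w o).sem s = { s with rreg := f } ∧ (∀ a < 18, f a = s.rreg a) ∧
      (∀ i : Fin 3, (fun k : Fin 3 => f (18 + 3 * i + k)) =
        normals (v.eval s.rreg) (w.eval s.rreg) i) ∧
      (∀ i : Fin 3, f (27 + i) = normals (v.eval s.rreg) (w.eval s.rreg) i ⬝ᵥ
        fun k : Fin 3 => s.rreg (3 * o i + k)) ∧
      f 30 = normals (v.eval s.rreg) (w.eval s.rreg) 1 ⬝ᵥ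
        normals (v.eval s.rreg) (w.eval s.rreg) 1 ∧ f 31 = 0 := by
  have ho0 := ho 0
  have ho1 := ho 1
  have ho2 := ho 2
  have b18 : (VExp.regs 18).Below 21 := VExp.below_regs le_rfl
  have b21 : (VExp.regs 21).Below 24 := VExp.below_regs le_rfl
  obtain ⟨f1, h1, e1, l1⟩ := v.sem_code 18 s hv
  obtain ⟨f2, h2, e2, l2⟩ := ((VExp.regs 18).cross w).sem_code 21 { s with rreg := f1 }
    (b18.cross (hw.mono (by omega)))
  obtain ⟨f3, h3, e3, l3⟩ := ((VExp.regs 18).cross (.regs 21)).sem_code 24 { s with rreg := f2 }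
    ((b18.mono (by omega)).cross b21)
  obtain ⟨f4, h4, e4, l4⟩ := ((VExp.regs 18).dot (.regs (3 * o 0))).sem_code 27
    { s with rreg := f3 } ((VExp.below_regs (by omega)).dot (VExp.below_regs (by omega)))
  obtain ⟨f5, h5, e5, l5⟩ := ((VExp.regs 21).dot (.regs (3 * o 1))).sem_code 28
    { s with rreg := f4 } ((VExp.below_regs (by omega)).dot (VExp.below_regs (by omega)))
  obtain ⟨f6, h6, e6, l6⟩ := ((VExp.regs 24).dot (.regs (3 * o 2))).sem_code 29
    { s with rreg := f5 } ((VExp.below_regs (by omega)).dot (VExp.below_regs (by omega)))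
  obtain ⟨f7, h7, e7, l7⟩ := ((VExp.regs 21).dot (.regs 21)).sem_code 30
    { s with rreg := f6 } ((VExp.below_regs (by omega)).dot (VExp.below_regs (by omega)))
  simp only [VExp.eval_cross, VExp.eval_dot, VExp.eval_regs] at e2 e3 e4 e5 e6 e7
  simp only at l2 l3 l4 l5 l6 l7
  have hw1 : w.eval f1 = w.eval s.rreg := VExp.eval_congr l1 hw
  -- The facts `i1` to `i6` say that each intermediate result survives all later computations.
  have i1 : ∀ a < 21, f7 a = f1 a := fun a ha => by
    rw [l7 a (by omega), l6 a (by omega), l5 a (by omega), l4 a (by omega), l3 a (by omega),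
      l2 a (by omega)]
  have i2 : ∀ a < 24, f7 a = f2 a := fun a ha => by
    rw [l7 a (by omega), l6 a (by omega), l5 a (by omega), l4 a (by omega), l3 a (by omega)]
  have i3 : ∀ a < 27, f7 a = f3 a := fun a ha => by
    rw [l7 a (by omega), l6 a (by omega), l5 a (by omega), l4 a (by omega)]
  have i4 : ∀ a < 28, f7 a = f4 a := fun a ha => by
    rw [l7 a (by omega), l6 a (by omega), l5 a (by omega)]
  have i5 : ∀ a < 29, f7 a = f5 a := fun a ha => by rw [l7 a (by omega), l6 a (by omega)]
  have i6 : ∀ a < 30, f7 a = f6 a := l7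
  have n0 : (fun k : Fin 3 => f7 (18 + k)) = v.eval s.rreg := by
    rw [← e1]; funext k; exact i1 _ (by omega)
  have n1 : (fun k : Fin 3 => f7 (21 + k)) = crossProduct (v.eval s.rreg) (w.eval s.rreg) := by
    rw [← hw1, ← n0]
    refine Eq.trans ?_ (e2.trans ?_)
    · funext k; exact i2 _ (by omega)
    · congr 2; funext k; exact (i1 _ (by omega)).symm
  have n2 : (fun k : Fin 3 => f7 (24 + k)) =
      crossProduct (v.eval s.rreg) (crossProduct (v.eval s.rreg) (w.eval s.rreg)) := by
    rw [← n1, ← n0]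
    refine Eq.trans ?_ (e3.trans ?_)
    · funext k; exact i3 _ (by omega)
    · congr 2 <;> funext k
      · exact (i2 _ (by omega)).symm
      · exact (i2 _ (by omega)).symm
  have hp : ∀ a < 18, f7 a = s.rreg a := fun a ha => (i1 a (by omega)).trans (l1 a ha)
  have hpt : ∀ i : ℕ, i < 6 → (fun k : Fin 3 => f7 (3 * i + k)) = fun k : Fin 3 =>
      s.rreg (3 * i + k) := fun i hi => funext fun k => hp _ (by omega)
  refine ⟨Function.update f7 31 0, ?_, ?_, ?_, ?_, ?_, Function.update_self ..⟩
  · simp only [planes, sem]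
    rw [h1, h2, h3, h4, h5, h6, h7]
    simp [sem_block, Instr.apply]
  · intro a ha
    rw [Function.update_of_ne (by omega), hp a ha]
  · intro i
    refine Eq.trans (funext fun k : Fin 3 => Function.update_of_ne (by omega) _ _) ?_
    fin_cases i
    exacts [n0, n1, n2]
  · intro i
    rw [Function.update_of_ne (by omega)]
    fin_cases i
    · refine (i4 27 (by omega)).trans (e4.trans ?_)
      change _ = v.eval s.rreg ⬝ᵥ (fun k : Fin 3 => s.rreg (3 * o 0 + k))
      rw [← hpt _ ho0, ← n0]
      congr 1 <;> funext k
      · exact (i3 _ (by omega)).symm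
      · exact (i3 _ (by omega)).symm
    · refine (i5 28 (by omega)).trans (e5.trans ?_)
      change _ = crossProduct _ _ ⬝ᵥ (fun k : Fin 3 => s.rreg (3 * o 1 + k))
      rw [← hpt _ ho1, ← n1]
      congr 1 <;> funext k
      · exact (i4 _ (by omega)).symm
      · exact (i4 _ (by omega)).symm
    · refine (i6 29 (by omega)).trans (e6.trans ?_)
      change _ = crossProduct _ (crossProduct _ _) ⬝ᵥ (fun k : Fin 3 => s.rreg (3 * o 2 + k))
      rw [← hpt _ ho2, ← n2]
      congr 1 <;> funext k
      · exact (i5 _ (by omega)).symm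
      · exact (i5 _ (by omega)).symm
  · rw [Function.update_of_ne (by omega)]
    refine e7.trans ?_
    change _ = crossProduct _ _ ⬝ᵥ crossProduct _ _
    rw [← n1]
    congr 1 <;> funext k
    · exact (i6 _ (by omega)).symm
    · exact (i6 _ (by omega)).symm

end RealRAM

/-! ### Sides of the points with respect to one plane -/

namespace RealRAM

open Cmd

open Classical in
/-- The sides of a plane on which the points lie, if `val j` is positive or negative according to
the side of the point number `j`; the points on the plane get the bits `u 0`, `u 1`, …. -/
noncomputable def sideBit (u : ℕ → ℕ) (val : ℕ → ℝ) (j : ℕ) : ℕ :=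
  if 0 < val j then 1 else if val j < 0 then 0 else u (Nat.count (fun i => val i = 0) j)

open Classical in
-- Registers `32`, `33`, `34` act as a queue: each point found on the plane takes its first bit and
-- shifts the rest, so they always hold the bits from the current number of such points on.
theorem sem_sides {i : ℕ} (hi : i < 3) (s : State) (h31 : s.rreg 31 = 0) {u : ℕ → ℕ}
    (hu : ∀ k < 3, u k = s.ireg (16 + 3 * i + k)) (hu' : ∀ k, 3 ≤ k → u k = 0) {val : ℕ → ℝ}
    (hval : ∀ j, val j =
      (fun k : Fin 3 => s.rreg (18 + 3 * i + k)) ⬝ᵥ pt s.rmem j - s.rreg (27 + i)) :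
    ((sides i).sem s).imem = fun a =>
      if a < 3 * s.ireg 0 ∧ a % 3 = i then sideBit u val (a / 3) else s.imem a := by
  rw [sides, sem]
  set s0 := (block [.icopy 32 (16 + 3 * i), .icopy 33 (17 + 3 * i), .icopy 34 (18 + 3 * i),
    .iconst 35 0, .iconst 38 i]).sem s with hs0
  have hb0 : ∀ a < 30, s0.ireg a = s.ireg a := fun a ha =>
    (frame _ s).ireg a (by interval_cases a <;> rfl)
  have hi32 : 17 + 3 * i ≠ 32 := by omega
  have hi33 : 18 + 3 * i ≠ 32 := by omega
  have hi34 : 18 + 3 * i ≠ 33 := by omega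
  have h0 : s0.ireg 35 = 0 ∧ s0.ireg 38 = i ∧ s0.ireg 32 = u 0 ∧ s0.ireg 33 = u 1 ∧
      s0.ireg 34 = u 2 ∧ s0.imem = s.imem ∧ s0.rreg = s.rreg ∧ s0.rmem = s.rmem := by
    rw [hu 0 (by omega), hu 1 (by omega), hu 2 (by omega)]
    have e1 : 16 + 3 * i + 1 = 17 + 3 * i := by omega
    have e2 : 16 + 3 * i + 2 = 18 + 3 * i := by omega
    simp [hs0, sem_block, Instr.apply, hi32, hi33, hi34, e1, e2]
  clear_value s0
  obtain ⟨z35, z38, z32, z33, z34, zim, zrr, zrm⟩ := h0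
  rw [← hb0 0 (by omega)]
  refine (loop_induct (s := s0) (b := 0) (r := 36) rfl (fun k s' =>
    (s'.imem = fun a => if a < 3 * k ∧ a % 3 = i then sideBit u val (a / 3) else s.imem a) ∧
    s'.ireg 35 = 3 * k ∧ s'.ireg 38 = 3 * k + i ∧
    s'.ireg 32 = u (Nat.count (fun i => val i = 0) k) ∧
    s'.ireg 33 = u (Nat.count (fun i => val i = 0) k + 1) ∧
    s'.ireg 34 = u (Nat.count (fun i => val i = 0) k + 2)) ?_ ?_).1
  · simp [Instr.apply, z35, z38, z32, z33, z34, zim]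
  · rintro k s1 hk h36 hF ⟨j1, j2, j3, j4, j5, j6⟩
    have hrr : ∀ a < 40, s1.rreg a = s.rreg a := fun a ha =>
      (hF.rreg a (by interval_cases a <;> rfl)).trans (congrFun zrr a)
    have hrm : s1.rmem = s.rmem := (hF.rmem rfl).trans zrm
    simp only [sem]
    set s2 := (block [.rload 40 35, .isucc 35, .rload 41 35, .isucc 35, .rload 42 35,
      .isucc 35]).sem s1 with hs2
    have q : s2.ireg 35 = 3 * (k + 1) ∧ (∀ a, a ≠ 35 → s2.ireg a = s1.ireg a) ∧
        s2.imem = s1.imem ∧ (∀ a < 40, s2.rreg a = s.rreg a) ∧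
        (fun l : Fin 3 => s2.rreg (40 + l)) = pt s.rmem k := by
      refine ⟨?_, ?_, ?_, ?_, ?_⟩
      · simp [hs2, sem_block, Instr.apply, j2]; omega
      · intro a ha; simp [hs2, sem_block, Instr.apply, ha]
      · simp [hs2, sem_block, Instr.apply]
      · intro a ha
        rw [← hrr a ha]
        exact (frame _ s1).rreg a (by interval_cases a <;> rfl)
      · funext l
        fin_cases l <;> simp [hs2, sem_block, Instr.apply, j2, hrm, pt]
    clear_value s2
    obtain ⟨q1, q2, q3, q4, q5⟩ := q
    obtain ⟨f, hf, fe, fl⟩ := ((VExp.regs (18 + 3 * i)).dot (.regs 40) - .reg (27 + i)).sem_code 43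
      s2 (VExp.below_op .sub ((VExp.below_regs (by omega)).dot (VExp.below_regs (by omega)))
        (by simp [RExp.Below]; omega))
    rw [hf]
    have hfv : f 43 = val k := by
      rw [fe, hval, RExp.eval_sub, VExp.eval_dot, VExp.eval_regs, VExp.eval_regs, q5]
      rw [RExp.eval_reg, q4 _ (by omega)]
      congr 2
      funext l
      exact q4 _ (by omega)
    have hf0 : f 31 = 0 := by rw [fl 31 (by omega), q4 31 (by omega), h31]
    have him : ∀ b, b = sideBit u val k → Function.update (fun a => if a < 3 * k ∧ a % 3 = i then
        sideBit u val (a / 3) else s.imem a) (3 * k + i) b = fun a =>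
        if a < 3 * (k + 1) ∧ a % 3 = i then sideBit u val (a / 3) else s.imem a := by
      rintro b rfl
      funext a
      by_cases ha : a = 3 * k + i
      · have h1 : a < 3 * (k + 1) ∧ a % 3 = i := by omega
        have h2 : a / 3 = k := by omega
        rw [ha, Function.update_self, ← ha, if_pos h1, h2]
      · rw [Function.update_of_ne ha]
        by_cases h1 : a < 3 * k ∧ a % 3 = i
        · rw [if_pos h1, if_pos (by omega)]
        · rw [if_neg h1, if_neg (by omega)]
    have hcnt := Nat.count_succ (fun i => val i = 0) k
    by_cases hpos : 0 < val k
    · have hc : (Test.rlt 31 43).Holds { s2 with rreg := f } := by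
        simp only [Test.Holds, hfv, hf0, hpos]
      rw [if_neg hpos.ne'] at hcnt
      rw [if_pos hc]
      simp only [hcnt, add_zero]
      refine ⟨?_, ?_⟩
      · rw [← him 1 (by rw [sideBit, if_pos hpos])]
        simp [sem_block, Instr.apply, q2, q3, j1, j3]
      · simp [sem_block, Instr.apply, *]
        omega
    by_cases hneg : val k < 0
    · have hc : ¬ (Test.rlt 31 43).Holds { s2 with rreg := f } := by
        simpa only [Test.Holds, hfv, hf0] using hpos
      have hc' : (Test.rlt 43 31).Holds { s2 with rreg := f } := by
        simpa only [Test.Holds, hfv, hf0] using hneg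
      rw [if_neg hneg.ne] at hcnt
      rw [if_neg hc, if_pos hc']
      simp only [hcnt, add_zero]
      refine ⟨?_, ?_⟩
      · rw [← him 0 (by rw [sideBit, if_neg hpos, if_pos hneg])]
        simp [sem_block, Instr.apply, q2, q3, j1, j3]
      · simp [sem_block, Instr.apply, *]
        omega
    · have hc : ¬ (Test.rlt 31 43).Holds { s2 with rreg := f } := by
        simpa only [Test.Holds, hfv, hf0] using hpos
      have hc' : ¬ (Test.rlt 43 31).Holds { s2 with rreg := f } := by
        simpa only [Test.Holds, hfv, hf0] using hneg
      rw [if_pos (le_antisymm (not_lt.1 hpos) (not_lt.1 hneg))] at hcnt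
      rw [if_neg hc, if_neg hc']
      simp only [hcnt]
      refine ⟨?_, ?_⟩
      · rw [← him _ (by rw [sideBit, if_neg hpos, if_neg hneg])]
        simp [sem_block, Instr.apply, q2, q3, j1, j3, j4]
      -- The shift brings a zero into the last place of the queue, in agreement with the bits being
      -- zero from index 3 on.
      · rw [hu' (Nat.count (fun i => val i = 0) k + 1 + 2) (by omega)]
        simp [sem_block, Instr.apply, q1, q2, j3, j5, j6, add_assoc]
        omega

end RealRAM

/-! ### Canonical relabelling, balance test, trie insertion and output -/

namespace RealRAM

open Cmd

/-- The label `0, …, 7` of a point that is given by its three sides. -/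
def rawLabel (mem : ℕ → ℕ) (j : ℕ) : ℕ :=
  (if 0 < mem (3 * j) then 4 else 0) + (if 0 < mem (3 * j + 1) then 2 else 0) +
    if 0 < mem (3 * j + 2) then 1 else 0

theorem rawLabel_lt (mem : ℕ → ℕ) (j : ℕ) : rawLabel mem j < 8 := by
  unfold rawLabel; split_ifs <;> omega

open Classical in
-- Eight cells after the side table remember, for each raw label, its new label plus one, with zero
-- meaning that it has not occurred. The new label overwrites the first side bit of a point only
-- after all three have been read.
theorem sem_relabel (s : State) (h2 : s.ireg 2 = 8) (h3 : s.ireg 3 = 3 * s.ireg 0)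
    (h7 : s.ireg 7 = 0) :
    (∀ j < s.ireg 0, (relabel.sem s).imem (3 * j) = canonLabel (rawLabel s.imem) j) ∧
    ∀ a, 3 * s.ireg 0 + 8 ≤ a → (relabel.sem s).imem a = s.imem a := by
  set N := s.ireg 0 with hN
  set r := rawLabel s.imem with hr
  simp only [relabel, sem_seq]
  set s1 := (block [.icopy 40 3]).sem s with hs1
  have a1 : ∀ a < 40, s1.ireg a = s.ireg a := fun a ha =>
    (frame _ s).ireg a (by interval_cases a <;> rfl)
  have hA := loop_induct (s := s1) (b := 2) (r := 41) (p := block [.istore 40 7, .isucc 40]) rfl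
    (fun k s' => s'.ireg 40 = 3 * N + k ∧ (∀ a, a < 3 * N ∨ 3 * N + 8 ≤ a → s'.imem a = s.imem a) ∧
      ∀ v < k, s'.imem (3 * N + v) = 0) (by simp [hs1, sem_block, Instr.apply, h3]) (by
    rintro k s' hk hr' hF ⟨i1, i2, i3⟩
    have hk8 : k < 8 := by rw [a1 2 (by omega), h2] at hk; exact hk
    have h7' : s'.ireg 7 = 0 := by rw [hF.ireg 7 rfl, a1 7 (by omega), h7]
    refine ⟨by simp [sem_block, Instr.apply, i1]; omega, ?_, ?_⟩
    · intro a ha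
      have : a ≠ 3 * N + k := by omega
      simp [sem_block, Instr.apply, i1, this, i2 a ha]
    · intro v hv
      by_cases hvk : v = k
      · simp [sem_block, Instr.apply, i1, h7', hvk]
      · simp [sem_block, Instr.apply, i1, hvk, i3 v (by omega)])
  have a2 := (frame (.loop 2 41 (block [.istore 40 7, .isucc 40])) s1).ireg
  set s2 := (Cmd.loop 2 41 (block [.istore 40 7, .isucc 40])).sem s1
  rw [a1 2 (by omega), h2] at hA
  obtain ⟨-, m2, z2⟩ := hA
  have a2' : ∀ a < 40, s2.ireg a = s.ireg a := fun a ha =>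
    (a2 a (by interval_cases a <;> rfl)).trans (a1 a ha)
  set s3 := (block [.iconst 42 0, .iconst 43 0, .iconst 44 0]).sem s2 with hs3
  have a3 : ∀ a < 40, s3.ireg a = s.ireg a := fun a ha =>
    ((frame _ s2).ireg a (by interval_cases a <;> rfl)).trans (a2' a ha)
  have m3 : s3.imem = s2.imem := (frame _ s2).imem rfl
  have r3 : s3.ireg 42 = 0 ∧ s3.ireg 43 = 0 ∧ s3.ireg 44 = 0 := by
    simp [hs3, sem_block, Instr.apply]
  clear_value s3 s2
  have h0 : s3.ireg 0 = N := a3 0 (by omega)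
  -- The invariant separates the unread sides, the labels already written, and the two kinds of
  -- table entries: zero for unseen raw labels, canonical label plus one for the others.
  have hI := loop_induct (s := s3) (b := 0) (r := 45) (p := relabelStep) rfl
    (fun k s' => s'.ireg 42 = Nat.count (IsLeader r) k ∧ s'.ireg 43 = 3 * k ∧ s'.ireg 44 = 3 * k ∧
      (∀ a, 3 * N + 8 ≤ a → s'.imem a = s.imem a) ∧
      (∀ a, 3 * k ≤ a → a < 3 * N → s'.imem a = s.imem a) ∧
      (∀ j < k, s'.imem (3 * j) = canonLabel r j) ∧
      (∀ v < 8, (∀ j < k, r j ≠ v) → s'.imem (3 * N + v) = 0) ∧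
      ∀ j < k, s'.imem (3 * N + r j) = canonLabel r j + 1) ?_ ?_
  · rw [h0] at hI
    obtain ⟨-, -, -, g1, -, g2, -⟩ := hI
    exact ⟨g2, g1⟩
  · refine ⟨by simp [Instr.apply, r3], by simp [Instr.apply, r3], by simp [Instr.apply, r3],
      fun a ha => ?_, fun a _ ha => ?_, by simp, fun v hv _ => ?_, by simp⟩
    · exact (congrFun m3 a).trans (m2 a (.inr ha))
    · exact (congrFun m3 a).trans (m2 a (.inl ha))
    · exact (congrFun m3 _).trans (z2 v hv)
  · rintro k s' hk hk45 hF ⟨i42, i43, i44, iT, iB, iL, iZ, iM⟩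
    rw [h0] at hk
    have f3 : s'.ireg 3 = 3 * N := by rw [hF.ireg 3 rfl, a3 3 (by omega), h3]
    have f7 : s'.ireg 7 = 0 := by rw [hF.ireg 7 rfl, a3 7 (by omega), h7]
    have b0 := iB (3 * k) (by omega) (by omega)
    have b1 := iB (3 * k + 1) (by omega) (by omega)
    have b2 := iB (3 * k + 2) (by omega) (by omega)
    have hrk : r k < 8 := rawLabel_lt _ _
    simp only [relabelStep, sem_seq, sem_ite_ilt]
    set t1 := (block [.iload 46 43, .isucc 43, .iload 47 43, .isucc 43, .iload 48 43, .isucc 43,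
      .icopy 49 3]).sem s' with ht1
    have q : t1.ireg 46 = s.imem (3 * k) ∧ t1.ireg 47 = s.imem (3 * k + 1) ∧
        t1.ireg 48 = s.imem (3 * k + 2) ∧ t1.ireg 49 = 3 * N ∧ t1.ireg 43 = 3 * (k + 1) ∧
        t1.ireg 42 = Nat.count (IsLeader r) k ∧ t1.ireg 44 = 3 * k ∧ t1.ireg 7 = 0 ∧
        t1.imem = s'.imem ∧ t1.ireg 45 = k := by
      simp [sem_block, Instr.apply, *]
      omega
    clear_value t1
    obtain ⟨c46, c47, c48, c49, c43, c42, c44, c7, cim, c45⟩ := q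
    set t2 := if t1.ireg 7 < t1.ireg 46 then
      (block [.isucc 49, .isucc 49, .isucc 49, .isucc 49]).sem t1 else skip.sem t1 with ht2
    have q : t2 = { t1 with ireg := (Function.update t1.ireg 49
        (3 * N + if 0 < s.imem (3 * k) then 4 else 0)) } := by
      rw [ht2]
      simp only [c7, c46]
      split_ifs <;> simp [sem_block, Instr.apply, c49]
      rw [← c49, Function.update_eq_self]
    clear_value t2
    set t3 := if t2.ireg 7 < t2.ireg 47 then
      (block [.isucc 49, .isucc 49]).sem t2 else skip.sem t2 with ht3
    have q' : t3 = { t1 with ireg := (Function.update t1.ireg 49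
        (3 * N + (if 0 < s.imem (3 * k) then 4 else 0) +
          if 0 < s.imem (3 * k + 1) then 2 else 0)) } := by
      rw [ht3, q]
      simp only [Function.update_of_ne (show 7 ≠ 49 by decide),
        Function.update_of_ne (show 47 ≠ 49 by decide), c7, c47]
      split_ifs <;> simp [sem_block, Instr.apply]
    clear_value t3
    set t4 := if t3.ireg 7 < t3.ireg 48 then (block [.isucc 49]).sem t3 else skip.sem t3 with ht4
    have q'' : t4 = { t1 with ireg := Function.update t1.ireg 49 (3 * N + r k) } := by
      rw [ht4, q', hr, rawLabel]
      simp only [Function.update_of_ne (show 7 ≠ 49 by decide),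
        Function.update_of_ne (show 48 ≠ 49 by decide), c7, c48]
      split_ifs <;> simp [sem_block, Instr.apply]
    clear_value t4
    set t5 := (block [.iload 50 49]).sem t4 with ht5
    have q5 : t5.ireg 50 = s'.imem (3 * N + r k) ∧ t5.ireg 49 = 3 * N + r k ∧
        t5.ireg 43 = 3 * (k + 1) ∧ t5.ireg 42 = Nat.count (IsLeader r) k ∧ t5.ireg 44 = 3 * k ∧
        t5.ireg 7 = 0 ∧ t5.imem = s'.imem ∧ t5.ireg 45 = k := by
      rw [ht5, q'']
      simp [sem_block, Instr.apply, cim, c43, c42, c44, c7, c45]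
    clear_value t5
    clear q q' q''
    obtain ⟨d50, d49, d43, d42, d44, d7, dim, d45⟩ := q5
    have hcnt := Nat.count_succ (IsLeader r) k
    by_cases hL : IsLeader r k
    · have hz := iZ (r k) hrk hL
      rw [if_pos hL] at hcnt
      have hlab := hL.canonLabel_eq
      have hc : ¬ t5.ireg 7 < t5.ireg 50 := by simp [d7, d50, hz]
      rw [if_neg hc]
      have him : ((Instr.isucc 45).apply ((block [.ipred 50, .istore 44 50, .isucc 44, .isucc 44,
          .isucc 44]).sem ((block [.isucc 42, .icopy 50 42, .istore 49 42]).sem t5))).imem =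
          Function.update (Function.update s'.imem (3 * N + r k) (canonLabel r k + 1)) (3 * k)
            (canonLabel r k) := by
        simp [sem_block, Instr.apply, d42, d49, d44, dim, hlab]
      rw [him]
      refine ⟨by simp [sem_block, Instr.apply, d42, hcnt], by simp [sem_block, Instr.apply, d43],
        by simp [sem_block, Instr.apply, d44]; omega, ?_, ?_, ?_, ?_, ?_⟩
      · intro a ha
        rw [Function.update_of_ne (by omega), Function.update_of_ne (by omega), iT a ha]
      · intro a ha ha'
        rw [Function.update_of_ne (by omega), Function.update_of_ne (by omega),
          iB a (by omega) ha']
      · intro j hj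
        rcases Nat.lt_succ_iff_lt_or_eq.1 hj with hj | rfl
        · rw [Function.update_of_ne (by omega), Function.update_of_ne (by omega), iL j hj]
        · rw [Function.update_self]
      · intro v hv hv'
        have := hv' k (by omega)
        rw [Function.update_of_ne (by omega), Function.update_of_ne (by omega),
          iZ v hv fun j hj => hv' j (by omega)]
      · intro j hj
        rcases Nat.lt_succ_iff_lt_or_eq.1 hj with hj | rfl
        · have := hL j hj
          rw [Function.update_of_ne (by omega), Function.update_of_ne (by omega), iM j hj]
        · rw [Function.update_of_ne (by omega), Function.update_self]
    · have hL' : ∃ i < k, r i = r k := by simpa [IsLeader] using hL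
      obtain ⟨i, hi, hik⟩ := hL'
      have hz := iM i hi
      rw [hik, canonLabel_congr hik] at hz
      rw [if_neg hL] at hcnt
      have hc : t5.ireg 7 < t5.ireg 50 := by simp [d7, d50, hz]
      rw [if_pos hc]
      have him : ((Instr.isucc 45).apply ((block [.ipred 50, .istore 44 50, .isucc 44, .isucc 44,
          .isucc 44]).sem (skip.sem t5))).imem = Function.update s'.imem (3 * k)
            (canonLabel r k) := by
        simp [sem_block, Instr.apply, d50, d44, dim, hz]
      rw [him]
      refine ⟨by simp [sem_block, Instr.apply, d42, hcnt], by simp [sem_block, Instr.apply, d43],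
        by simp [sem_block, Instr.apply, d44]; omega, ?_, ?_, ?_, ?_, ?_⟩
      · intro a ha
        rw [Function.update_of_ne (by omega), iT a ha]
      · intro a ha ha'
        rw [Function.update_of_ne (by omega), iB a (by omega) ha']
      · intro j hj
        rcases Nat.lt_succ_iff_lt_or_eq.1 hj with hj | rfl
        · rw [Function.update_of_ne (by omega), iL j hj]
        · rw [Function.update_self]
      · intro v hv hv'
        rw [Function.update_of_ne (by omega), iZ v hv fun j hj => hv' j (by omega)]
      · intro j hj
        rw [Function.update_of_ne (by omega)]
        rcases Nat.lt_succ_iff_lt_or_eq.1 hj with hj | rfl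
        · rw [iM j hj]
        · exact hz

/-- There is no division of integers, so the tally grows by 8 per occurrence and is compared with
`N` itself. -/
theorem sem_balance (s : State) (h2 : s.ireg 2 = 8) {lab : ℕ → ℕ}
    (hlab : ∀ j < s.ireg 0, s.imem (3 * j) = lab j) :
    (balance.sem s).ireg 51 = 0 ↔ ∀ c < 8, 8 * Nat.count (fun j => lab j = c) (s.ireg 0) =
      s.ireg 0 := by
  set N := s.ireg 0 with hN
  simp only [balance, sem_seq]
  set s1 := (block [.iconst 51 0]).sem s with hs1
  have a1 : ∀ a < 40, s1.ireg a = s.ireg a := fun a ha =>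
    (frame _ s).ireg a (by interval_cases a <;> rfl)
  have m1 : s1.imem = s.imem := (frame _ s).imem rfl
  have e51 : s1.ireg 51 = 0 := by simp [hs1, sem_block, Instr.apply]
  clear_value s1
  have hI := loop_induct (s := s1) (b := 2) (r := 52) (p := balanceStep) rfl
    (fun k s' => s'.ireg 51 = 0 ↔ ∀ c < k, 8 * Nat.count (fun j => lab j = c) N = N)
    (by simp [Instr.apply, e51]) ?_
  · rw [a1 2 (by omega), h2] at hI
    exact hI
  · intro k s' hk hr hF hI
    have f0 : s'.ireg 0 = N := by rw [hF.ireg 0 rfl, a1 0 (by omega)]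
    have fm : s'.imem = s.imem := (hF.imem rfl).trans m1
    simp only [balanceStep, sem_seq, sem_ite_ilt]
    set t1 := (block [.iconst 53 0, .iconst 54 0]).sem s' with ht1
    have q : t1.ireg 53 = 0 ∧ t1.ireg 54 = 0 ∧ t1.ireg 52 = k ∧ t1.ireg 51 = s'.ireg 51 ∧
        t1.ireg 0 = N ∧ t1.imem = s.imem := by
      simp [ht1, sem_block, Instr.apply, f0, fm, hr]
    clear_value t1
    obtain ⟨q53, q54, q52, q51, q0, qm⟩ := q
    have hJ := loop_induct (s := t1) (b := 0) (r := 55) (p := tallyStep) rfl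
      (fun j s'' => s''.ireg 54 = 3 * j ∧ s''.ireg 53 = 8 * Nat.count (fun j => lab j = k) j)
      (by simp [Instr.apply, q53, q54]) (by
      rintro j s'' hj hr' hF' ⟨k1, k2⟩
      have g52 : s''.ireg 52 = k := by rw [hF'.ireg 52 rfl, q52]
      have gm : s''.imem = s.imem := (hF'.imem rfl).trans qm
      have gl := hlab j (by omega)
      have hcnt := Nat.count_succ (fun j => lab j = k) j
      simp only [tallyStep, sem_seq, sem_ite_ilt]
      set u1 := (block [.iload 56 54, .isucc 54, .isucc 54, .isucc 54]).sem s'' with hu1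
      have w : u1.ireg 56 = lab j ∧ u1.ireg 54 = 3 * (j + 1) ∧ u1.ireg 52 = k ∧
          u1.ireg 53 = 8 * Nat.count (fun j => lab j = k) j := by
        simp [hu1, sem_block, Instr.apply, k1, k2, gm, gl, g52]
        omega
      clear_value u1
      obtain ⟨w56, w54, w52, w53⟩ := w
      rw [w56, w52, hcnt]
      split_ifs <;> first
        | omega
        | (simp [sem_block, Instr.apply, w54, w53]; try omega))
    rw [q0] at hJ
    have hF2 := (frame (.loop 0 55 tallyStep) t1).ireg
    set t2 := (Cmd.loop 0 55 tallyStep).sem t1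
    have p51 : t2.ireg 51 = s'.ireg 51 := (hF2 51 rfl).trans q51
    have p0 : t2.ireg 0 = N := (hF2 0 rfl).trans q0
    clear_value t2
    have hsucc : (∀ c < k + 1, 8 * Nat.count (fun j => lab j = c) N = N) ↔
        (∀ c < k, 8 * Nat.count (fun j => lab j = c) N = N) ∧
          8 * Nat.count (fun j => lab j = k) N = N := by
      simp only [Nat.forall_lt_succ_right]
    rw [hsucc, ← hI]
    rw [p0, hJ.2]
    split_ifs <;> simp [sem_block, Instr.apply, p51] <;> omega

/-- The insertion walks down the trie and creates a child wherever none exists. Once a node is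
missing, all later ones are missing too, so the flag in register `61` records exactly whether the
whole word is new. -/
theorem sem_record (s : State) (h2 : s.ireg 2 = 8) (h7 : s.ireg 7 = 0) {lab : ℕ → ℕ}
    (hlab : ∀ j < s.ireg 0, s.imem (3 * j) = lab j) (hlt : ∀ j, lab j < 8)
    (h4 : 3 * s.ireg 0 ≤ s.ireg 4) {P : List ℕ → Prop} {ν : List ℕ → ℕ}
    (hT : IsTrie s.imem (s.ireg 4) (s.ireg 5) P ν) :
    (∃ ν', IsTrie (record.sem s).imem (s.ireg 4) ((record.sem s).ireg 5)
      (fun p => P p ∨ p <+: (List.range (s.ireg 0)).map lab) ν') ∧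
    (0 < (record.sem s).ireg 61 ↔ ¬ P ((List.range (s.ireg 0)).map lab)) ∧
    ∀ a < s.ireg 4, (record.sem s).imem a = s.imem a := by
  set root := s.ireg 4 with hroot
  rw [record, sem_seq]
  set s1 := (block [.icopy 60 4, .iconst 61 0, .iconst 62 0]).sem s with hs1
  have a1 : ∀ a < 40, s1.ireg a = s.ireg a := fun a ha =>
    (frame _ s).ireg a (by interval_cases a <;> rfl)
  have q : s1.ireg 60 = root ∧ s1.ireg 61 = 0 ∧ s1.ireg 62 = 0 ∧ s1.imem = s.imem := by
    simp [hs1, sem_block, Instr.apply, hroot]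
  clear_value s1
  obtain ⟨q60, q61, q62, qm⟩ := q
  have hI := loop_induct (s := s1) (b := 0) (r := 63) (p := recordStep) rfl (fun k s' =>
    ∃ ν', IsTrie s'.imem root (s'.ireg 5) (fun p => P p ∨ p <+: (List.range k).map lab) ν' ∧
      s'.ireg 60 = ν' ((List.range k).map lab) ∧ s'.ireg 62 = 3 * k ∧
      (0 < s'.ireg 61 ↔ ¬ P ((List.range k).map lab)) ∧ ∀ a < root, s'.imem a = s.imem a)
    ⟨ν, ?_, ?_, ?_, ?_, ?_⟩ ?_
  · rw [a1 0 (by omega)] at hI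
    obtain ⟨ν', h1, -, -, h5, h6⟩ := hI
    exact ⟨⟨ν', h1⟩, h5, h6⟩
  · have h : IsTrie s1.imem root (s1.ireg 5) P ν := by rw [qm, a1 5 (by omega)]; exact hT
    refine h.congr_pred fun p => ?_
    simp only [List.range_zero, List.map_nil, List.prefix_nil, or_iff_left_iff_imp]
    rintro rfl
    exact hT.nil
  · simp [Instr.apply, q60, hT.addr_nil]
  · simp [Instr.apply, q62]
  · simp [Instr.apply, q61, hT.nil]
  · intro a _
    exact congrFun qm a
  · rintro k s' hk hr hF ⟨ν', i1, i60, i62, i61, im⟩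
    rw [a1 0 (by omega)] at hk
    have f2 : s'.ireg 2 = 8 := by rw [hF.ireg 2 rfl, a1 2 (by omega), h2]
    have f7 : s'.ireg 7 = 0 := by rw [hF.ireg 7 rfl, a1 7 (by omega), h7]
    have hlk : s'.imem (3 * k) = lab k := by rw [im _ (by omega), hlab k hk]
    have hc := hlt k
    set w := (List.range k).map lab with hw
    have hw' : (List.range (k + 1)).map lab = w ++ [lab k] := by simp [List.range_succ, hw]
    rw [hw']
    simp only [recordStep, sem_seq, sem_ite_ilt]
    set t1 := (block [.iload 64 62, .isucc 62, .isucc 62, .isucc 62, .icopy 65 60]).sem s' with ht1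
    have q : t1.ireg 64 = lab k ∧ t1.ireg 62 = 3 * (k + 1) ∧ t1.ireg 65 = ν' w ∧
        t1.ireg 2 = 8 ∧ t1.ireg 7 = 0 ∧ t1.ireg 5 = s'.ireg 5 ∧ t1.ireg 61 = s'.ireg 61 ∧
        t1.imem = s'.imem := by
      simp [ht1, sem_block, Instr.apply, i62, i60, hlk, f2, f7]
      omega
    clear_value t1
    obtain ⟨c64, c62, c65, c2, c7, c5, c61, cm⟩ := q
    -- The address of a child cell is formed by counting up to the letter, again for lack of integer
    -- addition; eight rounds suffice.
    have hJ := loop_induct (s := t1) (b := 2) (r := 66)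
      (p := .ite (.ilt 66 64) (block [.isucc 65]) skip) rfl
      (fun j s'' => s''.ireg 65 = ν' w + min j (lab k)) (by simp [Instr.apply, c65]) (by
        intro j s'' hj hr' hF' hJ
        have g64 : s''.ireg 64 = lab k := (hF'.ireg 64 rfl).trans c64
        rw [sem_ite_ilt, hr', g64]
        split_ifs <;> simp [sem_block, Instr.apply, hJ] <;> omega)
    rw [c2, min_eq_right hc.le] at hJ
    have hF2 := frame (.loop 2 66 (.ite (.ilt 66 64) (block [.isucc 65]) skip)) t1
    set t2 := (Cmd.loop 2 66 (.ite (.ilt 66 64) (block [.isucc 65]) skip)).sem t1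
    have d62 := (hF2.ireg 62 rfl).trans c62
    have d7 := (hF2.ireg 7 rfl).trans c7
    have d5 := (hF2.ireg 5 rfl).trans c5
    have d61 := (hF2.ireg 61 rfl).trans c61
    have dm := (hF2.imem rfl).trans cm
    clear_value t2
    set t3 := (block [.iload 60 65]).sem t2 with ht3
    have q : t3.ireg 60 = s'.imem (ν' w + lab k) ∧ t3.ireg 65 = ν' w + lab k ∧
        t3.ireg 62 = 3 * (k + 1) ∧ t3.ireg 7 = 0 ∧ t3.ireg 5 = s'.ireg 5 ∧
        t3.ireg 61 = s'.ireg 61 ∧ t3.imem = s'.imem := by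
      simp [ht3, sem_block, Instr.apply, hJ, d62, d7, d5, d61, dm]
    clear_value t3
    obtain ⟨e60, e65, e62, e7, e5, e61, em⟩ := q
    have hlen : ¬ w ++ [lab k] <+: w := fun h => by simpa using h.length_le
    by_cases hP : P (w ++ [lab k])
    · have hPw : P w := hT.of_append _ _ hP
      have hch := i1.child w (lab k) (.inr (List.prefix_refl _)) hc (.inl hP)
      -- Node addresses are positive, so a zero cell can stand for a missing child.
      have hpos : 0 < ν' (w ++ [lab k]) := i1.root_pos.trans_le (i1.root_le _ (.inl hP))
      rw [if_pos (by rw [e7, e60, hch]; exact hpos), sem_skip]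
      refine ⟨ν', ?_, ?_, ?_, ?_, ?_⟩
      · have h : IsTrie t3.imem root (t3.ireg 5) (fun p => P p ∨ p <+: w) ν' := by
          rw [em, e5]; exact i1
        refine h.congr_pred fun p => ?_
        rw [List.prefix_concat_iff]
        refine ⟨?_, ?_⟩
        · rintro (h | rfl | h)
          exacts [.inl h, .inl hP, .inr h]
        · rintro (h | h)
          exacts [.inl h, .inr (.inr h)]
      · simp [Instr.apply, e60, hch]
      · simp [Instr.apply, e62]
      · simp only [hPw, not_true_eq_false, iff_false] at i61
        simpa [Instr.apply, e61, hP] using i61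
      · intro a ha
        simpa [Instr.apply, em] using im a ha
    · have hP' : ¬ (P (w ++ [lab k]) ∨ w ++ [lab k] <+: w) := by simp [hP, hlen]
      have hch := i1.no_child w (lab k) (.inr (List.prefix_refl _)) hc hP'
      have hins := i1.insert (.inr (List.prefix_refl _)) hc hP'
      rw [if_neg (by rw [e7, e60, hch]; exact lt_irrefl 0)]
      refine ⟨Function.update ν' (w ++ [lab k]) (s'.ireg 5), ?_, ?_, ?_, ?_, ?_⟩
      · have h : IsTrie (Function.update s'.imem (ν' w + lab k) (s'.ireg 5)) root (s'.ireg 5 + 8)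
            (fun p => P p ∨ p <+: w ++ [lab k])
            (Function.update ν' (w ++ [lab k]) (s'.ireg 5)) := by
          refine hins.congr_pred fun p => ?_
          rw [List.prefix_concat_iff]
          tauto
        simpa [sem_block, Instr.apply, e65, e5, em] using h
      · simp [sem_block, Instr.apply, e5]
      · simp [sem_block, Instr.apply, e62]
      · simp [sem_block, Instr.apply, hP]
      · intro a ha
        have := i1.root_le w (.inr (List.prefix_refl _))
        have hne : a ≠ ν' w + lab k := by omega
        simpa [sem_block, Instr.apply, e65, e5, em, hne] using im a ha

theorem sem_printLabels (s : State) {lab : ℕ → ℕ}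
    (hlab : ∀ j < s.ireg 0, s.imem (3 * j) = lab j) :
    (printLabels.sem s).out = s.out ++ (List.range (s.ireg 0)).map lab := by
  rw [printLabels, sem]
  set s1 := (block [.iconst 67 0]).sem s with hs1
  have q : s1.ireg 67 = 0 ∧ s1.ireg 0 = s.ireg 0 ∧ s1.imem = s.imem ∧ s1.out = s.out := by
    simp [hs1, sem_block, Instr.apply]
  clear_value s1
  obtain ⟨q67, q0, qm, qo⟩ := q
  rw [← q0] at hlab ⊢
  refine (loop_induct (s := s1) (b := 0) (r := 68) rfl (fun k s' =>
    s'.out = s.out ++ (List.range k).map lab ∧ s'.ireg 67 = 3 * k) ?_ ?_).1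
  · simp [Instr.apply, q67, qo]
  · rintro k s' hk hr hF ⟨i1, i2⟩
    have fm : s'.imem = s.imem := (hF.imem rfl).trans qm
    simp [sem_block, Instr.apply, i1, i2, fm, hlab k hk, List.range_succ]
    omega

end RealRAM

/-! ### One candidate triple of planes -/

namespace RealRAM

open Cmd

/-- The bits in the registers for the points on the plane number `i`. -/
def tieBits (ρ : ℕ → ℕ) (i : ℕ) (k : ℕ) : ℕ := if k < 3 then ρ (16 + 3 * i + k) else 0

/-- The position of the point number `j` of the table `m` with respect to the plane with the normal
`n` through the point `q`. -/
def planeVal (m : ℕ → ℝ) (n q : Fin 3 → ℝ) (j : ℕ) : ℝ := n ⬝ᵥ pt m j - n ⬝ᵥ q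

/-- The label `0, …, 7` that belongs to three sides. -/
def octant (b : Fin 3 → ℕ) : ℕ :=
  (if 0 < b 0 then 4 else 0) + (if 0 < b 1 then 2 else 0) + if 0 < b 2 then 1 else 0

/-- The label of a point with respect to three mutually orthogonal planes. -/
noncomputable def pointLabel (m : ℕ → ℝ) (ρ : ℕ → ℕ) (v w : Fin 3 → ℝ) (q : Fin 3 → Fin 3 → ℝ)
    (j : ℕ) : ℕ :=
  octant fun i => sideBit (tieBits ρ i) (planeVal m (normals v w i) (q i)) j

/-- The labels form an equipartition. -/
def Balanced (N : ℕ) (lab : ℕ → ℕ) : Prop :=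
  ∀ c < 8, 8 * Nat.count (fun j => lab j = c) N = N

/-- The word is listed for the normals given by `v` and `w` and the planes through the points
`q i`. -/
def Listed (m : ℕ → ℝ) (N : ℕ) (ρ : ℕ → ℕ) (v w : Fin 3 → ℝ) (q : Fin 3 → Fin 3 → ℝ)
    (l : List ℕ) : Prop :=
  crossProduct v w ≠ 0 ∧ Balanced N (canonLabel (pointLabel m ρ v w q)) ∧
    l = (List.range N).map (canonLabel (pointLabel m ρ v w q))

theorem octant_lt (b : Fin 3 → ℕ) : octant b < 8 := by
  unfold octant; split_ifs <;> omega

/-- The octant number is a three-digit binary numeral, so it determines which of its digits are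
positive. -/
theorem octant_inj {b b' : Fin 3 → ℕ} : octant b = octant b' ↔ ∀ i, 0 < b i ↔ 0 < b' i := by
  rw [Fin.forall_fin_succ, Fin.forall_fin_two]
  simp only [octant, Fin.succ_zero_eq_one, Fin.succ_one_eq_two]
  split_ifs <;> simp_all

/-- The state of the program in which exactly the words in `S` have been listed. -/
structure Good (m : ℕ → ℝ) (N : ℕ) (S : List ℕ → Prop) (s : State) : Prop where
  ireg0 : s.ireg 0 = N
  ireg1 : s.ireg 1 = 2
  ireg2 : s.ireg 2 = 8
  ireg3 : s.ireg 3 = 3 * N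
  ireg4 : s.ireg 4 = 3 * N + 8
  ireg7 : s.ireg 7 = 0
  rmem : s.rmem = m
  trie : ∃ P ν, IsTrie s.imem (3 * N + 8) (s.ireg 5) P ν ∧ ∀ l, l.length = N → (P l ↔ S l)
  out : ∃ W : List (List ℕ), W.Nodup ∧ s.out = W.flatten ∧ ∀ l, l ∈ W ↔ S l
  length : ∀ l, S l → l.length = N

/-- The invariant ignores scratch registers and all integer cells below the root of the trie. -/
theorem Good.congr {m : ℕ → ℝ} {N : ℕ} {S S' : List ℕ → Prop} {s s' : State} (h : Good m N S s)
    (hi : ∀ a < 8, s'.ireg a = s.ireg a) (hr : s'.rmem = s.rmem)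
    (hm : ∀ a, 3 * N + 8 ≤ a → s'.imem a = s.imem a) (ho : s'.out = s.out)
    (hS : ∀ l, S' l ↔ S l) : Good m N S' s' := by
  obtain rfl : S' = S := funext fun l => propext (hS l)
  refine ⟨?_, ?_, ?_, ?_, ?_, ?_, hr.trans h.rmem, ?_, ?_, h.length⟩
  · rw [hi 0 (by omega), h.ireg0]
  · rw [hi 1 (by omega), h.ireg1]
  · rw [hi 2 (by omega), h.ireg2]
  · rw [hi 3 (by omega), h.ireg3]
  · rw [hi 4 (by omega), h.ireg4]
  · rw [hi 7 (by omega), h.ireg7]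
  · obtain ⟨P, ν, hT, hP⟩ := h.trie
    exact ⟨P, ν, by rw [hi 5 (by omega)]; exact hT.congr hm, hP⟩
  · rw [ho]
    exact h.out

/-- The three passes write disjoint residue classes of addresses modulo 3, hence do not overwrite
one another. -/
theorem sem_sides_all (s : State) (h31 : s.rreg 31 = 0) {n q : Fin 3 → Fin 3 → ℝ}
    (hn : ∀ i : Fin 3, (fun k : Fin 3 => s.rreg (18 + 3 * i + k)) = n i)
    (hq : ∀ i : Fin 3, s.rreg (27 + i) = n i ⬝ᵥ q i) :
    (∀ i : Fin 3, ∀ j < s.ireg 0, ((sides 0 ;; sides 1 ;; sides 2).sem s).imem (3 * j + i) =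
      sideBit (tieBits s.ireg i) (planeVal s.rmem (n i) (q i)) j) ∧
    ∀ a, 3 * s.ireg 0 ≤ a → ((sides 0 ;; sides 1 ;; sides 2).sem s).imem a = s.imem a := by
  simp only [sem_seq]
  have F : ∀ i < 3, ∀ s : State, (∀ a < 30, ((sides i).sem s).ireg a = s.ireg a) ∧
      (∀ a < 40, ((sides i).sem s).rreg a = s.rreg a) ∧ ((sides i).sem s).rmem = s.rmem :=
    fun i hi s => ⟨fun a ha => (frame _ s).ireg a (by interval_cases a <;> rfl),
      fun a ha => (frame _ s).rreg a (by interval_cases a <;> rfl), (frame _ s).rmem rfl⟩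
  have key : ∀ (i : Fin 3) (s' : State), (∀ a < 30, s'.ireg a = s.ireg a) →
      (∀ a < 40, s'.rreg a = s.rreg a) → s'.rmem = s.rmem →
      ((sides i).sem s').imem = fun a => if a < 3 * s.ireg 0 ∧ a % 3 = i then
        sideBit (tieBits s.ireg i) (planeVal s.rmem (n i) (q i)) (a / 3) else s'.imem a := by
    intro i s' hi hr hm
    rw [← hi 0 (by omega)]
    refine sem_sides i.isLt s' (by rw [hr 31 (by omega), h31]) ?_ ?_ ?_
    · intro k hk
      rw [tieBits, if_pos hk, hi _ (by omega)]
    · intro k hk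
      rw [tieBits, if_neg (by omega)]
    · intro j
      rw [planeVal, hm, hr _ (by omega), hq, ← hn i]
      congr 2
      funext k
      exact (hr _ (by omega)).symm
  obtain ⟨f1, f2, f3⟩ := F 0 (by omega) s
  have k0 := key 0 s (fun _ _ => rfl) (fun _ _ => rfl) rfl
  have k1 := key 1 ((sides 0).sem s) f1 f2 f3
  obtain ⟨g1, g2, g3⟩ := F 1 (by omega) ((sides 0).sem s)
  have k2 := key 2 ((sides 1).sem ((sides 0).sem s)) (fun a ha => (g1 a ha).trans (f1 a ha))
    (fun a ha => (g2 a ha).trans (f2 a ha)) (g3.trans f3)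
  simp only [Fin.val_zero, Fin.val_one, Fin.val_two] at k0 k1 k2
  rw [k2, k1, k0]
  constructor
  · intro i j hj
    fin_cases i
    · simp only [Fin.zero_eta]
      rw [if_neg (by omega), if_neg (by omega), if_pos (by omega)]
      congr 1; omega
    · simp only [Fin.mk_one]
      rw [if_neg (by omega), if_pos (by omega)]
      congr 1; omega
    · simp only [Fin.reduceFinMk]
      rw [if_pos (by omega)]
      congr 1; omega
  · intro a ha
    simp only
    rw [if_neg (by omega), if_neg (by omega), if_neg (by omega)]

/-- One candidate adds at most one word to the list. The six points and all loop counters survive,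
so that further candidates can be built from the same sextuple. -/
theorem Good.candidate {m : ℕ → ℝ} {N : ℕ} {S : List ℕ → Prop} {s : State} (h : Good m N S s)
    {v w : VExp} {o : Fin 3 → ℕ} (hv : v.Below 18) (hw : w.Below 18) (ho : ∀ i, o i < 6)
    (hpt : ∀ i < 6, (fun k : Fin 3 => s.rreg (3 * i + k)) = pt m (s.ireg (10 + i))) :
    Good m N (fun l => S l ∨ Listed m N s.ireg (v.eval s.rreg) (w.eval s.rreg)
      (fun i => pt m (s.ireg (10 + o i))) l) ((candidate v w o).sem s) ∧
    (∀ a < 18, ((Cmd.candidate v w o).sem s).rreg a = s.rreg a) ∧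
    ∀ a, 8 ≤ a → a < 30 → ((Cmd.candidate v w o).sem s).ireg a = s.ireg a := by
  obtain ⟨f, hf, f18, fn, fo, f30, f31⟩ := sem_planes hv hw ho s
  set v' := v.eval s.rreg
  set w' := w.eval s.rreg
  set q : Fin 3 → Fin 3 → ℝ := fun i => pt m (s.ireg (10 + o i)) with hq
  have fo' : ∀ i : Fin 3, f (27 + i) = normals v' w' i ⬝ᵥ q i := by
    intro i
    rw [fo i, hpt _ (ho i)]
  rw [Cmd.candidate, sem_seq, hf, sem]
  have hholds : (Test.rlt 31 30).Holds { s with rreg := f } ↔ crossProduct v' w' ≠ 0 := by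
    simp only [Test.Holds, f30, f31]
    change 0 < crossProduct v' w' ⬝ᵥ crossProduct v' w' ↔ _
    constructor
    · intro hpos h0
      simp [h0] at hpos
    · intro hne
      exact lt_of_le_of_ne (Finset.sum_nonneg fun i _ => mul_self_nonneg _)
        fun h0 => hne (dotProduct_self_eq_zero.1 h0.symm)
  by_cases hvw : crossProduct v' w' ≠ 0
  swap
  · rw [if_neg (mt hholds.1 hvw), sem_skip]
    exact ⟨h.congr (fun _ _ => rfl) rfl (fun _ _ => rfl) rfl (fun l => by simp [Listed, hvw]), f18,
      fun _ _ _ => rfl⟩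
  rw [if_pos (hholds.2 hvw)]
  set s1 : State := { s with rreg := f } with hs1
  have h1 : Good m N S s1 := h.congr (fun _ _ => rfl) rfl (fun _ _ => rfl) rfl (fun _ => Iff.rfl)
  obtain ⟨A1, A2⟩ := sem_sides_all s1 f31 fn fo'
  have assoc : ∀ p : Cmd, (sides 0 ;; sides 1 ;; sides 2 ;; p).sem s1 =
    p.sem ((sides 0 ;; sides 1 ;; sides 2).sem s1) := fun _ => rfl
  rw [assoc]
  have FA := frame (sides 0 ;; sides 1 ;; sides 2) s1
  have i2 : ∀ a < 30, ((sides 0 ;; sides 1 ;; sides 2).sem s1).ireg a = s.ireg a := fun a ha =>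
    FA.ireg a (by interval_cases a <;> rfl)
  have r2 : ∀ a < 18, ((sides 0 ;; sides 1 ;; sides 2).sem s1).rreg a = s.rreg a := fun a ha =>
    (FA.rreg a (by interval_cases a <;> rfl)).trans (f18 a ha)
  have m2 := FA.rmem rfl
  have o2 := FA.out rfl
  set s2 := (sides 0 ;; sides 1 ;; sides 2).sem s1
  clear_value s2
  have e0 : s1.ireg 0 = N := h.ireg0
  have e0' : s2.ireg 0 = N := (i2 0 (by omega)).trans e0
  rw [e0] at A1 A2
  have m1 : s1.rmem = m := h.rmem
  rw [m1] at A1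
  have h2 : Good m N S s2 := h1.congr (fun a ha => i2 a (by omega)) m2
    (fun a ha => A2 a (by omega)) o2 (fun _ => Iff.rfl)
  set lab := canonLabel (pointLabel m s.ireg v' w' q) with hlab
  have hraw : ∀ j < N, rawLabel s2.imem j = pointLabel m s.ireg v' w' q j := by
    intro j hj
    have a0 := A1 0 j hj
    have a1 := A1 1 j hj
    have a2 := A1 2 j hj
    simp only [Fin.val_zero, Fin.val_one, Fin.val_two, add_zero] at a0 a1 a2
    rw [rawLabel, a0, a1, a2]
    rfl
  obtain ⟨B1, B2⟩ := sem_relabel s2 h2.ireg2 (by rw [h2.ireg3, e0']) h2.ireg7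
  rw [e0'] at B1 B2
  have B1' : ∀ j < N, (relabel.sem s2).imem (3 * j) = lab j := by
    intro j hj
    rw [B1 j hj]
    -- The raw labels in memory agree with `pointLabel` only below `N`, which is enough for
    -- canonical labels below `N`.
    exact canonLabel_eq_of_iff hj fun i hi i' hi' => by rw [hraw i hi, hraw i' hi']
  rw [sem_seq, sem_seq]
  have FB := frame (relabel ;; balance) s2
  have i4 : ∀ a < 30, (balance.sem (relabel.sem s2)).ireg a = s.ireg a := fun a ha =>
    (FB.ireg a (by interval_cases a <;> rfl)).trans (i2 a ha)
  have r4 : ∀ a < 18, (balance.sem (relabel.sem s2)).rreg a = s.rreg a := fun a ha =>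
    (FB.rreg a (by interval_cases a <;> rfl)).trans (r2 a ha)
  have m4 : (balance.sem (relabel.sem s2)).rmem = s2.rmem := FB.rmem rfl
  have o4 : (balance.sem (relabel.sem s2)).out = s2.out := FB.out rfl
  have g4 : (balance.sem (relabel.sem s2)).imem = (relabel.sem s2).imem :=
    (frame balance (relabel.sem s2)).imem rfl
  have j3 : ∀ a < 30, (relabel.sem s2).ireg a = s2.ireg a := fun a ha =>
    (frame relabel s2).ireg a (by interval_cases a <;> rfl)
  have C := sem_balance (relabel.sem s2) (by rw [j3 2 (by omega), h2.ireg2]) (lab := lab)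
    (by rw [j3 0 (by omega), e0']; exact B1')
  rw [j3 0 (by omega), e0'] at C
  change _ ↔ Balanced N lab at C
  rw [← g4] at B1' B2
  set s4 := balance.sem (relabel.sem s2)
  clear_value s4
  have h4 : Good m N S s4 := h2.congr
    (fun a ha => (i4 a (by omega)).trans (i2 a (by omega)).symm) m4 B2 o4 (fun _ => Iff.rfl)
  rw [sem_ite_ilt, h4.ireg7]
  by_cases hbal : Balanced N lab
  swap
  · rw [if_pos (Nat.pos_of_ne_zero (mt C.1 hbal)), sem_skip]
    exact ⟨h4.congr (fun _ _ => rfl) rfl (fun _ _ => rfl) rfl (fun l => by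
      simp [Listed, ← hlab, hbal]), r4, fun a _ ha => i4 a ha⟩
  rw [if_neg (by rw [C.2 hbal]; exact lt_irrefl 0), sem_seq]
  obtain ⟨P, ν, hT, hP⟩ := h4.trie
  obtain ⟨W, hW, hout, hWS⟩ := h4.out
  have hlt : ∀ j, lab j < 8 := canonLabel_lt fun k => octant_lt _
  obtain ⟨⟨ν', hT'⟩, hnew, hold⟩ := sem_record s4 h4.ireg2 h4.ireg7 (lab := lab)
    (by rw [h4.ireg0]; exact B1') hlt (by rw [h4.ireg0, h4.ireg4]; omega)
    (by rw [h4.ireg4]; exact hT)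
  rw [h4.ireg0] at hT' hnew
  rw [h4.ireg4] at hT' hold
  set word := (List.range N).map lab with hword
  have hlen : word.length = N := by simp [hword]
  have hL : ∀ l, Listed m N s.ireg v' w' q l ↔ l = word := fun l =>
    ⟨fun h => h.2.2, fun h => ⟨hvw, hbal, h⟩⟩
  have FC := frame record s4
  have i5 : ∀ a < 30, a ≠ 5 → (record.sem s4).ireg a = s.ireg a := fun a ha h5 =>
    (FC.ireg a (by interval_cases a <;> first | rfl | exact absurd rfl h5)).trans (i4 a ha)
  have r5 : ∀ a < 18, (record.sem s4).rreg a = s.rreg a := fun a ha =>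
    (FC.rreg a (by interval_cases a <;> rfl)).trans (r4 a ha)
  have m5 := FC.rmem rfl
  have o5 := FC.out rfl
  set s5 := record.sem s4
  clear_value s5
  have h7 : s5.ireg 7 = 0 := (i5 7 (by omega) (by omega)).trans h.ireg7
  -- Among words of full length, the only prefix of the inserted word is the word itself; the
  -- shorter prefixes in the trie do not matter.
  have hP' : ∀ l, l.length = N → ((P l ∨ l <+: word) ↔ S l ∨ Listed m N s.ireg v' w' q l) := by
    intro l hl
    rw [hL, hP l hl]
    refine or_congr_right ⟨fun hp => hp.eq_of_length (hl.trans hlen.symm), ?_⟩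
    rintro rfl
    exact List.prefix_refl _
  have hlen' : ∀ l, S l ∨ Listed m N s.ireg v' w' q l → l.length = N := by
    rintro l (hl | hl)
    · exact h.length l hl
    · rw [(hL l).1 hl, hlen]
  have fin : ∀ s6 : State, (∀ a < 30, s6.ireg a = s5.ireg a) → s6.rmem = s5.rmem →
      s6.imem = s5.imem → (∃ W : List (List ℕ), W.Nodup ∧ s6.out = W.flatten ∧
        ∀ l, l ∈ W ↔ S l ∨ Listed m N s.ireg v' w' q l) →
      Good m N (fun l => S l ∨ Listed m N s.ireg v' w' q l) s6 := by
    intro s6 hi hr him hout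
    refine ⟨?_, ?_, ?_, ?_, ?_, ?_, ?_, ⟨_, ν', ?_, hP'⟩, hout, hlen'⟩
    · rw [hi 0 (by omega), i5 0 (by omega) (by omega), h.ireg0]
    · rw [hi 1 (by omega), i5 1 (by omega) (by omega), h.ireg1]
    · rw [hi 2 (by omega), i5 2 (by omega) (by omega), h.ireg2]
    · rw [hi 3 (by omega), i5 3 (by omega) (by omega), h.ireg3]
    · rw [hi 4 (by omega), i5 4 (by omega) (by omega), h.ireg4]
    · rw [hi 7 (by omega), i5 7 (by omega) (by omega), h.ireg7]
    · rw [hr, m5, h4.rmem]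
    · rw [him, hi 5 (by omega)]
      exact hT'
  rw [sem_ite_ilt, h7]
  by_cases hPw : P word
  · rw [if_neg (by simpa [hPw] using hnew), sem_skip]
    refine ⟨fin s5 (fun _ _ => rfl) rfl rfl ⟨W, hW, o5.trans hout, fun l => ?_⟩, r5,
      fun a h8 ha => i5 a ha (by omega)⟩
    rw [hWS, hL]
    refine ⟨.inl, ?_⟩
    rintro (hl | rfl)
    exacts [hl, (hP _ hlen).1 hPw]
  · rw [if_pos (hnew.2 hPw)]
    have hp := sem_printLabels s5 (lab := lab) (by
      rw [i5 0 (by omega) (by omega), h.ireg0]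
      intro j hj
      rw [hold _ (by omega), B1' j hj])
    rw [i5 0 (by omega) (by omega), h.ireg0] at hp
    have FD := frame printLabels s5
    have i6 : ∀ a < 30, (printLabels.sem s5).ireg a = s5.ireg a := fun a ha =>
      FD.ireg a (by interval_cases a <;> rfl)
    have r6 : ∀ a < 18, (printLabels.sem s5).rreg a = s5.rreg a := fun a ha =>
      FD.rreg a (by interval_cases a <;> rfl)
    refine ⟨fin _ i6 (FD.rmem rfl) (FD.imem rfl) ⟨W ++ [word], ?_, ?_, ?_⟩,
      fun a ha => (r6 a ha).trans (r5 a ha),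
      fun a h8 ha => (i6 a ha).trans (i5 a ha (by omega))⟩
    · rw [← List.concat_eq_append, List.nodup_concat]
      exact ⟨fun hmem => hPw ((hP _ hlen).2 ((hWS _).1 hmem)), hW⟩
    · rw [hp, o5, hout, List.flatten_append]
      simp [hword]
    · intro l
      rw [List.mem_append, hWS, hL, List.mem_singleton]

end RealRAM

/-! ### All candidates of a sextuple, and the nested loops -/

namespace RealRAM

open Cmd

/-- A normal of the first of three mutually orthogonal planes that are parallel to `d`, `e`, `f`,
respectively; `k` is a sign. -/
noncomputable def rootNormal (k : ℝ) (d e f : Fin 3 → ℝ) : Fin 3 → ℝ :=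
  (k * √((crossProduct d e ⬝ᵥ f) * (crossProduct d e ⬝ᵥ f) -
      4 * (e ⬝ᵥ f) * ((d ⬝ᵥ e) * (d ⬝ᵥ f))) - crossProduct d e ⬝ᵥ f) • crossProduct d e +
    (2 * e ⬝ᵥ f) • crossProduct d (crossProduct d e)

/-- The three planes with the normals given by `v` and `w` through the points `q 0`, `q 1`, `q 2`
are determined by the six points `p`. -/
def IsDetermined (p : ℕ → Fin 3 → ℝ) (v w : Fin 3 → ℝ) (q : Fin 3 → Fin 3 → ℝ) : Prop :=
  (v = crossProduct (p 0 - p 1) (p 0 - p 2) ∧ w = p 3 - p 4 ∧ q = ![p 0, p 3, p 5]) ∨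
  ((v = rootNormal 1 (p 0 - p 1) (p 2 - p 3) (p 4 - p 5) ∨
    v = rootNormal (-1) (p 0 - p 1) (p 2 - p 3) (p 4 - p 5)) ∧ w = p 2 - p 3 ∧
    q = ![p 0, p 2, p 4]) ∨
  (v = p 0 - p 1 ∧ w = p 4 - p 5 ∧ q = ![p 2, p 4, p 3])

/-- The words that are listed for the numbers of six points in the registers `10, …, 15`. -/
def ListedFor (m : ℕ → ℝ) (N : ℕ) (ρ : ℕ → ℕ) (l : List ℕ) : Prop :=
  ∃ v w q, IsDetermined (fun i => pt m (ρ (10 + i))) v w q ∧ Listed m N ρ v w q l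

theorem eval_rootVec (ρ : ℕ → ℝ) (k : ℤ) (d e f : VExp) :
    (rootVec k d e f).eval ρ = rootNormal k (d.eval ρ) (e.eval ρ) (f.eval ρ) := by
  simp only [rootVec, rootNormal, rootCoef, VExp.eval_lin, VExp.eval_cross, RExp.eval_sub,
    RExp.eval_mul, RExp.eval_sqrt, RExp.eval_const, VExp.eval_dot]
  norm_num

theorem below_diff {a b : ℕ} (ha : a < 6) (hb : b < 6) : (diff a b).Below 18 :=
  (VExp.below_regs (by omega)).sub (VExp.below_regs (by omega))

theorem below_rootVec {k : ℤ} {d e f : VExp} (hd : d.Below 18) (he : e.Below 18)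
    (hf : f.Below 18) : (rootVec k d e f).Below 18 := by
  have h1 := (hd.cross he).dot hf
  have h2 := he.dot hf
  have h3 := hd.dot he
  have h4 := hd.dot hf
  exact VExp.Below.lin (VExp.below_op .sub (VExp.below_op .mul rfl (VExp.below_op .sub
    (VExp.below_op .mul h1 h1) (VExp.below_op .mul (VExp.below_op .mul rfl h2)
      (VExp.below_op .mul h3 h4)))) h1)
    (hd.cross he) (VExp.below_op .mul rfl h2) (hd.cross (hd.cross he))

theorem Good.candidates {m : ℕ → ℝ} {N : ℕ} {S : List ℕ → Prop} {s : State} (h : Good m N S s)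
    (hN : ∀ i < 6, s.ireg (10 + i) < N) :
    Good m N (fun l => S l ∨ ListedFor m N s.ireg l) (candidates.sem s) ∧
    ∀ a, 8 ≤ a → a < 30 → (Cmd.candidates.sem s).ireg a = s.ireg a := by
  have hp := sem_loadPoints s fun i hi => (hN i hi).le.trans h.ireg0.ge
  have F0 := frame loadPoints s
  rw [Cmd.candidates]
  simp only [sem_seq]
  have i0 : ∀ a < 30, (loadPoints.sem s).ireg a = s.ireg a := fun a ha =>
    F0.ireg a (by interval_cases a <;> rfl)
  rw [h.rmem] at hp
  have h0 : Good m N S (loadPoints.sem s) := h.congr (fun a ha => i0 a (by omega)) (F0.rmem rfl)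
    (fun a _ => congrFun (F0.imem rfl) a) (F0.out rfl) (fun _ => Iff.rfl)
  set s0 := loadPoints.sem s
  clear_value s0
  set p : ℕ → Fin 3 → ℝ := fun i => pt m (s.ireg (10 + i)) with hpdef
  -- All four candidates are referred back to the points loaded at the beginning; only the set of
  -- words listed so far changes from one call to the next.
  have step : ∀ (S : List ℕ → Prop) (s' : State), Good m N S s' →
      (∀ a < 18, s'.rreg a = s0.rreg a) → (∀ a, 8 ≤ a → a < 30 → s'.ireg a = s.ireg a) →
      ∀ (v w : VExp) (o : Fin 3 → ℕ), v.Below 18 → w.Below 18 → (∀ i, o i < 6) →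
      Good m N (fun l => S l ∨ Listed m N s.ireg (v.eval s0.rreg) (w.eval s0.rreg)
        (fun i => p (o i)) l) ((Cmd.candidate v w o).sem s') ∧
      (∀ a < 18, ((Cmd.candidate v w o).sem s').rreg a = s0.rreg a) ∧
      ∀ a, 8 ≤ a → a < 30 → ((Cmd.candidate v w o).sem s').ireg a = s.ireg a := by
    intro S s' hS hr hi v w o hv hw ho
    have hcand := hS.candidate hv hw ho (fun i hi6 => by
      rw [hi _ (by omega) (by omega), ← hp i hi6]
      funext k
      exact hr _ (by omega))
    obtain ⟨c1, c2, c3⟩ := hcand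
    refine ⟨?_, fun a ha => (c2 a ha).trans (hr a ha),
      fun a h8 ha => (c3 a h8 ha).trans (hi a h8 ha)⟩
    refine c1.congr (fun _ _ => rfl) rfl (fun _ _ => rfl) rfl fun l => or_congr_right ?_
    rw [VExp.eval_congr (fun a ha => (hr a ha).symm) hv,
      VExp.eval_congr (fun a ha => (hr a ha).symm) hw]
    have hq : (fun i => pt m (s'.ireg (10 + o i))) = fun i => p (o i) := funext fun i => by
      have := ho i
      rw [hi _ (by omega) (by omega)]
    rw [hq]
    have hlab : ∀ v w q, pointLabel m s'.ireg v w q = pointLabel m s.ireg v w q := by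
      intro v w q
      have ht : ∀ i : Fin 3, tieBits s'.ireg i = tieBits s.ireg i := fun i => funext fun k => by
        unfold tieBits
        split_ifs
        · exact hi _ (by omega) (by omega)
        · rfl
      funext j
      simp only [pointLabel, ht]
    simp only [Listed, hlab]
  have hd : ∀ a < 6, ∀ b < 6, (diff a b).eval s0.rreg = p a - p b := by
    intro a ha b hb
    rw [diff, VExp.eval_sub, VExp.eval_regs, VExp.eval_regs, hp a ha, hp b hb]
  obtain ⟨g1, r1, j1⟩ := step S s0 h0 (fun _ _ => rfl) (fun a _ ha => i0 a ha)
    ((diff 0 1).cross (diff 0 2)) (diff 3 4) ![0, 3, 5]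
    ((below_diff (by omega) (by omega)).cross (below_diff (by omega) (by omega)))
    (below_diff (by omega) (by omega)) (by decide)
  obtain ⟨g2, r2, j2⟩ := step _ _ g1 r1 j1
    (rootVec 1 (diff 0 1) (diff 2 3) (diff 4 5)) (diff 2 3) ![0, 2, 4]
    (below_rootVec (below_diff (by omega) (by omega)) (below_diff (by omega) (by omega))
      (below_diff (by omega) (by omega))) (below_diff (by omega) (by omega)) (by decide)
  obtain ⟨g3, r3, j3⟩ := step _ _ g2 r2 j2
    (rootVec (-1) (diff 0 1) (diff 2 3) (diff 4 5)) (diff 2 3) ![0, 2, 4]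
    (below_rootVec (below_diff (by omega) (by omega)) (below_diff (by omega) (by omega))
      (below_diff (by omega) (by omega))) (below_diff (by omega) (by omega)) (by decide)
  obtain ⟨g4, r4, j4⟩ := step _ _ g3 r3 j3 (diff 0 1) (diff 4 5) ![2, 4, 3]
    (below_diff (by omega) (by omega)) (below_diff (by omega) (by omega)) (by decide)
  refine ⟨g4.congr (fun _ _ => rfl) rfl (fun _ _ => rfl) rfl fun l => ?_, j4⟩
  have hvec : ∀ a b c : ℕ, (fun i : Fin 3 => p (![a, b, c] i)) = ![p a, p b, p c] := by
    intro a b c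
    funext i
    fin_cases i <;> rfl
  rw [VExp.eval_cross, eval_rootVec, eval_rootVec, hd 0 (by omega) 1 (by omega),
    hd 0 (by omega) 2 (by omega), hd 3 (by omega) 4 (by omega), hd 2 (by omega) 3 (by omega),
    hd 4 (by omega) 5 (by omega)]
  simp only [hvec, Int.cast_one, Int.cast_neg]
  rw [or_assoc, or_assoc, or_assoc]
  refine or_congr_right ⟨?_, ?_⟩
  · rintro ⟨v, w, q, (⟨rfl, rfl, rfl⟩ | ⟨(rfl | rfl), rfl, rfl⟩ | ⟨rfl, rfl, rfl⟩), hl⟩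
    exacts [.inl hl, .inr (.inl hl), .inr (.inr (.inl hl)), .inr (.inr (.inr hl))]
  · rintro (hl | hl | hl | hl)
    exacts [⟨_, _, _, .inl ⟨rfl, rfl, rfl⟩, hl⟩, ⟨_, _, _, .inr (.inl ⟨.inl rfl, rfl, rfl⟩), hl⟩,
      ⟨_, _, _, .inr (.inl ⟨.inr rfl, rfl, rfl⟩), hl⟩, ⟨_, _, _, .inr (.inr ⟨rfl, rfl, rfl⟩), hl⟩]

/-- Only the six point numbers and the nine bits enter. -/
theorem ListedFor.congr {m : ℕ → ℝ} {N : ℕ} {ρ ρ' : ℕ → ℕ}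
    (h : ∀ a, 10 ≤ a → a < 25 → ρ a = ρ' a) {l : List ℕ} (hl : ListedFor m N ρ l) :
    ListedFor m N ρ' l := by
  obtain ⟨v, w, q, hd, hl⟩ := hl
  have ht : ∀ i : Fin 3, tieBits ρ i = tieBits ρ' i := fun i => funext fun k => by
    unfold tieBits
    split_ifs
    · exact h _ (by omega) (by omega)
    · rfl
  have hlab : pointLabel m ρ v w q = pointLabel m ρ' v w q := by
    funext j
    simp only [pointLabel, ht]
  refine ⟨v, w, q, ?_, by simpa only [Listed, hlab] using hl⟩
  simp only [IsDetermined] at hd ⊢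
  rwa [← h (10 + 0) (by omega) (by omega), ← h (10 + 1) (by omega) (by omega),
    ← h (10 + 2) (by omega) (by omega), ← h (10 + 3) (by omega) (by omega),
    ← h (10 + 4) (by omega) (by omega), ← h (10 + 5) (by omega) (by omega)]

/-- The bounds of the nested loops. -/
def loopBound (N a : ℕ) : ℕ := if a < 16 then N else 2

/-- The command lists the words for all values of the registers `r, …, 24`. -/
def Searches (m : ℕ → ℝ) (N r : ℕ) (c : Cmd) : Prop :=
  ∀ (S : List ℕ → Prop) (s : State), Good m N S s →
    (∀ a, 10 ≤ a → a < r → s.ireg a < loopBound N a) →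
    Good m N (fun l => S l ∨ ∃ ρ : ℕ → ℕ, (∀ a, 10 ≤ a → a < r → ρ a = s.ireg a) ∧
      (∀ a, 10 ≤ a → a < 25 → ρ a < loopBound N a) ∧ ListedFor m N ρ l) (c.sem s) ∧
    ∀ a, 10 ≤ a → a < r → (c.sem s).ireg a = s.ireg a

theorem searches_candidates (m : ℕ → ℝ) (N : ℕ) : Searches m N 25 candidates := by
  intro S s h hb
  obtain ⟨h1, h2⟩ := h.candidates fun i hi => by
    simpa [loopBound, show 10 + i < 16 by omega] using hb (10 + i) (by omega) (by omega)
  refine ⟨h1.congr (fun _ _ => rfl) rfl (fun _ _ => rfl) rfl fun l => or_congr_right ⟨?_, ?_⟩,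
    fun a h8 ha => h2 a (by omega) (by omega)⟩
  · rintro ⟨ρ, hρ, -, hl⟩
    exact hl.congr hρ
  · exact fun hl => ⟨s.ireg, fun _ _ _ => rfl, hb, hl⟩

/-- Wrapping a loop around the search frees one more register: the values below the counter have
been exhausted, and the body handles the current one. -/
theorem Searches.loop {m : ℕ → ℝ} {N r b : ℕ} {c : Cmd} (h : Searches m N (r + 1) c)
    (hr : 10 ≤ r) (hr' : r < 25) (hb : b = if r < 16 then 0 else 1)
    (hc : c.any (·.setsI r) = false) : Searches m N r (.loop b r c) := by
  intro S s hS hlt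
  have hbs : s.ireg b = loopBound N r := by
    rw [hb, loopBound]
    split_ifs
    exacts [hS.ireg0, hS.ireg1]
  have hI := loop_induct (s := s) (b := b) hc (fun k s' =>
    Good m N (fun l => S l ∨ ∃ ρ : ℕ → ℕ, (∀ a, 10 ≤ a → a < r → ρ a = s.ireg a) ∧ ρ r < k ∧
      (∀ a, 10 ≤ a → a < 25 → ρ a < loopBound N a) ∧ ListedFor m N ρ l) s' ∧
    ∀ a, 10 ≤ a → a < r → s'.ireg a = s.ireg a) ⟨?_, ?_⟩ ?_
  · rw [hbs] at hI
    refine ⟨hI.1.congr (fun _ _ => rfl) rfl (fun _ _ => rfl) rfl fun l => or_congr_right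
      ⟨?_, ?_⟩, hI.2⟩
    · rintro ⟨ρ, h1, h2, h3⟩
      exact ⟨ρ, h1, h2 r hr hr', h2, h3⟩
    · rintro ⟨ρ, h1, -, h2, h3⟩
      exact ⟨ρ, h1, h2, h3⟩
  · refine hS.congr (fun a ha => ?_) rfl (fun _ _ => rfl) rfl (fun l => by simp)
    exact Function.update_of_ne (by omega) _ _
  · intro a _ ha
    exact Function.update_of_ne (by omega) _ _
  · rintro k s' hk hkr - ⟨g1, g2⟩
    obtain ⟨f1, f2⟩ := h _ s' g1 (fun a ha ha' => by
      rcases Nat.lt_succ_iff_lt_or_eq.1 ha' with ha' | rfl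
      · rw [g2 a ha ha']; exact hlt a ha ha'
      · rw [hkr, ← hbs]; exact hk)
    refine ⟨f1.congr (fun a ha => Function.update_of_ne (by omega) _ _) rfl (fun _ _ => rfl) rfl
      fun l => ?_, fun a ha ha' => ?_⟩
    · rw [or_assoc]
      refine or_congr_right ⟨?_, ?_⟩
      · rintro ⟨ρ, h1, h2, h3, h4⟩
        rcases Nat.lt_succ_iff_lt_or_eq.1 h2 with h2 | h2
        · exact .inl ⟨ρ, h1, h2, h3, h4⟩
        · refine .inr ⟨ρ, fun a ha ha' => ?_, h3, h4⟩
          rcases Nat.lt_succ_iff_lt_or_eq.1 ha' with ha' | rfl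
          · rw [g2 a ha ha', h1 a ha ha']
          · rw [h2, hkr]
      · rintro (⟨ρ, h1, h2, h3, h4⟩ | ⟨ρ, h1, h3, h4⟩)
        · exact ⟨ρ, h1, by omega, h3, h4⟩
        · refine ⟨ρ, fun a ha ha' => ?_, ?_, h3, h4⟩
          · rw [h1 a ha (by omega), g2 a ha ha']
          · rw [h1 r hr (by omega), hkr]
            exact Nat.lt_succ_self k
    · refine (Function.update_of_ne (by omega) _ _).trans ?_
      rw [f2 a ha (by omega), g2 a ha ha']

theorem searches_search (m : ℕ → ℝ) (N : ℕ) : Searches m N 10 search := by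
  unfold search
  repeat' refine Searches.loop ?_ (by decide) (by decide) rfl (by decide +kernel)
  exact searches_candidates m N

theorem good_setup {m : ℕ → ℝ} {N : ℕ} {s : State} (h0 : s.ireg 0 = N) (h1 : s.ireg 1 = 2)
    (h2 : s.ireg 2 = 8) (h7 : s.ireg 7 = 0) (hm : s.rmem = m) (him : ∀ a, s.imem a = 0)
    (ho : s.out = []) (hN : 0 < N) : Good m N (fun _ => False) (setup.sem s) := by
  rw [setup, sem_seq, sem_seq]
  set s1 := (block [.iconst 3 0]).sem s with hs1
  have q : s1.ireg 0 = N ∧ s1.ireg 1 = 2 ∧ s1.ireg 2 = 8 ∧ s1.ireg 3 = 0 ∧ s1.ireg 7 = 0 ∧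
      s1.rmem = m ∧ s1.imem = s.imem ∧ s1.out = [] := by
    simp [sem_block, Instr.apply, *]
  clear_value s1
  obtain ⟨q0, q1, q2, q3, q7, qr, qi, qo⟩ := q
  have hI := loop_induct (s := s1) (b := 0) (r := 31) (p := block [.isucc 3, .isucc 3, .isucc 3])
    rfl (fun k s' => s'.ireg 3 = 3 * k) (by simp [Instr.apply, q3]) (by
      intro k s' _ _ _ hI
      simp [sem_block, Instr.apply, hI]
      omega)
  have F := frame (.loop 0 31 (block [.isucc 3, .isucc 3, .isucc 3])) s1
  set s2 := (Cmd.loop 0 31 (block [.isucc 3, .isucc 3, .isucc 3])).sem s1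
  rw [q0] at hI
  have e0 := (F.ireg 0 rfl).trans q0
  have e1 := (F.ireg 1 rfl).trans q1
  have e2 := (F.ireg 2 rfl).trans q2
  have e7 := (F.ireg 7 rfl).trans q7
  have er := (F.rmem rfl).trans qr
  have ei := (F.imem rfl).trans qi
  have eo := (F.out rfl).trans qo
  clear_value s2
  refine ⟨by simp [sem_block, Instr.apply, e0], by simp [sem_block, Instr.apply, e1],
    by simp [sem_block, Instr.apply, e2], by simp [sem_block, Instr.apply, hI],
    by simp [sem_block, Instr.apply, hI], by simp [sem_block, Instr.apply, e7],
    by simp [sem_block, Instr.apply, er], ⟨(· = []), fun _ => 3 * N + 8,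
      IsTrie.congr (mem := s.imem) ?_ ?_, ?_⟩,
    ⟨[], List.nodup_nil, by simp [sem_block, Instr.apply, eo], by simp⟩, by simp⟩
  · have := IsTrie.empty s.imem (root := 3 * N + 8) (by omega) fun a _ => him a
    simpa [sem_block, Instr.apply, hI] using this
  · intro a _
    simp [sem_block, Instr.apply, ei]
  -- The initial trie contains only the empty word, which is not of length `N` because `N > 0`.
  · rintro l hl
    simp only [iff_false]
    rintro rfl
    simp only [List.length_nil] at hl
    omega

/-- The program that lists the orthogonal equipartitions. -/
def program : Prog := .seq (.instr (.iconst 1 2)) (.seq (.instr (.iconst 2 8)) main.toProg)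

/-- The program halts in time and prints every word that is listed for some values of the loop
counters exactly once. -/
theorem program_runs : ∃ C : ℕ, ∀ (N : ℕ), 0 < N → ∀ x : Fin N → E3, ∃ t ≤ C * N ^ 7, ∃ s : State,
    program.Runs (State.input x) t s ∧ ∃ W : List (List ℕ), W.Nodup ∧ s.out = W.flatten ∧
      ∀ l, l ∈ W ↔ ∃ ρ : ℕ → ℕ, (∀ a, 10 ≤ a → a < 25 → ρ a < loopBound N a) ∧
        ListedFor (State.input x).rmem N ρ l := by
  refine ⟨main.coef + 2, fun N hN x => ?_⟩
  set s0 := (Instr.iconst 2 8).apply ((Instr.iconst 1 2).apply (State.input x)) with hs0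
  have q : s0.ireg 0 = N ∧ s0.ireg 1 = 2 ∧ s0.ireg 2 = 8 ∧ s0.ireg 7 = 0 ∧
      s0.rmem = (State.input x).rmem ∧ (∀ a, s0.imem a = 0) ∧ s0.out = [] := by
    simp [hs0, Instr.apply, State.input]
  obtain ⟨q0, q1, q2, q7, qr, qi, qo⟩ := q
  obtain ⟨t, ht, hrun⟩ := runs (N := N) main s0 wf_main q0.le (by rw [q1]; omega) q2.le
  refine ⟨1 + (1 + t), ?_, main.sem s0, .seq (.instr _ _) (.seq (.instr _ _) hrun), ?_⟩
  · have h1 : 1 ≤ N ^ 7 := Nat.one_le_pow _ _ hN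
    have h2 := ht.trans (cost_le hN main)
    rw [depth_main] at h2
    rw [add_mul]
    omega
  · have hG := good_setup q0 q1 q2 q7 qr qi qo hN
    have hS := (searches_search _ N _ _ hG (fun a h h' => by omega)).1
    obtain ⟨W, h1, h2, h3⟩ := hS.out
    refine ⟨W, h1, h2, fun l => (h3 l).trans ?_⟩
    rw [false_or]
    refine exists_congr fun ρ => ⟨fun h => h.2, fun h => ⟨fun a h h' => by omega, h⟩⟩

end RealRAM

/-! ## Three mutually orthogonal vectors under linear constraints -/

local notation "V3" => Fin 3 → ℝ

section cross

variable {a b p x y : V3}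

/-- Lagrange's identity gives `(p ⬝ᵥ p) • x - (p ⬝ᵥ x) • p = (p × x) × p`. -/
theorem exists_smul_of_cross_eq_zero (hp : p ≠ 0) (h : crossProduct p x = 0) : ∃ c : ℝ, x = c • p := by
  have hpp : p ⬝ᵥ p ≠ 0 := mt dotProduct_self_eq_zero.1 hp
  refine ⟨(p ⬝ᵥ x) / (p ⬝ᵥ p), ?_⟩
  have h0 := congrFun h 0
  have h1 := congrFun h 1
  have h2 := congrFun h 2
  simp [cross_apply] at h0 h1 h2
  have key : (p ⬝ᵥ p) • x = (p ⬝ᵥ x) • p := by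
    funext k
    simp only [Pi.smul_apply, smul_eq_mul, dotProduct, Fin.sum_univ_three]
    fin_cases k <;> simp
    · linear_combination p 2 * h1 - p 1 * h2
    · linear_combination p 0 * h2 - p 2 * h0
    · linear_combination p 1 * h0 - p 0 * h1
  rw [div_eq_inv_mul, mul_smul, ← key, smul_smul, inv_mul_cancel₀ hpp, one_smul]

/-- The identity `(a × b) × x = (a ⬝ᵥ x) • b - (b ⬝ᵥ x) • a` shows that `x` is parallel to `a × b`.
-/
theorem exists_smul_cross (h : crossProduct a b ≠ 0) (ha : x ⬝ᵥ a = 0) (hb : x ⬝ᵥ b = 0) :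
    ∃ c : ℝ, x = c • crossProduct a b := by
  refine exists_smul_of_cross_eq_zero h ?_
  simp only [dotProduct, Fin.sum_univ_three] at ha hb
  funext k
  fin_cases k <;> simp [cross_apply]
  · linear_combination b 0 * ha - a 0 * hb
  · linear_combination b 1 * ha - a 1 * hb
  · linear_combination b 2 * ha - a 2 * hb

theorem dot_cross_left (a b : V3) : crossProduct a b ⬝ᵥ a = 0 := by
  rw [dotProduct_comm, dot_self_cross]

theorem dot_cross_right (a b : V3) : crossProduct a b ⬝ᵥ b = 0 := by
  rw [dotProduct_comm, dot_cross_self]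

/-- Orthogonal nonzero vectors are not parallel. -/
theorem cross_ne_zero_of_dot (ha : a ≠ 0) (hb : b ≠ 0) (h : a ⬝ᵥ b = 0) : crossProduct a b ≠ 0 := by
  intro h0
  obtain ⟨c, rfl⟩ := exists_smul_of_cross_eq_zero ha h0
  rw [dotProduct_smul, smul_eq_mul, mul_eq_zero, dotProduct_self_eq_zero] at h
  rcases h with rfl | h
  exacts [hb (zero_smul _ _), ha h]

/-- A vector that is not orthogonal to `y` is not parallel to a vector orthogonal to `y`. -/
theorem cross_ne_zero_of_dot_ne (ha : a ≠ 0) (h : y ⬝ᵥ a = 0) (hb : y ⬝ᵥ b ≠ 0) :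
    crossProduct a b ≠ 0 := by
  intro h0
  obtain ⟨c, rfl⟩ := exists_smul_of_cross_eq_zero ha h0
  rw [dotProduct_smul, h, smul_zero] at hb
  exact hb rfl

theorem cross_comm_ne_zero (h : crossProduct a b ≠ 0) : crossProduct b a ≠ 0 := by
  rwa [← cross_anticomm, neg_ne_zero]

theorem left_ne_zero_of_cross (h : crossProduct a b ≠ 0) : a ≠ 0 := by
  rintro rfl
  simp at h

end cross

/-- Three mutually orthogonal nonzero vectors such that the vector number `i` has a nonnegative
scalar product with all vectors in `D i`. -/
structure Feasible (D : Fin 3 → Finset V3) (n : Fin 3 → V3) : Prop where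
  ne_zero : ∀ i, n i ≠ 0
  orth : ∀ i j, i ≠ j → n i ⬝ᵥ n j = 0
  nonneg : ∀ i, ∀ d ∈ D i, 0 ≤ n i ⬝ᵥ d

/-- Take the minimum of the finitely many constraint functions that become negative somewhere on the
path. It is nonnegative at the start and nonpositive at the end, so it vanishes at some `T`; there
every constraint holds and one is tight. That this one is negative elsewhere shows that it is not a
consequence of the equalities kept along the path. -/
theorem exists_feasible_of_path {D : Fin 3 → Finset V3} {f : ℝ → Fin 3 → V3}
    (hc : ∀ i, Continuous fun t => f t i) (h0 : ∀ t i, f t i ≠ 0)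
    (ho : ∀ t i j, i ≠ j → f t i ⬝ᵥ f t j = 0) (hf : ∀ i, ∀ d ∈ D i, 0 ≤ f 0 i ⬝ᵥ d)
    (hπ : ∃ i, ∃ d ∈ D i, f Real.pi i ⬝ᵥ d < 0) :
    ∃ T, Feasible D (f T) ∧ ∃ i, ∃ d ∈ D i, f T i ⬝ᵥ d = 0 ∧ ∃ t, f t i ⬝ᵥ d < 0 := by
  classical
  set E : Finset (Σ _ : Fin 3, V3) :=
    (Finset.univ.sigma D).filter fun x => ∃ t, f t x.1 ⬝ᵥ x.2 < 0 with hE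
  have hmem : ∀ i d, (⟨i, d⟩ : Σ _ : Fin 3, V3) ∈ E ↔ d ∈ D i ∧ ∃ t, f t i ⬝ᵥ d < 0 := by
    simp [hE]
  obtain ⟨i, d, hd, hneg⟩ := hπ
  have hne : E.Nonempty := ⟨⟨i, d⟩, (hmem i d).2 ⟨hd, _, hneg⟩⟩
  set g : (Σ _ : Fin 3, V3) → ℝ → ℝ := fun x t => f t x.1 ⬝ᵥ x.2 with hg
  have hgc : ∀ x, Continuous (g x) := fun x => (hc x.1).dotProduct continuous_const
  have hm : Continuous fun t => E.inf' hne fun x => g x t :=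
    Continuous.finset_inf'_apply hne fun x _ => hgc x
  have hpos : 0 ≤ E.inf' hne fun x => g x 0 := Finset.le_inf' _ _ fun x hx =>
    hf x.1 x.2 ((hmem x.1 x.2).1 hx).1
  have hlt : (E.inf' hne fun x => g x Real.pi) ≤ 0 :=
    (Finset.inf'_le (fun x => g x Real.pi) ((hmem i d).2 ⟨hd, _, hneg⟩)).trans hneg.le
  obtain ⟨T, -, hT⟩ := intermediate_value_Icc' Real.pi_pos.le hm.continuousOn ⟨hlt, hpos⟩
  simp only at hT
  obtain ⟨x, hx, hxT⟩ := Finset.exists_mem_eq_inf' hne fun x => g x T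
  refine ⟨T, ⟨h0 T, ho T, fun j e he => ?_⟩, x.1, x.2, ((hmem _ _).1 hx).1, ?_, ((hmem _ _).1 hx).2⟩
  · by_cases hje : ∃ t, f t j ⬝ᵥ e < 0
    · have := Finset.inf'_le (fun x => g x T) ((hmem j e).2 ⟨he, hje⟩)
      rw [hT] at this
      exact this
    · push Not at hje
      exact hje T
  · exact hxT.symm.trans hT

/-- The third vector is a multiple of the cross product of the other two. -/
theorem Feasible.exists_eq_smul_cross {D : Fin 3 → Finset V3} {n : Fin 3 → V3} (h : Feasible D n)
    {i j k : Fin 3} (hij : i ≠ j) (hjk : j ≠ k) (hik : i ≠ k) :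
    ∃ c : ℝ, c ≠ 0 ∧ n k = c • crossProduct (n i) (n j) := by
  obtain ⟨c, hc⟩ := exists_smul_cross
    (cross_ne_zero_of_dot (h.ne_zero i) (h.ne_zero j) (h.orth i j hij))
    (h.orth k i hik.symm) (h.orth k j hjk.symm)
  refine ⟨c, ?_, hc⟩
  rintro rfl
  exact h.ne_zero k (by rw [hc, zero_smul])

/-- Reversing the normal number `i` breaks any of its strict constraints, which supplies the
violation required at the end of the path. The frame is given by three separate curves so that `i`,
`j`, `k` can be in any order. -/
theorem Feasible.exists_of_paths {D : Fin 3 → Finset V3} {n : Fin 3 → V3} (h : Feasible D n)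
    (hD : ∀ i, ∃ d ∈ D i, n i ⬝ᵥ d ≠ 0)
    {i j k : Fin 3} (hij : i ≠ j) (hjk : j ≠ k) (hik : i ≠ k) {gi gj gk : ℝ → V3}
    (ci : Continuous gi) (cj : Continuous gj) (ck : Continuous gk)
    (ni : ∀ t, gi t ≠ 0) (nj : ∀ t, gj t ≠ 0) (nk : ∀ t, gk t ≠ 0)
    (oij : ∀ t, gi t ⬝ᵥ gj t = 0) (oik : ∀ t, gi t ⬝ᵥ gk t = 0) (ojk : ∀ t, gj t ⬝ᵥ gk t = 0)
    (zi : gi 0 = n i) (zj : gj 0 = n j) (zk : gk 0 = n k) (hπ : gi Real.pi = -n i) :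
    ∃ T n', Feasible D n' ∧ n' i = gi T ∧ n' j = gj T ∧ n' k = gk T ∧
      ((∃ e ∈ D i, n' i ⬝ᵥ e = 0 ∧ ∃ t, gi t ⬝ᵥ e ≠ 0) ∨
        (∃ e ∈ D j, n' j ⬝ᵥ e = 0 ∧ ∃ t, gj t ⬝ᵥ e ≠ 0) ∨
        ∃ e ∈ D k, n' k ⬝ᵥ e = 0 ∧ ∃ t, gk t ⬝ᵥ e ≠ 0) := by
  have hcases : ∀ l : Fin 3, l = i ∨ l = j ∨ l = k := by
    have : ∀ i j k : Fin 3, i ≠ j → j ≠ k → i ≠ k → ∀ l, l = i ∨ l = j ∨ l = k := by decide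
    exact this i j k hij hjk hik
  set f : ℝ → Fin 3 → V3 := fun t l => if l = i then gi t else if l = j then gj t else gk t with hf
  have fi : ∀ t, f t i = gi t := fun t => if_pos rfl
  have fj : ∀ t, f t j = gj t := fun t => (if_neg hij.symm).trans (if_pos rfl)
  have fk : ∀ t, f t k = gk t := fun t => (if_neg hik.symm).trans (if_neg hjk.symm)
  have f0 : f 0 = n := by
    funext l
    rcases hcases l with rfl | rfl | rfl
    exacts [(fi 0).trans zi, (fj 0).trans zj, (fk 0).trans zk]
  obtain ⟨T, hT, l, e, he, heT, t, ht⟩ := exists_feasible_of_path (D := D) (f := f)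
    (fun l => by
      rcases hcases l with rfl | rfl | rfl
      · simpa only [fi] using ci
      · simpa only [fj] using cj
      · simpa only [fk] using ck)
    (fun t l => by
      rcases hcases l with rfl | rfl | rfl
      · rw [fi]; exact ni t
      · rw [fj]; exact nj t
      · rw [fk]; exact nk t)
    (fun t l l' hl => by
      rcases hcases l with rfl | rfl | rfl <;> rcases hcases l' with rfl | rfl | rfl <;>
        first
        | exact absurd rfl hl
        | (simp only [fi, fj, fk]
           first
           | exact oij t | exact oik t | exact ojk t
           | (rw [dotProduct_comm]; first | exact oij t | exact oik t | exact ojk t)))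
    (fun l => by rw [f0]; exact h.nonneg l)
    (by
      obtain ⟨d, hd, hne⟩ := hD i
      refine ⟨i, d, hd, ?_⟩
      rw [fi, hπ, neg_dotProduct, neg_lt_zero]
      exact lt_of_le_of_ne (h.nonneg i d hd) hne.symm)
  refine ⟨T, f T, hT, fi T, fj T, fk T, ?_⟩
  rcases hcases l with rfl | rfl | rfl
  · exact .inl ⟨e, he, heT, t, by rw [fi] at ht; exact ht.ne⟩
  · exact .inr (.inl ⟨e, he, heT, t, by rw [fj] at ht; exact ht.ne⟩)
  · exact .inr (.inr ⟨e, he, heT, t, by rw [fk] at ht; exact ht.ne⟩)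

/-- A rotation about one of the vectors leads to an equality for one of the others. -/
theorem Feasible.rotate {D : Fin 3 → Finset V3} {n : Fin 3 → V3} (h : Feasible D n)
    (hD : ∀ i, ∃ d ∈ D i, n i ⬝ᵥ d ≠ 0)
    {i j k : Fin 3} (hij : i ≠ j) (hjk : j ≠ k) (hik : i ≠ k) :
    ∃ n', Feasible D n' ∧ n' k = n k ∧
      ((∃ e ∈ D i, n' i ⬝ᵥ e = 0 ∧ crossProduct (n k) e ≠ 0) ∨
        ∃ e ∈ D j, n' j ⬝ᵥ e = 0 ∧ crossProduct (n k) e ≠ 0) := by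
  obtain ⟨c, hc0, hc⟩ := h.exists_eq_smul_cross hik hjk.symm hij
  -- This curve is an ellipse in the plane orthogonal to `n k`; unit length is not needed, only that
  -- it avoids zero and ends at `-n i`.
  set g : ℝ → V3 := fun t => Real.cos t • n i + Real.sin t • crossProduct (n k) (n i) with hg
  have gc : Continuous g := by fun_prop
  have gk : ∀ t, g t ⬝ᵥ n k = 0 := fun t => by
    simp [hg, add_dotProduct, smul_dotProduct, h.orth i k hik, dot_cross_left]
  have hki := cross_ne_zero_of_dot (h.ne_zero k) (h.ne_zero i) (h.orth k i hik.symm)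
  have g0 : ∀ t, g t ≠ 0 := by
    intro t ht
    have h1 : g t ⬝ᵥ n i = Real.cos t * (n i ⬝ᵥ n i) := by
      simp [hg, add_dotProduct, smul_dotProduct, dot_cross_right]
    have h2 : g t ⬝ᵥ crossProduct (n k) (n i) =
        Real.sin t * (crossProduct (n k) (n i) ⬝ᵥ crossProduct (n k) (n i)) := by
      simp [hg, add_dotProduct, smul_dotProduct, dot_cross_self]
    rw [ht, zero_dotProduct] at h1 h2
    have h1' := (mul_eq_zero.1 h1.symm).resolve_right (mt dotProduct_self_eq_zero.1 (h.ne_zero i))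
    have h2' := (mul_eq_zero.1 h2.symm).resolve_right (mt dotProduct_self_eq_zero.1 hki)
    have := Real.sin_sq_add_cos_sq t
    rw [h1', h2'] at this
    norm_num at this
  have gx : ∀ t, crossProduct (g t) (n k) ≠ 0 := fun t =>
    cross_ne_zero_of_dot (g0 t) (h.ne_zero k) (gk t)
  have cc : Continuous fun t => c • crossProduct (g t) (n k) := by
    refine Continuous.const_smul ?_ c
    have : Continuous fun x : V3 => crossProduct x (n k) :=
      (crossProduct.flip (n k)).continuous_of_finiteDimensional
    exact this.comp gc
  -- The new tight difference is not parallel to the axis, since at some time a vector orthogonal to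
  -- the axis is not orthogonal to it.
  have par : ∀ (e y : V3), y ⬝ᵥ n k = 0 → y ⬝ᵥ e ≠ 0 → crossProduct (n k) e ≠ 0 := fun e y h1 h2 =>
    cross_ne_zero_of_dot_ne (h.ne_zero k) h1 h2
  obtain ⟨T, n', hn', e1, e2, e3, hcase⟩ := h.exists_of_paths hD hij hjk hik (gi := g)
    (gj := fun t => c • crossProduct (g t) (n k)) (gk := fun _ => n k) gc cc continuous_const g0
    (fun t => smul_ne_zero hc0 (gx t)) (fun _ => h.ne_zero k)
    (fun t => by rw [dotProduct_smul, dot_self_cross, smul_zero]) gk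
    (fun t => by rw [smul_dotProduct, dot_cross_right, smul_zero]) (by simp [hg])
    (by simp [hg, hc]) rfl (by simp [hg])
  refine ⟨n', hn', e3, ?_⟩
  rcases hcase with ⟨e, he, h1, t, h2⟩ | ⟨e, he, h1, t, h2⟩ | ⟨e, he, h1, t, h2⟩
  · exact .inl ⟨e, he, h1, par e _ (gk t) h2⟩
  · exact .inr ⟨e, he, h1, par e _ (by rw [smul_dotProduct, dot_cross_right, smul_zero]) h2⟩
  -- The axis stays fixed, so its scalar products cannot change from zero to nonzero.
  · rw [e3] at h1
    exact absurd h1 h2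

/-! ### Moving a feasible frame to a rigid one -/

open RealRAM

/-- The three vectors are determined, up to scalar factors, by few of the equalities. -/
def Rigid (D : Fin 3 → Finset V3) (n : Fin 3 → V3) : Prop :=
  ∃ i j k : Fin 3, i ≠ j ∧ j ≠ k ∧ i ≠ k ∧
    ((∃ d ∈ D i, ∃ d' ∈ D i, ∃ e ∈ D j, n i ⬝ᵥ d = 0 ∧ n i ⬝ᵥ d' = 0 ∧ n j ⬝ᵥ e = 0 ∧
        crossProduct d d' ≠ 0 ∧ crossProduct (n i) e ≠ 0) ∨
      (∃ d ∈ D i, ∃ e ∈ D j, ∃ f ∈ D k, n i ⬝ᵥ d = 0 ∧ n j ⬝ᵥ e = 0 ∧ n k ⬝ᵥ f = 0 ∧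
        crossProduct (n i) e ≠ 0 ∧ ∃ c : ℝ, ∃ ε : ℝ, (ε = 1 ∨ ε = -1) ∧
          n i = c • rootNormal ε d e f) ∨
      (∃ l, ∃ d ∈ D l, ∃ e ∈ D j, n j ⬝ᵥ e = 0 ∧ crossProduct d e ≠ 0 ∧ ∃ c : ℝ, n i = c • d))

/-- A vector `n` orthogonal to `d` such that `n × (n × e)` is orthogonal to `f` is given by a quadratic
equation. -/
theorem exists_eq_smul_rootNormal {n d e f : V3} (hde : crossProduct d e ≠ 0) (hn : n ≠ 0)
    (hnd : n ⬝ᵥ d = 0) (hef : e ⬝ᵥ f ≠ 0)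
    (h : crossProduct n (crossProduct n e) ⬝ᵥ f = 0) :
    ∃ c : ℝ, ∃ ε : ℝ, (ε = 1 ∨ ε = -1) ∧ n = c • rootNormal ε d e f := by
  set u := crossProduct d e with hu
  set w := crossProduct d u with hw
  have hd0 : d ≠ 0 := left_ne_zero_of_cross hde
  -- As `d`, `u`, `w` are mutually orthogonal, `u` and `w` span the plane orthogonal to `d`.
  obtain ⟨α, β, hαβ⟩ : ∃ α β : ℝ, n = α • u + β • w := by
    have hdd : d ⬝ᵥ d ≠ 0 := mt dotProduct_self_eq_zero.1 hd0
    have huu : u ⬝ᵥ u ≠ 0 := mt dotProduct_self_eq_zero.1 hde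
    obtain ⟨c, hc⟩ := exists_smul_cross (x := n - ((n ⬝ᵥ u) / (u ⬝ᵥ u)) • u) (a := d) (b := u)
      (cross_ne_zero_of_dot hd0 hde (dot_self_cross d e))
      (by rw [sub_dotProduct, smul_dotProduct, hnd, dot_cross_left]; simp)
      (by rw [sub_dotProduct, smul_dotProduct, smul_eq_mul, div_mul_cancel₀ _ huu, sub_self])
    exact ⟨(n ⬝ᵥ u) / (u ⬝ᵥ u), c, by rw [← hw] at hc; rw [← hc]; abel⟩
  have huu : u ⬝ᵥ u ≠ 0 := mt dotProduct_self_eq_zero.1 hde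
  -- In these coordinates the condition is a homogeneous quadratic equation in `α` and `β`, up to
  -- the nonzero factor `-(u ⬝ᵥ u)`.
  have key : crossProduct n (crossProduct n e) ⬝ᵥ f = -(u ⬝ᵥ u) *
      ((e ⬝ᵥ f) * α ^ 2 + (u ⬝ᵥ f) * (α * β) + (d ⬝ᵥ e) * (d ⬝ᵥ f) * β ^ 2) := by
    rw [hαβ, hw, hu]
    simp only [dotProduct, Fin.sum_univ_three, cross_apply, Pi.add_apply, Pi.smul_apply,
      smul_eq_mul, Matrix.cons_val_zero, Matrix.cons_val_one, Matrix.cons_val]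
    ring
  have hq := (mul_eq_zero.1 (key.symm.trans h)).resolve_left (neg_ne_zero.2 huu)
  set A := e ⬝ᵥ f with hA
  set B := u ⬝ᵥ f with hB
  set C := (d ⬝ᵥ e) * (d ⬝ᵥ f) with hC
  have hβ : β ≠ 0 := by
    rintro rfl
    have hα : α = 0 := by
      have : A * α ^ 2 = 0 := by linarith
      exact pow_eq_zero_iff (two_ne_zero) |>.1 ((mul_eq_zero.1 this).resolve_left hef)
    exact hn (by rw [hαβ, hα, zero_smul, zero_smul, add_zero])
  -- Completing the square shows that the discriminant is a square, so the real root taken by the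
  -- program is not the default value at a negative argument.
  have hsq : ((2 * A * α + B * β) / β) ^ 2 = B * B - 4 * A * C := by
    rw [div_pow, div_eq_iff (pow_ne_zero 2 hβ)]
    linear_combination 4 * A * hq
  have hsqrt : √(B * B - 4 * A * C) = |(2 * A * α + B * β) / β| := by
    rw [← hsq, Real.sqrt_sq_eq_abs]
  have hroot : ∀ ε : ℝ, ε * √(B * B - 4 * A * C) = (2 * A * α + B * β) / β →
      n = (β / (2 * A)) • rootNormal ε d e f := by
    intro ε hε
    rw [rootNormal, ← hu, ← hA, ← hB, ← hC, ← hw, hε, hαβ, smul_add, smul_smul, smul_smul]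
    congr 2
    · field_simp
      ring
    · field_simp
  rcases abs_choice ((2 * A * α + B * β) / β) with h' | h'
  · exact ⟨_, 1, .inl rfl, hroot 1 (by rw [hsqrt, h', one_mul])⟩
  · exact ⟨_, -1, .inr rfl, hroot (-1) (by rw [hsqrt, h']; ring)⟩

section

variable {D : Fin 3 → Finset V3} {n : Fin 3 → V3}

/-- With one tight difference in each plane, `n j` is parallel to `n i × e` and `n k` to `n i × (n i
× e)`, so orthogonality to `f` is the quadratic equation above. Its leading coefficient is `e ⬝ᵥ f`;
if that vanishes, some normal turns out to be parallel to a difference and the third kind of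
rigidity applies. -/
theorem Feasible.rigid_of_three (h : Feasible D n) {i j k : Fin 3} (hij : i ≠ j) (hjk : j ≠ k)
    (hik : i ≠ k) {d e f : V3} (hd : d ∈ D i) (he : e ∈ D j) (hf : f ∈ D k)
    (h0 : ∀ i, ∀ d ∈ D i, d ≠ 0) (hnd : n i ⬝ᵥ d = 0) (hne : n j ⬝ᵥ e = 0) (hnf : n k ⬝ᵥ f = 0)
    (hde : d ⬝ᵥ e ≠ 0) (hde' : crossProduct d e ≠ 0) (hx : crossProduct (n i) e ≠ 0) :
    Rigid D n := by
  by_cases hef : e ⬝ᵥ f = 0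
  · by_cases hjf : crossProduct (n j) f = 0
    · obtain ⟨c, hc⟩ := exists_smul_of_cross_eq_zero (h0 k f hf)
        (by rw [← cross_anticomm, hjf, neg_zero] : crossProduct f (n j) = 0)
      refine ⟨j, i, k, hij.symm, hik, hjk, .inr (.inr ⟨k, f, hf, d, hd, hnd, ?_, c, hc⟩)⟩
      exact cross_ne_zero_of_dot_ne (y := e) (h0 k f hf) hef (by rwa [dotProduct_comm])
    -- Both `n k` and `e` are orthogonal to the independent vectors `n j` and `f`, hence parallel.
    · obtain ⟨c, hc⟩ := exists_smul_cross hjf (h.orth k j hjk.symm) hnf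
      obtain ⟨c', hc'⟩ := exists_smul_cross hjf (by rwa [dotProduct_comm]) hef
      have hc0 : c' ≠ 0 := by
        rintro rfl
        exact h0 j e he (by rw [hc', zero_smul])
      refine ⟨k, i, j, hik.symm, hij, hjk.symm, .inr (.inr ⟨j, e, he, d, hd, hnd,
        cross_comm_ne_zero hde', c / c', ?_⟩)⟩
      rw [hc, hc', smul_smul, div_mul_cancel₀ _ hc0]
  · refine ⟨i, j, k, hij, hjk, hik, .inr (.inl ⟨d, hd, e, he, f, hf, hnd, hne, hnf, hx, ?_⟩)⟩
    refine exists_eq_smul_rootNormal hde' (h.ne_zero i) hnd hef ?_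
    obtain ⟨c, hc⟩ := exists_smul_cross hx (h.orth j i hij.symm) hne
    obtain ⟨c', hc0', hc'⟩ := h.exists_eq_smul_cross hij hjk hik
    have hc0 : c ≠ 0 := by
      rintro rfl
      exact h.ne_zero j (by rw [hc, zero_smul])
    rw [hc', hc, map_smul, smul_smul, smul_dotProduct, smul_eq_mul] at hnf
    exact (mul_eq_zero.1 hnf).resolve_left (mul_ne_zero hc0' hc0)

/-- One degree of freedom is left: turn `n i` around `d` and let `n j` follow as a multiple of `n i
× e`. This family is safe when `d ⬝ᵥ e ≠ 0`. The cases of orthogonal and of parallel `d`, `e` are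
treated separately, by a rotation about a normal parallel to `d`. -/
theorem Feasible.exists_rigid_of_two (h : Feasible D n) (h0 : ∀ i, ∀ d ∈ D i, d ≠ 0)
    (hD : ∀ (i : Fin 3) (m : V3), m ≠ 0 → ∃ d ∈ D i, m ⬝ᵥ d ≠ 0)
    {i j k : Fin 3} (hij : i ≠ j) (hjk : j ≠ k) (hik : i ≠ k) {d e : V3} (hd : d ∈ D i)
    (he : e ∈ D j) (hnd : n i ⬝ᵥ d = 0) (hne : n j ⬝ᵥ e = 0) (hx : crossProduct (n i) e ≠ 0) :
    ∃ n', Feasible D n' ∧ Rigid D n' := by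
  have hD' : ∀ i, ∃ d ∈ D i, n i ⬝ᵥ d ≠ 0 := fun i => hD i (n i) (h.ne_zero i)
  have hd0 := h0 i d hd
  have he0 := h0 j e he
  obtain ⟨σ, hσ⟩ := exists_smul_cross hx (h.orth j i hij.symm) hne
  have hσ0 : σ ≠ 0 := by
    rintro rfl
    exact h.ne_zero j (by rw [hσ, zero_smul])
  by_cases hde : d ⬝ᵥ e = 0
  -- Here `d` is orthogonal to both `n i` and `e`, as is `n j`; so `n j` is parallel to `d`, and a
  -- rotation about `n j` gives the third kind of rigidity.
  · obtain ⟨μ, hμ⟩ := exists_smul_cross hx (by rwa [dotProduct_comm]) hde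
    have hμ0 : μ ≠ 0 := by
      rintro rfl
      exact hd0 (by rw [hμ, zero_smul])
    have hjd : n j = (σ / μ) • d := by rw [hσ, hμ, smul_smul, div_mul_cancel₀ _ hμ0]
    have hpar : ∀ e', crossProduct (n j) e' ≠ 0 → crossProduct d e' ≠ 0 := by
      rintro e' he' hz
      exact he' (by rw [hjd, map_smul, LinearMap.smul_apply, hz, smul_zero])
    obtain ⟨n', hn', ej, ⟨e', he', h1, h2⟩ | ⟨e', he', h1, h2⟩⟩ := h.rotate hD' hik hjk.symm hij
    · exact ⟨n', hn', j, i, k, hij.symm, hik, hjk, .inr (.inr ⟨i, d, hd, e', he', h1,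
        hpar e' h2, σ / μ, ej.trans hjd⟩)⟩
    · exact ⟨n', hn', j, k, i, hjk, hik.symm, hij.symm, .inr (.inr ⟨i, d, hd, e', he', h1,
        hpar e' h2, σ / μ, ej.trans hjd⟩)⟩
  by_cases hde' : crossProduct d e = 0
  -- Now `d` and `e` are both parallel to `n k`. A rotation about `n k` keeps both equalities, and a
  -- third tight difference in plane `i` or `j` is independent of them.
  · obtain ⟨c, hc⟩ := exists_smul_of_cross_eq_zero hd0 hde'
    have hc0 : c ≠ 0 := by
      rintro rfl
      exact he0 (by rw [hc, zero_smul])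
    have hjd : n j ⬝ᵥ d = 0 := by
      rw [hc, dotProduct_smul, smul_eq_mul] at hne
      exact (mul_eq_zero.1 hne).resolve_left hc0
    have hxx := cross_ne_zero_of_dot (h.ne_zero i) (h.ne_zero j) (h.orth i j hij)
    obtain ⟨μ, hμ⟩ := exists_smul_cross (x := d) hxx (by rwa [dotProduct_comm])
      (by rwa [dotProduct_comm])
    obtain ⟨τ, hτ0, hτ⟩ := h.exists_eq_smul_cross hij hjk hik
    have hdk : d = (μ / τ) • n k := by rw [hτ, hμ, smul_smul, div_mul_cancel₀ _ hτ0]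
    have hek : e = (c * (μ / τ)) • n k := by rw [hc, mul_smul, ← hdk]
    have hpar : ∀ (a : ℝ) (x y : V3), x ≠ 0 → x = a • n k → crossProduct (n k) y ≠ 0 →
        crossProduct x y ≠ 0 := by
      rintro a x y hx rfl hy
      have : a ≠ 0 := by rintro rfl; exact hx (zero_smul _ _)
      rw [map_smul, LinearMap.smul_apply]
      exact smul_ne_zero this hy
    obtain ⟨n', hn', ek, hcase⟩ := h.rotate hD' hij hjk hik
    have o1 : n' i ⬝ᵥ d = 0 := by
      rw [hdk, ← ek, dotProduct_smul, hn'.orth i k hik, smul_zero]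
    have o2 : n' j ⬝ᵥ e = 0 := by
      rw [hek, ← ek, dotProduct_smul, hn'.orth j k hjk, smul_zero]
    have o3 : n' i ⬝ᵥ e = 0 := by
      rw [hek, ← ek, dotProduct_smul, hn'.orth i k hik, smul_zero]
    have o4 : n' j ⬝ᵥ d = 0 := by
      rw [hdk, ← ek, dotProduct_smul, hn'.orth j k hjk, smul_zero]
    rcases hcase with ⟨e', he', h1, h2⟩ | ⟨e', he', h1, h2⟩
    · exact ⟨n', hn', i, j, k, hij, hjk, hik, .inl ⟨d, hd, e', he', e, he, o1, h1, o2,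
        hpar _ d e' hd0 hdk h2, cross_ne_zero_of_dot (hn'.ne_zero i) he0 o3⟩⟩
    · exact ⟨n', hn', j, i, k, hij.symm, hik, hjk, .inl ⟨e, he, e', he', d, hd, o2, h1, o1,
        hpar _ e e' he0 hek h2, cross_ne_zero_of_dot (hn'.ne_zero j) hd0 o4⟩⟩
  obtain ⟨τ, hτ0, hτ⟩ := h.exists_eq_smul_cross hij hjk hik
  set g : ℝ → V3 := fun t => Real.cos t • n i + Real.sin t • crossProduct d (n i) with hg
  have gc : Continuous g := by fun_prop
  have gd : ∀ t, g t ⬝ᵥ d = 0 := fun t => by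
    simp [hg, add_dotProduct, smul_dotProduct, hnd, dot_cross_left]
  have hdi := cross_ne_zero_of_dot hd0 (h.ne_zero i) (by rwa [dotProduct_comm])
  have g0 : ∀ t, g t ≠ 0 := by
    intro t ht
    have h1 : g t ⬝ᵥ n i = Real.cos t * (n i ⬝ᵥ n i) := by
      simp [hg, add_dotProduct, smul_dotProduct, dot_cross_right]
    have h2 : g t ⬝ᵥ crossProduct d (n i) =
        Real.sin t * (crossProduct d (n i) ⬝ᵥ crossProduct d (n i)) := by
      simp [hg, add_dotProduct, smul_dotProduct, dot_cross_self]
    rw [ht, zero_dotProduct] at h1 h2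
    have h1' := (mul_eq_zero.1 h1.symm).resolve_right (mt dotProduct_self_eq_zero.1 (h.ne_zero i))
    have h2' := (mul_eq_zero.1 h2.symm).resolve_right (mt dotProduct_self_eq_zero.1 hdi)
    have := Real.sin_sq_add_cos_sq t
    rw [h1', h2'] at this
    norm_num at this
  -- The vector `g t` is orthogonal to `d` while `e` is not, so they are never parallel and the
  -- frame does not degenerate along the path.
  have gx : ∀ t, crossProduct (g t) e ≠ 0 := fun t =>
    cross_ne_zero_of_dot_ne (y := d) (g0 t) (by rw [dotProduct_comm]; exact gd t) hde
  set gj : ℝ → V3 := fun t => σ • crossProduct (g t) e with hgj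
  have gjc : Continuous gj := by
    have : Continuous fun x : V3 => crossProduct x e :=
      (crossProduct.flip e).continuous_of_finiteDimensional
    exact (this.comp gc).const_smul σ
  have gj0 : ∀ t, gj t ≠ 0 := fun t => smul_ne_zero hσ0 (gx t)
  have gij : ∀ t, g t ⬝ᵥ gj t = 0 := fun t => by rw [hgj, dotProduct_smul, dot_self_cross, smul_zero]
  have gje : ∀ t, gj t ⬝ᵥ e = 0 := fun t => by rw [hgj, smul_dotProduct, dot_cross_right, smul_zero]
  set gk : ℝ → V3 := fun t => τ • crossProduct (g t) (gj t) with hgk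
  have gkc : Continuous gk := by
    refine Continuous.const_smul ?_ τ
    simp only [cross_apply]
    fun_prop
  have z0 : g 0 = n i := by simp [hg]
  have z1 : gj 0 = n j := by simp only [hgj, z0]; exact hσ.symm
  obtain ⟨T, n', hn', e1, e2, -, hcase⟩ := h.exists_of_paths hD' hij hjk hik (gi := g) (gj := gj)
    (gk := gk) gc gjc gkc g0 gj0
    (fun t => smul_ne_zero hτ0 (cross_ne_zero_of_dot (g0 t) (gj0 t) (gij t))) gij
    (fun t => by rw [hgk, dotProduct_smul, dot_self_cross, smul_zero])
    (fun t => by rw [hgk, dotProduct_smul, dot_cross_self, smul_zero])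
    z0 z1
    (by rw [hτ, ← z1, ← z0]) (by simp [hg])
  refine ⟨n', hn', ?_⟩
  have o1 : n' i ⬝ᵥ d = 0 := e1 ▸ gd T
  have o2 : n' j ⬝ᵥ e = 0 := e2 ▸ gje T
  have o3 : crossProduct (n' i) e ≠ 0 := e1 ▸ gx T
  -- A second equality in plane `i` or `j` is independent of the first, because the first one holds
  -- along the whole path and the new one does not. One in plane `k` leads to the quadratic
  -- equation.
  rcases hcase with ⟨e', he', h1, t, h2⟩ | ⟨e', he', h1, t, h2⟩ | ⟨f, hf, h1, -⟩
  · exact ⟨i, j, k, hij, hjk, hik, .inl ⟨d, hd, e', he', e, he, o1, h1, o2,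
      cross_ne_zero_of_dot_ne hd0 (gd t) h2, o3⟩⟩
  · refine ⟨j, i, k, hij.symm, hik, hjk, .inl ⟨e, he, e', he', d, hd, o2, h1, o1,
      cross_ne_zero_of_dot_ne he0 (gje t) h2, ?_⟩⟩
    exact cross_ne_zero_of_dot_ne (y := e) (hn'.ne_zero j) (by rwa [dotProduct_comm])
      (by rwa [dotProduct_comm])
  · exact hn'.rigid_of_three hij hjk hik hd he hf h0 o1 o2 h1 hde hde' o3

/-- The constraints can be satisfied by three vectors that are determined by few equalities. -/
theorem Feasible.exists_rigid (h : Feasible D n) (h0 : ∀ i, ∀ d ∈ D i, d ≠ 0)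
    (hD : ∀ (i : Fin 3) (m : V3), m ≠ 0 → ∃ d ∈ D i, m ⬝ᵥ d ≠ 0) :
    ∃ n', Feasible D n' ∧ Rigid D n' := by
  -- A rotation about `n i` preserves the equality for `n i` and yields a second one in another
  -- plane.
  have key : ∀ {n : Fin 3 → V3} {i j k : Fin 3}, Feasible D n → i ≠ j → j ≠ k → i ≠ k →
      (∃ d ∈ D i, n i ⬝ᵥ d = 0) → ∃ n', Feasible D n' ∧ Rigid D n' := by
    rintro n i j k h hij hjk hik ⟨d, hd, hnd⟩
    obtain ⟨n', hn', ei, ⟨e, he, h1, h2⟩ | ⟨e, he, h1, h2⟩⟩ :=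
      h.rotate (fun i => hD i (n i) (h.ne_zero i)) hjk hik.symm hij.symm
    · exact hn'.exists_rigid_of_two h0 hD hij hjk hik hd he (ei ▸ hnd) h1 (ei ▸ h2)
    · exact hn'.exists_rigid_of_two h0 hD hik hjk.symm hij hd he (ei ▸ hnd) h1 (ei ▸ h2)
  obtain ⟨n', hn', -, ⟨d, hd, h1, -⟩ | ⟨d, hd, h1, -⟩⟩ :=
    h.rotate (i := 0) (j := 1) (k := 2) (fun i => hD i (n i) (h.ne_zero i)) (by decide) (by decide)
      (by decide)
  · exact key hn' (i := 0) (j := 1) (k := 2) (by decide) (by decide) (by decide) ⟨d, hd, h1⟩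
  · exact key hn' (i := 1) (j := 0) (k := 2) (by decide) (by decide) (by decide) ⟨d, hd, h1⟩

end

/-! ### From rigid frames to planes through six points -/

section

variable {ι : Type*} {y : ι → V3} {s : Fin 3 → ι → Bool} {n : Fin 3 → V3}

/-- The plane with the normal `n i` through the point `y o` has the prescribed points on its two
sides. -/
def Separates (y : ι → V3) (s : Fin 3 → ι → Bool) (n : Fin 3 → V3) (i : Fin 3) (o : ι) : Prop :=
  ∀ j, (s i j = true → n i ⬝ᵥ y o ≤ n i ⬝ᵥ y j) ∧ (s i j = false → n i ⬝ᵥ y j ≤ n i ⬝ᵥ y o)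

/-- Every point is on the side of the plane with the normal `m` through `y o` that belongs to its
sign, where `b` is the sign of the positive side. -/
theorem Separates.sign {i : Fin 3} {o : ι} (h : Separates y s n i o) {m : V3} {c : ℝ} (hc : c ≠ 0)
    (hm : n i = c • m) : ∃ b : Bool, ∀ j, (0 < m ⬝ᵥ y j - m ⬝ᵥ y o → s i j = b) ∧
      (m ⬝ᵥ y j - m ⬝ᵥ y o < 0 → s i j = !b) := by
  have h' : ∀ j, (s i j = true → 0 ≤ c * (m ⬝ᵥ y j - m ⬝ᵥ y o)) ∧
      (s i j = false → c * (m ⬝ᵥ y j - m ⬝ᵥ y o) ≤ 0) := by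
    intro j
    obtain ⟨h1, h2⟩ := h j
    rw [hm, smul_dotProduct, smul_dotProduct, smul_eq_mul, smul_eq_mul] at h1 h2
    rw [mul_sub]
    exact ⟨fun hs => sub_nonneg.2 (h1 hs), fun hs => sub_nonpos.2 (h2 hs)⟩
  rcases lt_or_gt_of_ne hc with hc | hc
  · refine ⟨false, fun j => ⟨fun hp => ?_, fun hp => ?_⟩⟩
    · by_contra hs
      exact absurd ((h' j).1 (by simpa using hs)) (not_le.2 (mul_neg_of_neg_of_pos hc hp))
    · by_contra hs
      exact absurd ((h' j).2 (by simpa using hs)) (not_le.2 (mul_pos_of_neg_of_neg hc hp))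
  · refine ⟨true, fun j => ⟨fun hp => ?_, fun hp => ?_⟩⟩
    · by_contra hs
      exact absurd ((h' j).2 (by simpa using hs)) (not_le.2 (mul_pos hc hp))
    · by_contra hs
      exact absurd ((h' j).1 (by simpa using hs)) (not_le.2 (mul_neg_of_pos_of_neg hc hp))

/-- Up to their order and orientation, the planes with the normals given by `v` and `w` through the
points `q i` have the prescribed points on their sides. -/
def Realizes (y : ι → V3) (s : Fin 3 → ι → Bool) (v w : V3) (q : Fin 3 → V3) : Prop :=
  ∃ σ : Fin 3 → Fin 3, Function.Injective σ ∧ ∃ b : Fin 3 → Bool, ∀ l j,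
    (0 < normals v w l ⬝ᵥ y j - normals v w l ⬝ᵥ q l → s (σ l) j = b l) ∧
    (normals v w l ⬝ᵥ y j - normals v w l ⬝ᵥ q l < 0 → s (σ l) j = !b l)

/-- Orthogonality to `v` and to `w` forces `n j` to be parallel to `v × w`, and then `n k` to `v ×
(v × w)`. Negative factors only reverse sides, which the bits `b` absorb. -/
theorem realizes {D : Fin 3 → Finset V3} (h : Feasible D n) {i j k : Fin 3} (hij : i ≠ j)
    (hjk : j ≠ k) (hik : i ≠ k) {v w : V3} {c : ℝ} (hvw : crossProduct v w ≠ 0)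
    (hi : n i = c • v) (hj : n j ⬝ᵥ w = 0) {o0 o1 o2 : ι} (h0 : Separates y s n i o0)
    (h1 : Separates y s n j o1) (h2 : Separates y s n k o2) :
    Realizes y s v w ![y o0, y o1, y o2] := by
  have hc : c ≠ 0 := by
    rintro rfl
    exact h.ne_zero i (by rw [hi, zero_smul])
  have ov : ∀ l, l ≠ i → n l ⬝ᵥ v = 0 := by
    intro l hl
    have := h.orth l i hl
    rw [hi, dotProduct_smul, smul_eq_mul] at this
    exact (mul_eq_zero.1 this).resolve_left hc
  obtain ⟨c1, hc1⟩ := exists_smul_cross hvw (ov j hij.symm) hj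
  have hc1' : c1 ≠ 0 := by
    rintro rfl
    exact h.ne_zero j (by rw [hc1, zero_smul])
  have ow : n k ⬝ᵥ crossProduct v w = 0 := by
    have := h.orth k j hjk.symm
    rw [hc1, dotProduct_smul, smul_eq_mul] at this
    exact (mul_eq_zero.1 this).resolve_left hc1'
  have hvvw : crossProduct v (crossProduct v w) ≠ 0 :=
    cross_ne_zero_of_dot (left_ne_zero_of_cross hvw) hvw (dot_self_cross v w)
  obtain ⟨c2, hc2⟩ := exists_smul_cross hvvw (ov k hik.symm) ow
  have hc2' : c2 ≠ 0 := by
    rintro rfl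
    exact h.ne_zero k (by rw [hc2, zero_smul])
  obtain ⟨b0, hb0⟩ := h0.sign hc hi
  obtain ⟨b1, hb1⟩ := h1.sign hc1' hc1
  obtain ⟨b2, hb2⟩ := h2.sign hc2' hc2
  refine ⟨![i, j, k], ?_, ![b0, b1, b2], ?_⟩
  · intro l l' hl
    fin_cases l <;> fin_cases l' <;> simp_all
  · intro l a
    fin_cases l
    exacts [hb0 a, hb1 a, hb2 a]

variable [Fintype ι]

/-- The differences of points on the two sides. -/
noncomputable def differences (y : ι → V3) (s : Fin 3 → ι → Bool) (i : Fin 3) : Finset V3 :=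
  ((Finset.univ.filter fun j => s i j = true) ×ˢ Finset.univ.filter fun j => s i j = false).image
    fun p => y p.1 - y p.2

theorem mem_differences {i : Fin 3} {d : V3} : d ∈ differences y s i ↔
    ∃ a b, s i a = true ∧ s i b = false ∧ y a - y b = d := by
  simp [differences, and_assoc]

theorem Feasible.le (h : Feasible (differences y s) n) {i : Fin 3} {a b : ι} (ha : s i a = true)
    (hb : s i b = false) : n i ⬝ᵥ y b ≤ n i ⬝ᵥ y a := by
  have := h.nonneg i _ (mem_differences.2 ⟨a, b, ha, hb, rfl⟩)
  rwa [dotProduct_sub, sub_nonneg] at this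

/-- A tight pair attains the minimum on the positive side and the maximum on the negative side, so
the separating plane passes through both points. -/
theorem Feasible.exists_of_mem (h : Feasible (differences y s) n) {i : Fin 3} {d : V3}
    (hd : d ∈ differences y s i) (h0 : n i ⬝ᵥ d = 0) :
    ∃ a b, d = y a - y b ∧ n i ⬝ᵥ y a = n i ⬝ᵥ y b ∧ s i a = true ∧ s i b = false ∧
      Separates y s n i a ∧ Separates y s n i b := by
  obtain ⟨a, b, ha, hb, rfl⟩ := mem_differences.1 hd
  rw [dotProduct_sub, sub_eq_zero] at h0
  refine ⟨a, b, rfl, h0, ha, hb, fun j => ⟨fun hj => ?_, fun hj => ?_⟩,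
    fun j => ⟨fun hj => ?_, fun hj => ?_⟩⟩
  · rw [h0]; exact h.le hj hb
  · exact h.le ha hj
  · exact h.le hj hb
  · rw [← h0]; exact h.le ha hj

/-- A plane without a tight pair is moved to the nearest point on its positive side. -/
theorem Feasible.exists_separates (h : Feasible (differences y s) n)
    (hs : ∀ i b, ∃ j, s i j = b) (i : Fin 3) : ∃ o, Separates y s n i o := by
  obtain ⟨a, ha⟩ := hs i true
  obtain ⟨o, ho, hmin⟩ := Finset.exists_min_image (Finset.univ.filter fun j => s i j = true)
    (fun j => n i ⬝ᵥ y j) ⟨a, by simpa using ha⟩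
  refine ⟨o, fun j => ⟨fun hj => hmin j (by simpa using hj), fun hj => h.le (by simpa using ho) hj⟩⟩

/-- If three mutually orthogonal planes separate the points as prescribed, there are such planes
among those determined by six of the points. -/
theorem exists_isDetermined (hy : Function.Injective y)
    (hcop : ∀ m : V3, m ≠ 0 → ∀ c : ℝ, ∃ j, m ⬝ᵥ y j ≠ c) (hs : ∀ i b, ∃ j, s i j = b)
    (hn : ∀ i, n i ≠ 0) (ho : ∀ i j, i ≠ j → n i ⬝ᵥ n j = 0) {c : Fin 3 → ℝ}
    (ht : ∀ i j, s i j = true → c i ≤ n i ⬝ᵥ y j) (hf : ∀ i j, s i j = false → n i ⬝ᵥ y j ≤ c i) :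
    ∃ (p : ℕ → ι) (v w : V3) (q : Fin 3 → V3), IsDetermined (fun l => y (p l)) v w q ∧
      crossProduct v w ≠ 0 ∧ Realizes y s v w q := by
  have hF : Feasible (differences y s) n := ⟨hn, ho, fun i d hd => by
    obtain ⟨a, b, ha, hb, rfl⟩ := mem_differences.1 hd
    rw [dotProduct_sub, sub_nonneg]
    exact (hf i b hb).trans (ht i a ha)⟩
  obtain ⟨n, h, i, j, k, hij, hjk, hik, hcase⟩ := hF.exists_rigid (fun i d hd => by
    obtain ⟨a, b, ha, hb, rfl⟩ := mem_differences.1 hd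
    rw [sub_ne_zero]
    intro e
    rw [hy e, hb] at ha
    -- If `m` were orthogonal to all differences across plane `i`, all points would have the same
    -- scalar product with `m`, contrary to `hcop`.
    exact absurd ha (by decide)) (fun i m hm => by
    obtain ⟨a, ha⟩ := hs i true
    obtain ⟨b, hb⟩ := hs i false
    obtain ⟨j, hj⟩ := hcop m hm (m ⬝ᵥ y a)
    by_contra hall
    push Not at hall
    have key : ∀ a b, s i a = true → s i b = false → m ⬝ᵥ y a = m ⬝ᵥ y b := fun a b ha hb => by
      have := hall _ (mem_differences.2 ⟨a, b, ha, hb, rfl⟩)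
      rwa [dotProduct_sub, sub_eq_zero] at this
    cases hsj : s i j
    · exact hj (key a j ha hsj).symm
    · exact hj ((key j b hsj hb).trans (key a b ha hb).symm))
  obtain ⟨oi, hoi⟩ := h.exists_separates hs i
  obtain ⟨ok, hok⟩ := h.exists_separates hs k
  rcases hcase with ⟨d, hd, d', hd', e, he, h1, h2, h3, h4, h5⟩ |
    ⟨d, hd, e, he, f, hf, h1, h2, h3, h4, c, ε, hε, h5⟩ | ⟨l, d, hd, e, he, h1, h2, c, h3⟩
  · obtain ⟨a, b, rfl, eab, ha, hb, sa, -⟩ := h.exists_of_mem hd h1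
    obtain ⟨a', b', rfl, eab', ha', hb', sa', -⟩ := h.exists_of_mem hd' h2
    obtain ⟨a3, a4, rfl, -, -, -, s3, -⟩ := h.exists_of_mem he h3
    -- There is only one separating level for `n i` once a tight pair exists, so the two pairs lie
    -- in the same plane.
    have eaa : n i ⬝ᵥ y a = n i ⬝ᵥ y a' :=
      le_antisymm (eab.trans_le (h.le ha' hb)) (eab'.trans_le (h.le ha hb'))
    -- Three of the four points already span the plane: if `a'` and `b'` were both on the line
    -- through `a` and `b`, the two differences would be parallel. This leaves room for the
    -- remaining three of the six points.
    obtain ⟨r, hr, hrx⟩ : ∃ r, n i ⬝ᵥ y a = n i ⬝ᵥ y r ∧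
        crossProduct (y a - y b) (y a - y r) ≠ 0 := by
      by_contra! hall
      have e1 := hall a' eaa
      have e2 := hall b' (eaa.trans eab')
      apply h4
      have : y a' - y b' = (y a - y b') - (y a - y a') := by abel
      rw [this, map_sub, e1, e2, sub_zero]
    set v := crossProduct (y a - y b) (y a - y r) with hv
    obtain ⟨c, hc⟩ := exists_smul_cross hrx h1 (by rw [dotProduct_sub, hr, sub_self])
    refine ⟨fun l => ([a, b, r, a3, a4, ok] : List ι).getD l a, v, y a3 - y a4,
      ![y a, y a3, y ok], .inl ⟨rfl, rfl, rfl⟩, ?_,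
      realizes h hij hjk hik ?_ hc h3 sa s3 hok⟩ <;>
    · intro hz
      exact h5 (by rw [hc, map_smul, LinearMap.smul_apply, hz, smul_zero])
  · obtain ⟨a0, a1, rfl, -, -, -, s0, -⟩ := h.exists_of_mem hd h1
    obtain ⟨a2, a3, rfl, -, -, -, s2, -⟩ := h.exists_of_mem he h2
    obtain ⟨a4, a5, rfl, -, -, -, s4, -⟩ := h.exists_of_mem hf h3
    refine ⟨fun l => ([a0, a1, a2, a3, a4, a5] : List ι).getD l a0, _, y a2 - y a3,
      ![y a0, y a2, y a4], .inr (.inl ⟨hε.imp (fun e => ?_) (fun e => ?_), rfl, rfl⟩), ?_,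
      realizes h hij hjk hik ?_ h5 h2 s0 s2 s4⟩
    · rw [e]; rfl
    · rw [e]; rfl
    all_goals
      intro hz
      exact h4 (by rw [h5, map_smul, LinearMap.smul_apply, hz, smul_zero])
  · obtain ⟨a0, a1, -, -, rfl⟩ := mem_differences.1 hd
    obtain ⟨a4, a5, rfl, -, -, -, s4, -⟩ := h.exists_of_mem he h1
    exact ⟨fun l => ([a0, a1, oi, ok, a4, a5] : List ι).getD l a0, _, _,
      ![y oi, y a4, y ok], .inr (.inr ⟨rfl, rfl, rfl⟩), h2, realizes h hij hjk hik h2 h3 h1 hoi s4 hok⟩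

end

/-! ## The listed words are the equipartitions -/

theorem inner_eq_dotProduct (a b : E3) : inner ℝ a b = a.ofLp ⬝ᵥ b.ofLp := by
  rw [EuclideanSpace.inner_eq_star_dotProduct, dotProduct_comm, star_trivial]

/-- All differences lie in the orthogonal complement of `m`, which has dimension 2. -/
theorem coplanar_of_dotProduct_eq {m : V3} (hm : m ≠ 0) {c : ℝ} {S : Set E3}
    (h : ∀ a ∈ S, m ⬝ᵥ a.ofLp = c) : Coplanar ℝ S := by
  have hm' : (WithLp.toLp 2 m : E3) ≠ 0 := fun h0 => hm (by simpa using congrArg WithLp.ofLp h0)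
  have : Fact (Module.finrank ℝ E3 = 2 + 1) := ⟨by simp⟩
  have hle : vectorSpan ℝ S ≤ (ℝ ∙ (WithLp.toLp 2 m : E3))ᗮ := by
    rw [vectorSpan, Submodule.span_le]
    rintro _ ⟨a, ha, b, hb, rfl⟩
    rw [SetLike.mem_coe, Submodule.mem_orthogonal_singleton_iff_inner_right, inner_eq_dotProduct]
    beta_reduce
    rw [vsub_eq_sub, WithLp.ofLp_sub, dotProduct_sub, h a ha, h b hb, sub_self]
  rw [coplanar_iff_finrank_le_two]
  exact (Submodule.finrank_mono hle).trans (Submodule.finrank_orthogonal_span_singleton hm').le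

theorem normals_ne_zero {v w : V3} (h : crossProduct v w ≠ 0) (i : Fin 3) : normals v w i ≠ 0 := by
  have hv := left_ne_zero_of_cross h
  fin_cases i
  exacts [hv, h, cross_ne_zero_of_dot hv h (dot_self_cross v w)]

theorem normals_dot (v w : V3) {i j : Fin 3} (hij : i ≠ j) :
    normals v w i ⬝ᵥ normals v w j = 0 := by
  have h1 := dot_self_cross v w
  have h2 := dot_self_cross v (crossProduct v w)
  have h3 := dot_cross_self v (crossProduct v w)
  have h4 := dot_self_cross (crossProduct v w) v
  fin_cases i <;> fin_cases j <;> simp_all [normals, dotProduct_comm]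

theorem pt_input {N : ℕ} (x : Fin N → E3) (j : Fin N) : pt (State.input x).rmem j = (x j).ofLp := by
  funext k
  have h1 : (3 * (j : ℕ) + k) / 3 = j := by omega
  have h2 : (3 * (j : ℕ) + k) % 3 = k := by omega
  simp [pt, State.input, h1, h2]

theorem planeVal_input {N : ℕ} (x : Fin N → E3) (n q : V3) (j : Fin N) :
    planeVal (State.input x).rmem n q j = n ⬝ᵥ (x j).ofLp - n ⬝ᵥ q := by
  rw [planeVal, pt_input]

theorem count_eq_card_fin (p : ℕ → Prop) [DecidablePred p] (N : ℕ) :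
    Nat.count p N = (Finset.univ.filter fun j : Fin N => p j).card := by
  rw [Nat.count_eq_card_filter_range, ← Finset.card_map Fin.valEmbedding]
  congr 1
  ext a
  simp only [Finset.mem_filter, Finset.mem_range, Finset.mem_map, Finset.mem_univ, true_and,
    Fin.valEmbedding_apply]
  exact ⟨fun h => ⟨⟨a, h.1⟩, h.2, rfl⟩, fun ⟨j, h, hj⟩ => hj ▸ ⟨j.2, h⟩⟩

open Classical in
/-- At most three points on a plane can be assigned to its sides at will. -/
theorem exists_sideBit {N : ℕ} {val : ℕ → ℝ} (τ : ℕ → Bool)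
    (hp : ∀ j < N, 0 < val j → τ j = true) (hn : ∀ j < N, val j < 0 → τ j = false)
    (hc : Nat.count (fun j => val j = 0) N ≤ 3) :
    ∃ u : ℕ → ℕ, (∀ k, u k < 2) ∧
      ∀ u' : ℕ → ℕ, (∀ k < 3, u' k = u k) → ∀ j < N, 0 < sideBit u' val j ↔ τ j = true := by
  -- The bit number `k` is the desired side of the `k`-th point on the plane; by the bound on their
  -- number, the queue of three bits covers all of them.
  refine ⟨fun k => (τ (Nat.nth (fun j => val j = 0) k)).toNat, fun k => Bool.toNat_lt _, ?_⟩
  intro u' hu j hj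
  unfold sideBit
  rcases lt_trichotomy (val j) 0 with h | h | h
  · simp [h, h.not_gt, hn j hj h]
  · have hlt : Nat.count (fun j => val j = 0) j < 3 :=
      (Nat.count_strict_mono (p := fun j => val j = 0) h hj).trans_le hc
    rw [if_neg h.not_gt, if_neg h.not_lt, hu _ hlt]
    beta_reduce
    rw [Nat.nth_count (p := fun j => val j = 0) h]
    cases τ j <;> simp
  · simp [h, hp j hj h]

/-- Each label occurs `n` times or not at all; as eight labels share `8 * n` points, none is
missing. -/
theorem balanced_of_card {N n : ℕ} {f : ℕ → ℕ} (hN : N = 8 * n) (hf : ∀ j, f j < 8)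
    (h : ∀ j : Fin N, (Finset.univ.filter fun k : Fin N => f k = f j).card = n) : Balanced N f := by
  intro c hc
  have hle : ∀ c ∈ Finset.range 8, (Finset.univ.filter fun k : Fin N => f k = c).card ≤ n := by
    intro c _
    rcases (Finset.univ.filter fun k : Fin N => f k = c).eq_empty_or_nonempty with h0 | ⟨j, hj⟩
    · rw [h0, Finset.card_empty]
      exact n.zero_le
    · rw [← (Finset.mem_filter.1 hj).2]
      exact (h j).le
  have hsum : ∑ c ∈ Finset.range 8, (Finset.univ.filter fun k : Fin N => f k = c).card =
      ∑ c ∈ Finset.range 8, n := by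
    rw [← Finset.card_eq_sum_card_fiberwise fun k _ => Finset.mem_coe.2 (Finset.mem_range.2 (hf _))]
    simp [hN]
  rw [count_eq_card_fin,
    (Finset.sum_eq_sum_iff_of_le hle).1 hsum c (Finset.mem_range.2 hc), hN]

/-- Every partition of the points into two sides for each of three mutually orthogonal planes, with
equally many points in the eight octants, is listed. -/
theorem exists_listedFor {N n : ℕ} (hN : N = 8 * n) (hn0 : 0 < n) {x : Fin N → E3}
    (hx : Function.Injective x)
    (hgp : ∀ m : V3, m ≠ 0 → ∀ c, ∀ S : Finset (Fin N), S.card = 4 → ∃ j ∈ S, m ⬝ᵥ (x j).ofLp ≠ c)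
    {s : Fin 3 → Fin N → Bool}
    (hs : ∀ b : Fin 3 → Bool, (Finset.univ.filter fun j => (fun i => s i j) = b).card = n)
    {a : Fin 3 → V3} (ha : ∀ i, a i ≠ 0) (ho : ∀ i j, i ≠ j → a i ⬝ᵥ a j = 0) {c : Fin 3 → ℝ}
    (ht : ∀ i j, s i j = true → c i ≤ a i ⬝ᵥ (x j).ofLp)
    (hf : ∀ i j, s i j = false → a i ⬝ᵥ (x j).ofLp ≤ c i) :
    ∃ ρ l, (∀ a, 10 ≤ a → a < 25 → ρ a < loopBound N a) ∧ ListedFor (State.input x).rmem N ρ l ∧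
      ∀ j k : Fin N, l.getD j 0 = l.getD k 0 ↔ ∀ i, s i j = s i k := by
  obtain ⟨p, v, w, q, hd, hvw, σ, hσ, b, hb⟩ := exists_isDetermined (y := fun j => (x j).ofLp)
    (fun j k h => hx (WithLp.ofLp_injective 2 h))
    (fun m hm c => by
      obtain ⟨S, -, hS⟩ := Finset.exists_subset_card_eq
        (s := (Finset.univ : Finset (Fin N))) (n := 4) (by rw [Finset.card_fin]; omega)
      obtain ⟨j, -, hj⟩ := hgp m hm c S hS
      exact ⟨j, hj⟩)
    (fun i b => by
      obtain ⟨j, hj⟩ := Finset.card_pos.1 (hn0.trans_eq (hs fun _ => b).symm)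
      exact ⟨j, congrFun (Finset.mem_filter.1 hj).2 i⟩) ha ho ht hf
  set m := (State.input x).rmem with hm
  have hnormal : ∀ i, normals v w i ≠ 0 := normals_ne_zero hvw
  classical
  have key : ∀ i : Fin 3, ∃ u : ℕ → ℕ, (∀ k, u k < 2) ∧ ∀ u' : ℕ → ℕ, (∀ k < 3, u' k = u k) →
      ∀ j : Fin N, 0 < sideBit u' (planeVal m (normals v w i) (q i)) j ↔ s (σ i) j = b i := by
    intro i
    have hcount : Nat.count (fun j => planeVal m (normals v w i) (q i) j = 0) N ≤ 3 := by
      rw [count_eq_card_fin]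
      by_contra! hlt
      obtain ⟨S, hS, hS4⟩ := Finset.exists_subset_card_eq hlt
      obtain ⟨j, hj, hne⟩ := hgp _ (hnormal i) (normals v w i ⬝ᵥ q i) S hS4
      have h0 := (Finset.mem_filter.1 (hS hj)).2
      rw [hm, planeVal_input] at h0
      exact hne (sub_eq_zero.1 h0)
    -- The comparison with `b i` adapts the sides to the orientation of the computed normal.
    obtain ⟨u, h1, h2⟩ := exists_sideBit
      (fun j => if h : j < N then s (σ i) ⟨j, h⟩ == b i else false)
      (fun j hj h => by
        rw [hm, planeVal_input x _ _ ⟨j, hj⟩] at h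
        simp [hj, (hb i ⟨j, hj⟩).1 h])
      (fun j hj h => by
        rw [hm, planeVal_input x _ _ ⟨j, hj⟩] at h
        simp [hj, (hb i ⟨j, hj⟩).2 h]) hcount
    refine ⟨u, h1, fun u' hu' j => ?_⟩
    rw [h2 u' hu' j j.2]
    simp
  choose u hu hu' using key
  -- These are the loop counters at which the candidate is met: six point numbers, then three bits
  -- for each plane. The outer `% 3` only supplies a bound for the index.
  let ρ : ℕ → ℕ := fun r => if r < 16 then (p (r - 10) : ℕ) else
    u ⟨(r - 16) / 3 % 3, Nat.mod_lt _ (by norm_num)⟩ ((r - 16) % 3)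
  have hp : ∀ i < 6, ρ (10 + i) = p i := fun i hi => by
    simp [ρ, show 10 + i < 16 by omega]
  have hbit : ∀ (i : Fin 3) (j : Fin N),
      0 < sideBit (tieBits ρ i) (planeVal m (normals v w i) (q i)) j ↔ s (σ i) j = b i := by
    intro i
    refine hu' i _ fun k hk => ?_
    have e1 : (16 + 3 * (i : ℕ) + k - 16) / 3 % 3 = i := by omega
    have e2 : (16 + 3 * (i : ℕ) + k - 16) % 3 = k := by omega
    simp only [tieBits, ρ, hk, if_true, show ¬ 16 + 3 * (i : ℕ) + k < 16 by omega, if_false, e1, e2]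
  -- The order and orientation of the planes are lost, but the partition into octants is the same.
  have hker : ∀ j k : Fin N, pointLabel m ρ v w q j = pointLabel m ρ v w q k ↔
      ∀ i, s i j = s i k := by
    intro j k
    rw [pointLabel, pointLabel, octant_inj]
    constructor
    · intro h i
      obtain ⟨i, rfl⟩ := Finite.surjective_of_injective hσ i
      have := h i
      rw [hbit, hbit] at this
      revert this
      cases s (σ i) j <;> cases s (σ i) k <;> cases b i <;> simp
    · intro h i
      rw [hbit, hbit, h]
  refine ⟨ρ, (List.range N).map (canonLabel (pointLabel m ρ v w q)), ?_,
    ⟨v, w, q, ?_, hvw, ?_, rfl⟩, ?_⟩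
  · intro r h1 h2
    by_cases h : r < 16
    · simp [loopBound, ρ, h]
    · simp only [loopBound, ρ, h, if_false]
      exact hu _ _
  · have hpt : ∀ i < 6, pt m (ρ (10 + i)) = (x (p i)).ofLp := fun i hi => by
      rw [hp i hi, hm, pt_input]
    simp only [IsDetermined] at hd ⊢
    rwa [hpt 0 (by omega), hpt 1 (by omega), hpt 2 (by omega), hpt 3 (by omega), hpt 4 (by omega),
      hpt 5 (by omega)]
  · refine balanced_of_card hN (canonLabel_lt fun _ => octant_lt _) fun j => ?_
    rw [← hs fun i => s i j]
    congr 1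
    ext k
    simp only [Finset.mem_filter, Finset.mem_univ, true_and, canonLabel_inj, hker, funext_iff]
  · intro j k
    rw [← hker j k, ← canonLabel_inj]
    simp

/-- The word with the given letters; letters that are too large are reduced. -/
def letters (N : ℕ) (l : List ℕ) (j : Fin N) : Fin 8 := Fin.ofNat 8 (l.getD j 0)

/-! ### Words and partitions -/

section blocks

variable {N : ℕ} {x : Fin N → E3} {w w' : Fin N → Fin 8} {X : Finset E3}

theorem mem_block (hx : Function.Injective x) {c : Fin 8} {j : Fin N} :
    x j ∈ (Finset.univ.filter fun j : Fin N => w j = c).image x ↔ w j = c := by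
  rw [hx.mem_finset_image]
  simp

/-- The set of blocks determines a word up to renaming its letters. -/
theorem eq_iff_of_labelBlocks_eq (hx : Function.Injective x) (h : labelBlocks x w = labelBlocks x w')
    (j k : Fin N) : w j = w k ↔ w' j = w' k := by
  have hmem : (Finset.univ.filter fun k : Fin N => w k = w j).image x ∈ labelBlocks x w :=
    Finset.mem_image_of_mem _ (Finset.mem_univ (w j))
  rw [h] at hmem
  obtain ⟨c, -, hc⟩ := Finset.mem_image.1 hmem
  have hiff : ∀ k, w' k = c ↔ w k = w j := fun k => by
    rw [← mem_block hx (w := w'), hc, mem_block hx]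
  rw [(hiff j).2 rfl, eq_comm, ← hiff, eq_comm]

theorem labelBlocks_eq_parts (hX : ∀ a, a ∈ X ↔ ∃ j, x j = a) (hx : Function.Injective x)
    (hw : Function.Surjective w) (P : Finpartition X)
    (h : ∀ j k, w j = w k ↔ P.part (x j) = P.part (x k)) : labelBlocks x w = P.parts := by
  have hblock : ∀ j, (Finset.univ.filter fun k : Fin N => w k = w j).image x = P.part (x j) := by
    intro j
    ext a
    constructor
    · intro ha
      obtain ⟨k, hk, rfl⟩ := Finset.mem_image.1 ha
      rw [← (h k j).1 (Finset.mem_filter.1 hk).2]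
      exact P.mem_part ((hX _).2 ⟨k, rfl⟩)
    · intro ha
      obtain ⟨k, rfl⟩ := (hX a).1 (P.part_subset _ ha)
      exact (mem_block hx).2 ((h k j).2 (P.part_eq_of_mem (P.part_mem.2 ((hX _).2 ⟨j, rfl⟩)) ha))
  ext A
  constructor
  · intro hA
    obtain ⟨c, -, rfl⟩ := Finset.mem_image.1 hA
    obtain ⟨j, rfl⟩ := hw c
    rw [hblock]
    exact P.part_mem.2 ((hX _).2 ⟨j, rfl⟩)
  · intro hA
    obtain ⟨a, ha⟩ := P.nonempty_of_mem_parts hA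
    obtain ⟨j, rfl⟩ := (hX a).1 (P.le hA ha)
    rw [← P.part_eq_of_mem hA ha, ← hblock]
    exact Finset.mem_image_of_mem _ (Finset.mem_univ _)

/-- A word in which every letter occurs `n` times gives a partition into parts of `n` points, which
is an orthogonal equipartition if the parts lie in different octants. -/
theorem exists_isOrthogonalEquipartition {n : ℕ} (hn : 0 < n) (hX : ∀ a, a ∈ X ↔ ∃ j, x j = a)
    (hx : Function.Injective x) (hw : ∀ c, (Finset.univ.filter fun j => w j = c).card = n)
    {H : Fin 3 → OrientedPlane} (hH : OrientedPlane.MutuallyOrthogonal H) {s : Fin N → Fin 3 → Bool}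
    (hs : ∀ j k, s j = s k ↔ w j = w k) (hr : ∀ j, x j ∈ OrientedPlane.region H (s j)) :
    ∃ P : Finpartition X, IsOrthogonalEquipartition n P ∧ P.parts = labelBlocks x w := by
  have hsurj : Function.Surjective w := fun c => by
    obtain ⟨j, hj⟩ := Finset.card_pos.1 (hn.trans_eq (hw c).symm)
    exact ⟨j, (Finset.mem_filter.1 hj).2⟩
  set B : Fin 8 → Finset E3 := fun c => (Finset.univ.filter fun j => w j = c).image x with hB
  have hinj : Function.Injective B := by
    intro c c' h
    obtain ⟨j, rfl⟩ := hsurj c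
    have hj : x j ∈ B (w j) := (mem_block hx).2 rfl
    rw [h] at hj
    exact (mem_block hx).1 hj
  have hparts : ∀ A, A ∈ labelBlocks x w ↔ ∃ c, B c = A := fun A => by
    simp [labelBlocks, hB]
  let P : Finpartition X := Finpartition.ofExistsUnique (labelBlocks x w) (by
      intro A hA a ha
      obtain ⟨c, rfl⟩ := (hparts A).1 hA
      obtain ⟨j, -, rfl⟩ := Finset.mem_image.1 ha
      exact (hX _).2 ⟨j, rfl⟩) (by
      intro a ha
      obtain ⟨j, rfl⟩ := (hX a).1 ha
      refine ⟨B (w j), ⟨(hparts _).2 ⟨_, rfl⟩, (mem_block hx).2 rfl⟩, ?_⟩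
      rintro A ⟨hA, hj⟩
      obtain ⟨c, rfl⟩ := (hparts A).1 hA
      rw [(mem_block hx).1 hj]) (by
      intro h
      obtain ⟨c, hc⟩ := (hparts _).1 h
      obtain ⟨j, rfl⟩ := hsurj c
      have hj : x j ∈ B (w j) := (mem_block hx).2 rfl
      rw [hc] at hj
      exact Finset.notMem_empty _ hj)
  have hP : P.parts = labelBlocks x w := rfl
  choose r hrw using id hsurj
  -- Different letters lie in different octants, and there are eight of each, so the letters match
  -- the octants bijectively.
  have hbij : Function.Bijective fun c => s (r c) := by
    rw [Fintype.bijective_iff_injective_and_card]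
    refine ⟨fun c c' h => ?_, by simp⟩
    rw [← hrw c, ← hrw c']
    exact (hs _ _).1 h
  let e₁ : Fin 8 ≃ {A // A ∈ P.parts} := Equiv.ofBijective
    (fun c => ⟨B c, (hparts _).2 ⟨c, rfl⟩⟩) ⟨fun c c' h => hinj (congrArg Subtype.val h), fun A => by
      obtain ⟨c, hc⟩ := (hparts _).1 A.2
      exact ⟨c, Subtype.ext hc⟩⟩
  refine ⟨P, ⟨?_, ?_, H, hH, e₁.symm.trans (Equiv.ofBijective _ hbij), ?_⟩, hP⟩
  · rw [hP, labelBlocks, Finset.card_image_of_injective _ hinj, Finset.card_fin]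
  · intro A hA
    obtain ⟨c, rfl⟩ := (hparts A).1 hA
    rw [hB, Finset.card_image_of_injective _ hx, hw]
  · intro A
    obtain ⟨c, rfl⟩ := e₁.surjective A
    simp only [Equiv.trans_apply, Equiv.symm_apply_apply, Equiv.ofBijective_apply]
    intro a ha
    obtain ⟨j, hj, rfl⟩ := Finset.mem_image.1 (Finset.mem_coe.1 ha)
    rw [(hs (r c) j).2 ((hrw c).trans (Finset.mem_filter.1 hj).2.symm)]
    exact hr j

end blocks

/-! ### Soundness, uniqueness and completeness of the list -/

/-- The plane with the normal `n` through the point `q`. -/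
noncomputable def planeThrough (n q : V3) (hn : n ≠ 0) : OrientedPlane :=
  ⟨WithLp.toLp 2 n, n ⬝ᵥ q, fun h0 => hn (by simpa using congrArg WithLp.ofLp h0)⟩

theorem mem_closure_side_planeThrough {n q : V3} {hn : n ≠ 0} {a : E3} {b : Bool}
    (ht : b = true → n ⬝ᵥ q ≤ n ⬝ᵥ a.ofLp) (hf : b = false → n ⬝ᵥ a.ofLp ≤ n ⬝ᵥ q) :
    a ∈ closure ((planeThrough n q hn).side b) := by
  cases b
  · rw [OrientedPlane.closure_side_false, Set.mem_ofPred_eq, inner_eq_dotProduct]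
    exact hf rfl
  · rw [OrientedPlane.closure_side_true, Set.mem_ofPred_eq, inner_eq_dotProduct]
    exact ht rfl

theorem nonneg_of_sideBit_pos {u : ℕ → ℕ} {val : ℕ → ℝ} {j : ℕ} (h : 0 < sideBit u val j) : 0 ≤ val j := by
  by_contra! h'
  simp [sideBit, h', h'.not_gt] at h

theorem nonpos_of_sideBit_not_pos {u : ℕ → ℕ} {val : ℕ → ℝ} {j : ℕ} (h : ¬ 0 < sideBit u val j) :
    val j ≤ 0 := by
  by_contra! h'
  simp [sideBit, h'] at h

/-- The letters of a listed word. -/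
theorem letters_map_canonLabel {N : ℕ} {r : ℕ → ℕ} (hr : ∀ k, r k < 8) (j : Fin N) :
    (letters N ((List.range N).map (canonLabel r)) j : ℕ) = canonLabel r j := by
  simp [letters, Nat.mod_eq_of_lt (canonLabel_lt hr j)]

theorem RealRAM.ListedFor.exists_canonLabel {N : ℕ} {m : ℕ → ℝ} {ρ : ℕ → ℕ} {l : List ℕ}
    (h : ListedFor m N ρ l) : ∃ r : ℕ → ℕ, l = (List.range N).map (canonLabel r) ∧
      ∀ j : Fin N, (letters N l j : ℕ) = canonLabel r j := by
  obtain ⟨v, w, q, -, -, -, rfl⟩ := h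
  exact ⟨_, rfl, letters_map_canonLabel fun _ => octant_lt _⟩

theorem RealRAM.ListedFor.card_letters {N n : ℕ} {m : ℕ → ℝ} {ρ : ℕ → ℕ} {l : List ℕ}
    (h : ListedFor m N ρ l) (hN : N = 8 * n) (c : Fin 8) :
    (Finset.univ.filter fun j => letters N l j = c).card = n := by
  obtain ⟨v, w, q, -, -, hbal, rfl⟩ := h
  have := hbal c c.2
  rw [count_eq_card_fin] at this
  simp only [Fin.ext_iff, letters_map_canonLabel (r := pointLabel m ρ v w q) fun _ => octant_lt _]
  omega

/-- Soundness: the candidate planes themselves serve as witnesses. A point on a plane lies in both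
closed half-spaces, so whatever bit it was given is admissible. -/
theorem RealRAM.ListedFor.exists_isOrthogonalEquipartition {N n : ℕ} {x : Fin N → E3} {X : Finset E3}
    {ρ : ℕ → ℕ} {l : List ℕ} (h : ListedFor (State.input x).rmem N ρ l) (hN : N = 8 * n) (hn : 0 < n)
    (hX : ∀ a, a ∈ X ↔ ∃ j, x j = a) (hx : Function.Injective x) :
    ∃ P : Finpartition X, IsOrthogonalEquipartition n P ∧ P.parts = labelBlocks x (letters N l) := by
  have hcard := h.card_letters hN
  obtain ⟨v, w, q, -, hvw, -, rfl⟩ := h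
  set m := (State.input x).rmem with hm
  have hval := letters_map_canonLabel (N := N) (r := pointLabel m ρ v w q) fun _ => octant_lt _
  refine _root_.exists_isOrthogonalEquipartition hn hX hx hcard
    (H := fun i => planeThrough (normals v w i) (q i) (normals_ne_zero hvw i)) ?_
    (s := fun j i => decide (0 < sideBit (tieBits ρ i) (planeVal m (normals v w i) (q i)) j))
    (fun j k => ?_) fun j => ?_
  · intro i j hij
    rw [inner_eq_dotProduct]
    exact normals_dot v w hij
  · rw [Fin.ext_iff, hval, hval, canonLabel_inj, pointLabel, pointLabel, octant_inj, funext_iff]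
    simp only [decide_eq_decide]
  · refine Set.mem_iInter.2 fun i => mem_closure_side_planeThrough (fun h => ?_) fun h => ?_
    · have := nonneg_of_sideBit_pos (of_decide_eq_true h)
      rwa [hm, planeVal_input, sub_nonneg] at this
    · have := nonpos_of_sideBit_not_pos (of_decide_eq_false h)
      rwa [hm, planeVal_input, sub_nonpos] at this

/-- Listed words are canonical, so a partition cannot be listed through two different words. -/
theorem RealRAM.ListedFor.eq_of_labelBlocks_eq {N : ℕ} {x : Fin N → E3} {m : ℕ → ℝ} {ρ ρ' : ℕ → ℕ}
    {l l' : List ℕ} (h : ListedFor m N ρ l) (h' : ListedFor m N ρ' l') (hx : Function.Injective x)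
    (he : labelBlocks x (letters N l) = labelBlocks x (letters N l')) : l = l' := by
  obtain ⟨r, rfl, h⟩ := h.exists_canonLabel
  obtain ⟨r', rfl, h'⟩ := h'.exists_canonLabel
  refine List.map_congr_left fun j hj => canonLabel_eq_of_iff (List.mem_range.1 hj) ?_
  intro i hi k hk
  have := eq_iff_of_labelBlocks_eq hx he ⟨i, hi⟩ ⟨k, hk⟩
  rwa [Fin.ext_iff, Fin.ext_iff, h, h, h', h', canonLabel_inj, canonLabel_inj] at this

theorem RealRAM.ListedFor.ofFn_letters {N : ℕ} {m : ℕ → ℝ} {ρ : ℕ → ℕ} {l : List ℕ} (h : ListedFor m N ρ l) :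
    (List.ofFn fun j => (letters N l j : ℕ)) = l := by
  obtain ⟨r, rfl, h⟩ := h.exists_canonLabel
  simp_rw [h]
  refine List.ext_getElem (by simp) fun i h1 h2 => ?_
  simp

/-- Every orthogonal equipartition is listed. -/
theorem IsOrthogonalEquipartition.exists_listedFor {N n : ℕ} {x : Fin N → E3} {X : Finset E3}
    {P : Finpartition X} (h : IsOrthogonalEquipartition n P) (hN : N = 8 * n) (hn : 0 < n)
    (hgp : ∀ s ⊆ X, s.card = 4 → ¬ Coplanar ℝ (s : Set E3))
    (hX : ∀ a, a ∈ X ↔ ∃ j, x j = a) (hx : Function.Injective x) :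
    ∃ ρ l, (∀ a, 10 ≤ a → a < 25 → ρ a < loopBound N a) ∧ ListedFor (State.input x).rmem N ρ l ∧
      P.parts = labelBlocks x (letters N l) := by
  obtain ⟨-, hcard, H, hH, e, he⟩ := h
  have hmem : ∀ j, P.part (x j) ∈ P.parts := fun j => P.part_mem.2 ((hX _).2 ⟨j, rfl⟩)
  have hself : ∀ j, x j ∈ P.part (x j) := fun j => P.mem_part ((hX _).2 ⟨j, rfl⟩)
  -- A point on a plane may belong to either closed region, so its sign is read off from its part
  -- and not from its position.
  set s : Fin 3 → Fin N → Bool := fun i j => e ⟨P.part (x j), hmem j⟩ i with hs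
  have hpart : ∀ j k, (∀ i, s i j = s i k) ↔ P.part (x j) = P.part (x k) := fun j k => by
    rw [hs, ← funext_iff, e.injective.eq_iff, Subtype.mk.injEq]
  have hside : ∀ i j, x j ∈ closure ((H i).side (s i j)) := fun i j =>
    Set.mem_iInter.1 (he ⟨P.part (x j), hmem j⟩ (hself j)) i
  have hex := _root_.exists_listedFor hN hn hx (s := s) (a := fun i => (H i).normal.ofLp)
    (c := fun i => (H i).offset) ?_ ?_ ?_ ?_ ?_ ?_
  · obtain ⟨ρ, l, h1, h2, h3⟩ := hex
    refine ⟨ρ, l, h1, h2, ?_⟩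
    refine (labelBlocks_eq_parts hX hx (fun c => ?_) P fun j k => ?_).symm
    · obtain ⟨j, hj⟩ := Finset.card_pos.1 (hn.trans_eq (h2.card_letters hN c).symm)
      exact ⟨j, (Finset.mem_filter.1 hj).2⟩
    · rw [← hpart, ← h3, Fin.ext_iff]
      obtain ⟨r, rfl, h⟩ := h2.exists_canonLabel
      rw [h, h]
      simp
  · intro m hm c S hS
    by_contra! hall
    refine hgp (S.image x) ?_ ((Finset.card_image_of_injective _ hx).trans hS)
      (coplanar_of_dotProduct_eq hm (c := c) fun a ha => ?_)
    · intro a ha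
      obtain ⟨j, -, rfl⟩ := Finset.mem_image.1 ha
      exact (hX _).2 ⟨j, rfl⟩
    · obtain ⟨j, hj, rfl⟩ := Finset.mem_image.1 (Finset.mem_coe.1 ha)
      exact hall j hj
  · intro b
    rw [← hcard _ (e.symm b).2, ← Finset.card_image_of_injective _ hx]
    congr 1
    ext a
    constructor
    · intro ha
      obtain ⟨j, hj, rfl⟩ := Finset.mem_image.1 ha
      rw [← (Finset.mem_filter.1 hj).2, hs]
      simp only [Equiv.symm_apply_apply]
      exact hself j
    · intro ha
      obtain ⟨j, rfl⟩ := (hX a).1 (P.le (e.symm b).2 ha)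
      refine Finset.mem_image_of_mem _ (Finset.mem_filter.2 ⟨Finset.mem_univ _, ?_⟩)
      change e ⟨P.part (x j), hmem j⟩ = b
      rw [← Equiv.eq_symm_apply]
      exact Subtype.ext (P.part_eq_of_mem (e.symm b).2 ha)
  · intro i h0
    exact (H i).normal_ne_zero (WithLp.ofLp_injective 2 h0)
  · intro i j hij
    rw [← inner_eq_dotProduct]
    exact hH i j hij
  · intro i j h
    have := hside i j
    rwa [h, OrientedPlane.closure_side_true, Set.mem_ofPred_eq, inner_eq_dotProduct] at this
  · intro i j h
    have := hside i j
    rwa [h, OrientedPlane.closure_side_false, Set.mem_ofPred_eq, inner_eq_dotProduct] at this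

theorem theorem1p3 :
    ∃ (p : RealRAM.Prog) (C : ℕ), ∀ (n : ℕ), 1 ≤ n →
      ∀ (X : Finset E3), X.card = 8 * n → InGeneralPosition X →
      ∀ (x : Fin (8 * n) ≃ {a // a ∈ X}),
      ∃ (t : ℕ) (s : RealRAM.State),
        p.Runs (RealRAM.State.input fun j => (x j : E3)) t s ∧
        t ≤ C * n ^ 7 ∧
        ∃ L : List (Finpartition X),
          L.Nodup ∧ (∀ P : Finpartition X, P ∈ L ↔ IsOrthogonalEquipartition n P) ∧
          ListsPartitions (fun j => (x j : E3)) s.out L := by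
  obtain ⟨C, hC⟩ := program_runs
  -- The factor turns the bound in `N = 8 * n` into one in `n`.
  refine ⟨program, C * 8 ^ 7, fun n hn X _ hgp x => ?_⟩
  set y : Fin (8 * n) → E3 := fun j => (x j : E3) with hy
  have hyi : Function.Injective y := Subtype.val_injective.comp x.injective
  have hX : ∀ a, a ∈ X ↔ ∃ j, y j = a := fun a =>
    ⟨fun ha => ⟨x.symm ⟨a, ha⟩, by simp [hy]⟩, fun ⟨j, hj⟩ => hj ▸ (x j).2⟩
  obtain ⟨t, ht, s, hrun, W, hW, hout, hmem⟩ := hC (8 * n) (by omega) y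
  have hex : ∀ l, ∃ P : Finpartition X, l ∈ W →
      IsOrthogonalEquipartition n P ∧ P.parts = labelBlocks y (letters (8 * n) l) := by
    intro l
    by_cases hl : l ∈ W
    · obtain ⟨ρ, -, h⟩ := (hmem l).1 hl
      obtain ⟨P, hP⟩ := h.exists_isOrthogonalEquipartition rfl hn hX hyi
      exact ⟨P, fun _ => hP⟩
    -- An arbitrary value for words that are not printed makes the choice function total.
    · exact ⟨⊥, fun h => absurd h hl⟩
  choose g hg using hex
  refine ⟨t, s, hrun, by rw [mul_assoc, ← mul_pow]; exact ht, W.map g, ?_, fun P => ?_,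
    W.map (letters (8 * n)), ?_, ?_⟩
  · refine List.Nodup.map_on (fun l hl l' hl' h => ?_) hW
    obtain ⟨ρ, -, h1⟩ := (hmem l).1 hl
    obtain ⟨ρ', -, h2⟩ := (hmem l').1 hl'
    exact h1.eq_of_labelBlocks_eq h2 hyi (by rw [← (hg l hl).2, ← (hg l' hl').2, h])
  · rw [List.mem_map]
    constructor
    · rintro ⟨l, hl, rfl⟩
      exact (hg l hl).1
    · intro hP
      obtain ⟨ρ, l, h1, h2, h3⟩ := hP.exists_listedFor rfl hn hgp.2.1 hX hyi
      have hl : l ∈ W := (hmem l).2 ⟨ρ, h1, h2⟩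
      exact ⟨l, hl, Finpartition.ext ((hg l hl).2.trans h3.symm)⟩
  · rw [hout, List.flatMap_map, List.flatten_eq_flatMap]
    refine List.flatMap_congr fun l hl => ?_
    obtain ⟨ρ, -, h⟩ := (hmem l).1 hl
    exact h.ofFn_letters.symm
  · rw [List.map_map, List.map_map]
    exact List.map_congr_left fun l hl => ((hg l hl).2).symm
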